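/- Let $k$ be an algebraically closed field of characteristic zero, $\mathfrak g$ a Lie algebra over $k$, and $H=U(\mathfrak g)[[h]]$ with its topological bialgebra structure over $k[[h]]$; tensor powers are completed, so $H^{\otimes n}=U(\mathfrak g)^{\otimes n}[[h]]$. A twisted automorphism of $H$ is a pair $(f,F)$, where $f$ is an automorphism of the $k[[h]]$-algebra $H$ and $F\in H\otimes H$ is invertible, such that $F\Delta(f(x))=(f\otimes f)(\Delta(x))F$ for all $x\in H$, $(F\otimes1)(\Delta\otimes I)(F)=(1\otimes F)(I\otimes\Delta)(F)$ and $(\varepsilon\otimes I)(F)=(I\otimes\varepsilon)(F)=1$. They form a group under $(f',F')\circ(f,F)=(f'f,\,(f'\otimes f')(F)F')$. The Cat-group $\mathcal{A}ut_{\mathbf{Tw}}(H)$ is given by the crossed module $\partial: H_\varepsilon^\times\to\{\text{twisted automorphisms}\}$, $\partial(u)=(x\mapsto uxu^{-1},\,(u\otimes u)\Delta(u)^{-1})$, where $H_\varepsilon^\times$ is the group of units $u$ with $\varepsilon(u)=1$ and $(f,F)$ acts on it by $f$. The Cat-group $\mathcal{A}ut_{bialg}(H)$ is given by the crossed module $\partial: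 G(H)\to\{\text{bialgebra automorphisms}\}$, $\partial(u)=(x\mapsto uxu^{-1})$, where $G(H)$ is the group of group-like elements with the evident action. The maps $f\mapsto(f,1)$, $u\mapsto u$ include the second crossed module into the first. For a crossed module $\partial:C\to P$ put $\pi_0=\operatorname{coker}\partial$ and $\pi_1=\ker\partial$. Its associator is the class in $H^3(\pi_0,\pi_1)$ of the cocycle $(x,y,z)\mapsto a(x,yz)\;{}^{\sigma(x)}a(y,z)\;a(x,y)^{-1}a(xy,z)^{-1}$, where $\sigma:\pi_0\to P$ is any section and $a(x,y)\in C$ are any elements with $\sigma(xy)=\partial(a(x,y))\sigma(x)\sigma(y)$. Write $Aut_{\mathbf{Tw}}=\pi_0(\mathcal{A}ut_{\mathbf{Tw}}(H))$, $Out_{bialg}=\pi_0(\mathcal{A}ut_{bialg}(H))$, let $i:Out_{bialg}\to Aut_{\mathbf{Tw}}$, $[f]\mapsto[(f,1)]$, be the induced homomorphism, and let $\phi$ and $\psi$ be the associators of $\mathcal{A}ut_{\mathbf{Tw}}(H)$ and $\mathcal{A}ut_{bialg}(H)$. Then: 1. There is exactly one group homomorphism $p:Aut_{\mathbf{Tw}}\to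 Out_{bialg}$ with $p\circ i=\mathrm{id}$ whose kernel is the set of classes of invariant twists, that is, of twisted automorphisms of the form $(\mathrm{id},F)$. 2. The inclusion $G(H)\subset H_\varepsilon^\times$ induces an isomorphism $j:\pi_1(\mathcal{A}ut_{bialg}(H))\to\pi_1(\mathcal{A}ut_{\mathbf{Tw}}(H))$ satisfying $j(p(x)\cdot c)=x\cdot j(c)$ for $x\in Aut_{\mathbf{Tw}}$, and $\phi$ is the pullback of $\psi$ along $p$: $$\phi=j_*\,p^*(\psi)\in H^3(Aut_{\mathbf{Tw}},\pi_1(\mathcal{A}ut_{\mathbf{Tw}}(H))).$$ 3. The pullback of $\phi$ along $i$ is $\psi$: $\;\psi=(j^{-1})_*\,i^*(\phi)$, where $j^{-1}$ is $Out_{bialg}$-equivariant for the action through $i$. -/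

import Mathlib

universe u v w

/-- A crossed module of groups `∂ : C → P`; it encodes a strict categorical group with group of
objects `P`. -/
structure CrossedModule (P C : Type u) [Group P] [Group C] where
  /-- the action of `P` on `C` -/
  act : P →* MulAut C
  /-- the homomorphism `∂ : C → P` -/
  bd : C →* P
  bd_act : ∀ p c, bd (act p c) = p * bd c * p⁻¹
  peiffer : ∀ c c', act (bd c) c' = c * c' * c⁻¹

namespace CrossedModule

section
variable {P C : Type u} [Group P] [Group C] (M : CrossedModule P C)

instance range_normal : M.bd.range.Normal where
  conj_mem := by
    rintro _ ⟨c, rfl⟩ p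
    exact ⟨M.act p c, M.bd_act p c⟩

/-- `π₀ = coker ∂`. -/
abbrev Pi0 : Type u := P ⧸ M.bd.range

/-- `π₁ = ker ∂`. -/
abbrev Pi1 : Type u := M.bd.ker

theorem ker_comm {c : C} (hc : M.bd c = 1) (d : C) : c * d = d * c := by
  have h := M.peiffer c d
  rw [hc, map_one, MulAut.one_apply] at h
  conv_rhs => rw [h]
  simp

instance : CommGroup M.Pi1 where
  mul_comm a b := Subtype.ext (M.ker_comm a.2 b)

/-- The action of `P` on `π₁`. -/
def actKer : P →* MulAut M.Pi1 where
  toFun p :=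
    { toFun c := ⟨M.act p c, by
        rw [MonoidHom.mem_ker, M.bd_act, MonoidHom.mem_ker.1 c.2, mul_one, mul_inv_cancel]⟩
      invFun c := ⟨M.act p⁻¹ c, by
        rw [MonoidHom.mem_ker, M.bd_act, MonoidHom.mem_ker.1 c.2, mul_one, mul_inv_cancel]⟩
      left_inv c := Subtype.ext (by simp)
      right_inv c := Subtype.ext (by simp)
      map_mul' a b := Subtype.ext (by simp) }
  map_one' := by ext; simp
  map_mul' p q := by ext; simp

/-- The induced action of `π₀` on `π₁`. -/
def pi0Act : M.Pi0 →* MulAut M.Pi1 :=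
  QuotientGroup.lift _ M.actKer (by
    rintro _ ⟨c, rfl⟩
    ext d
    change M.act (M.bd c) d = d
    rw [M.peiffer, ← M.ker_comm d.2 c, mul_inv_cancel_right])

/-- `π₁` as a module over the group `π₀`. The base ring is a copy of `ℤ` in the universe of the
groups, so that group cohomology is available. -/
def rep : Rep.{u} (ULift.{u} ℤ) M.Pi0 :=
  Rep.of (k := ULift.{u} ℤ) (G := M.Pi0) (X := Additive M.Pi1)
    { toFun x :=
        { toFun c := Additive.ofMul (M.pi0Act x c.toMul)
          map_add' a b := by simp
          map_smul' n a := by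
            change Additive.ofMul (M.pi0Act x (a.toMul ^ n.down)) = _
            rw [map_zpow]; rfl }
      map_one' := by ext; simp
      map_mul' x y := by ext; simp }

/-- The choices used to compute the associator: a section `σ` of `P → π₀` and elements `a(x, y)`
of `C` with `σ(xy) = ∂(a(x, y)) σ(x) σ(y)`. -/
structure Choice where
  sec : M.Pi0 → P
  mk_sec : ∀ x, (sec x : M.Pi0) = x
  a : M.Pi0 → M.Pi0 → C
  sec_mul : ∀ x y, sec (x * y) = M.bd (a x y) * sec x * sec y

theorem nonempty_choice : Nonempty M.Choice := by
  have h : ∀ x y : M.Pi0, ∃ c : C, M.bd c = (x * y).out * (x.out * y.out)⁻¹ := by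
    intro x y
    have : (x * y).out * (x.out * y.out)⁻¹ ∈ M.bd.range := by
      rw [← QuotientGroup.eq_one_iff]
      simp
    exact this
  choose a ha using h
  exact ⟨⟨Quotient.out, fun x => by simp, a, fun x y => by rw [ha]; simp [mul_assoc]⟩⟩

variable {M}

/-- The cochain `a(x, yz) · ^{σ(x)}a(y, z) · a(x, y)⁻¹ · a(xy, z)⁻¹`. -/
def Choice.cochain (D : M.Choice) (x y z : M.Pi0) : M.Pi1 :=
  ⟨D.a x (y * z) * M.act (D.sec x) (D.a y z) * (D.a x y)⁻¹ * (D.a (x * y) z)⁻¹, by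
    have h1 := D.sec_mul x (y * z)
    have h2 := D.sec_mul (x * y) z
    rw [D.sec_mul y z] at h1
    rw [D.sec_mul x y, mul_assoc x y z, h1] at h2
    rw [MonoidHom.mem_ker]
    simp only [map_mul, map_inv, M.bd_act]
    rw [mul_inv_eq_one, mul_inv_eq_iff_eq_mul, ← mul_left_inj (D.sec x * D.sec y * D.sec z)]
    simpa [mul_assoc] using h2⟩

theorem Choice.cochain_spec (D : M.Choice) (x y z : M.Pi0) :
    D.a x (y * z) * M.act (D.sec x) (D.a y z) =
      (D.cochain x y z : C) * D.a (x * y) z * D.a x y := by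
  simp [Choice.cochain]

theorem Choice.act_sec_mul (D : M.Choice) (x y : M.Pi0) (c : C) :
    M.act (D.sec (x * y)) c * D.a x y = D.a x y * M.act (D.sec x) (M.act (D.sec y) c) := by
  rw [D.sec_mul, map_mul, map_mul, MulAut.mul_apply, MulAut.mul_apply, M.peiffer]
  simp

theorem Choice.pi0Act_val (D : M.Choice) (x : M.Pi0) (c : M.Pi1) :
    (M.pi0Act x c : C) = M.act (D.sec x) c := by
  conv_lhs => rw [← D.mk_sec x]
  rfl

theorem Choice.cocycle (D : M.Choice) (x y z t : M.Pi0) :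
    M.pi0Act x (D.cochain y z t) * D.cochain x (y * z) t * D.cochain x y z =
      D.cochain x y (z * t) * D.cochain (x * y) z t := by
  apply Subtype.ext
  have cen : ∀ (c : M.Pi1) (d : C), (c : C) * d = d * c := fun c d => M.ker_comm c.2 d
  have way1 : D.a x (y * (z * t)) * M.act (D.sec x) (D.a y (z * t)) *
      M.act (D.sec x) (M.act (D.sec y) (D.a z t)) =
      ((M.pi0Act x (D.cochain y z t) * D.cochain x (y * z) t * D.cochain x y z : M.Pi1) : C)
        * (D.a (x * y * z) t * D.a (x * y) z * D.a x y) := by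
    rw [mul_assoc, ← map_mul, D.cochain_spec, map_mul, map_mul, ← D.pi0Act_val]
    have e1 := D.cochain_spec x (y * z) t
    have e2 := D.cochain_spec x y z
    simp only [← mul_assoc] at e1 e2 ⊢
    rw [← cen, mul_assoc _ (D.a x _) (M.act (D.sec x) (D.a (y * z) t)), e1]
    simp only [mul_assoc] at e2 ⊢
    rw [e2, ← mul_assoc (D.a (x * (y * z)) t), ← cen]
    simp [mul_assoc]
  have way2 : D.a x (y * (z * t)) * M.act (D.sec x) (D.a y (z * t)) *
      M.act (D.sec x) (M.act (D.sec y) (D.a z t)) =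
      ((D.cochain x y (z * t) * D.cochain (x * y) z t : M.Pi1) : C)
        * (D.a (x * y * z) t * D.a (x * y) z * D.a x y) := by
    rw [D.cochain_spec, mul_assoc, ← D.act_sec_mul, mul_assoc, ← mul_assoc (D.a (x * y) (z * t)),
      D.cochain_spec]
    simp [mul_assoc]
  exact mul_right_cancel (way1.symm.trans way2)

/-- The inhomogeneous `3`-cochain of a choice. -/
def Choice.cochain₃ (D : M.Choice) (g : Fin 3 → M.Pi0) : M.rep :=
  Additive.ofMul (D.cochain (g 0) (g 1) (g 2))

theorem Choice.d_cochain₃ (D : M.Choice) :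
    inhomogeneousCochains.d M.rep 3 D.cochain₃ = 0 := by
  ext g
  have h := D.cocycle (g 0) (g 1) (g 2) (g 3)
  have h' := congrArg (fun c : M.Pi1 => (Additive.ofMul c : Additive M.Pi1)) h
  simp only [ofMul_mul] at h'
  rw [inhomogeneousCochains.d_hom_apply]
  have e0 : Fin.contractNth (0 : Fin 4) (· * ·) g = ![g 0 * g 1, g 2, g 3] := by
    ext i; fin_cases i <;> rfl
  have e1 : Fin.contractNth (1 : Fin 4) (· * ·) g = ![g 0, g 1 * g 2, g 3] := by
    ext i; fin_cases i <;> rfl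
  have e2 : Fin.contractNth (2 : Fin 4) (· * ·) g = ![g 0, g 1, g 2 * g 3] := by
    ext i; fin_cases i <;> rfl
  have e3 : Fin.contractNth (3 : Fin 4) (· * ·) g = ![g 0, g 1, g 2] := by
    ext i; fin_cases i <;> rfl
  change M.rep.ρ (g 0) (D.cochain₃ fun i => g i.succ) +
    Finset.univ.sum (fun j : Fin 4 => (-1 : ULift.{u} ℤ) ^ ((j : ℕ) + 1) •
      D.cochain₃ (Fin.contractNth j (· * ·) g)) = 0
  rw [Fin.sum_univ_four, e0, e1, e2, e3]
  have t0 : M.rep.ρ (g 0) (D.cochain₃ fun i => g i.succ) =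
      D.cochain₃ ![g 0, g 1, g 2 * g 3] + D.cochain₃ ![g 0 * g 1, g 2, g 3]
        - D.cochain₃ ![g 0, g 1, g 2] - D.cochain₃ ![g 0, g 1 * g 2, g 3] := by
    rw [eq_sub_iff_add_eq, eq_sub_iff_add_eq]
    refine Eq.trans ?_ h'
    rfl
  rw [t0]
  norm_num [pow_succ]
  abel

/-- The associator: the class in `H³(π₀, π₁)` of the cocycle of a choice. -/
noncomputable def associator (D : M.Choice) : groupCohomology M.rep 3 :=
  groupCohomology.π M.rep 3 (groupCohomology.cocyclesMk D.cochain₃ D.d_cochain₃)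
end

/-- A (strict) homomorphism of crossed modules. -/
structure Hom {P C P' C' : Type u} [Group P] [Group C] [Group P'] [Group C']
    (M : CrossedModule P C) (N : CrossedModule P' C') where
  obj : P →* P'
  mor : C →* C'
  comm : ∀ c, N.bd (mor c) = obj (M.bd c)
  equivariant : ∀ p c, mor (M.act p c) = N.act (obj p) (mor c)

namespace Hom
variable {P C P' C' : Type u} [Group P] [Group C] [Group P'] [Group C']
  {M : CrossedModule P C} {N : CrossedModule P' C'} (φ : Hom M N)

/-- The induced homomorphism on `π₀`. -/
def pi0 : M.Pi0 →* N.Pi0 :=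
  QuotientGroup.map _ _ φ.obj (by
    rintro _ ⟨c, rfl⟩
    exact ⟨φ.mor c, φ.comm c⟩)

/-- The induced homomorphism on `π₁`. -/
def pi1 : M.Pi1 →* N.Pi1 :=
  (φ.mor.comp M.bd.ker.subtype).codRestrict N.bd.ker fun c => by
    change N.bd (φ.mor c) = 1
    rw [φ.comm, MonoidHom.mem_ker.1 c.2, map_one]

end Hom
end CrossedModule

namespace HAdic

open PowerSeries
open scoped TensorProduct

section basic
variable {k : Type u} [CommRing k] {A B : Type*} [Ring A] [Algebra k A] [Ring B] [Algebra k B]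

/-- For a `k`-algebra `A`, the `k⟦X⟧`-algebra structure of `A⟦X⟧` (`X` is central). -/
noncomputable instance (priority := 50) algebra : Algebra k⟦X⟧ A⟦X⟧ :=
  (PowerSeries.map (algebraMap k A)).toAlgebra' fun c x => by
    ext n
    simp only [coeff_mul, coeff_map]
    rw [← Finset.Nat.sum_antidiagonal_swap]
    exact Finset.sum_congr rfl fun _ _ => Algebra.commutes _ _

theorem algebraMap_eq (c : k⟦X⟧) :
    algebraMap k⟦X⟧ A⟦X⟧ c = PowerSeries.map (algebraMap k A) c := rfl

theorem algebraMap_X : algebraMap k⟦X⟧ A⟦X⟧ X = X := by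
  rw [algebraMap_eq, map_X]

theorem map_X_eq (f : A⟦X⟧ →ₐ[k⟦X⟧] B⟦X⟧) : f X = X := by
  rw [← algebraMap_X (k := k), f.commutes, algebraMap_X]

/-- A `k⟦X⟧`-algebra homomorphism `A⟦X⟧ → B⟦X⟧` is determined by its values on `A`. -/
theorem algHom_ext {f g : A⟦X⟧ →ₐ[k⟦X⟧] B⟦X⟧} (h : ∀ a : A, f (C a) = g (C a)) : f = g := by
  have key : ∀ (n : ℕ) (p : A⟦X⟧), X ^ n ∣ f p - g p := by
    intro n
    induction n with
    | zero => intro p; simp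
    | succ n ih =>
      intro p
      obtain ⟨q, hq⟩ := ih (PowerSeries.mk fun i => coeff (i + 1) p)
      refine ⟨q, ?_⟩
      conv_lhs => rw [eq_X_mul_shift_add_const p]
      simp only [map_add, map_mul, map_X_eq, h]
      rw [add_sub_add_right_eq_sub, ← mul_sub, hq, pow_succ', mul_assoc]
  ext p n
  obtain ⟨q, hq⟩ := key (n + 1) p
  have := congrArg (coeff n) hq
  rw [coeff_X_pow_mul', if_neg (by omega), map_sub, sub_eq_zero] at this
  exact this

theorem eq_of_X_pow_dvd {p q : A⟦X⟧} (h : ∀ n : ℕ, X ^ n ∣ p - q) : p = q := by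
  ext n
  obtain ⟨r, hr⟩ := h (n + 1)
  have := congrArg (coeff n) hr
  rw [coeff_X_pow_mul', if_neg (by omega), map_sub, sub_eq_zero] at this
  exact this

/-- The series `∑ φ(aₙ) Xⁿ` for `p = ∑ aₙ Xⁿ`. -/
noncomputable def extendFun (φ : A →ₐ[k] B⟦X⟧) (p : A⟦X⟧) : B⟦X⟧ :=
  PowerSeries.mk fun n => ∑ ij ∈ Finset.HasAntidiagonal.antidiagonal n,
    coeff ij.1 (φ (coeff ij.2 p))

theorem extendFun_add (φ : A →ₐ[k] B⟦X⟧) (p q : A⟦X⟧) :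
    extendFun φ (p + q) = extendFun φ p + extendFun φ q := by
  ext; simp [extendFun, Finset.sum_add_distrib]

theorem extendFun_C (φ : A →ₐ[k] B⟦X⟧) (a : A) : extendFun φ (C a) = φ a := by
  ext n
  rw [extendFun, coeff_mk, Finset.sum_eq_single (n, 0)]
  · simp
  · rintro ⟨i, j⟩ hij hne
    have hj : j ≠ 0 := by
      rintro rfl
      simp at hij
      exact hne (by simp [hij])
    simp [coeff_C, hj]
  · simp

theorem extendFun_X_mul (φ : A →ₐ[k] B⟦X⟧) (p : A⟦X⟧) :
    extendFun φ (X * p) = X * extendFun φ p := by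
  ext n
  cases n with
  | zero => simp [extendFun]
  | succ n =>
    rw [coeff_succ_X_mul, extendFun, extendFun, coeff_mk, coeff_mk,
      Finset.Nat.sum_antidiagonal_succ']
    simp [coeff_succ_X_mul]

theorem extendFun_mul (φ : A →ₐ[k] B⟦X⟧) (p q : A⟦X⟧) :
    extendFun φ (p * q) = extendFun φ p * extendFun φ q := by
  refine eq_of_X_pow_dvd fun n => ?_
  induction n generalizing p q with
  | zero => simp
  | succ n ih =>
    obtain ⟨p₀, p', hp⟩ : ∃ a r, p = X * r + C a := ⟨_, _, eq_X_mul_shift_add_const p⟩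
    obtain ⟨q₀, q', hq⟩ : ∃ a r, q = X * r + C a := ⟨_, _, eq_X_mul_shift_add_const q⟩
    obtain ⟨r, hr⟩ := ih p' q
    obtain ⟨s, hs⟩ := ih (C p₀) q'
    have e1 : p * q = X * (p' * q + C p₀ * q') + C (p₀ * q₀) := by
      conv_lhs => rw [hp, add_mul]
      conv_lhs => enter [2]; rw [hq]
      rw [mul_add (C p₀), ← mul_assoc (C p₀) X, (commute_X (C p₀)).eq, map_mul]
      simp only [mul_add, mul_assoc, add_assoc]
    have e2 : extendFun φ p * extendFun φ q =
        X * (extendFun φ p' * extendFun φ q + extendFun φ (C p₀) * extendFun φ q')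
          + φ (p₀ * q₀) := by
      conv_lhs => rw [hp, extendFun_add, add_mul]
      conv_lhs => enter [2]; rw [hq, extendFun_add, extendFun_X_mul]
      rw [mul_add (extendFun φ (C p₀)), ← mul_assoc (extendFun φ (C p₀)) X,
        (commute_X (extendFun φ (C p₀))).eq, extendFun_X_mul, extendFun_C, extendFun_C, map_mul]
      simp only [mul_add, mul_assoc, add_assoc]
    refine ⟨r + s, ?_⟩
    rw [e1, e2, extendFun_add, extendFun_X_mul, extendFun_add, extendFun_C,
      add_sub_add_right_eq_sub, ← mul_sub, add_sub_add_comm, hr, hs, ← mul_add, pow_succ',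
      mul_assoc]

theorem extendFun_algebraMap (φ : A →ₐ[k] B⟦X⟧) (c : k⟦X⟧) :
    extendFun φ (algebraMap k⟦X⟧ A⟦X⟧ c) = algebraMap k⟦X⟧ B⟦X⟧ c := by
  refine eq_of_X_pow_dvd fun n => ?_
  induction n generalizing c with
  | zero => simp
  | succ n ih =>
    obtain ⟨a, r, rfl⟩ : ∃ a r, c = X * r + C a := ⟨_, _, eq_X_mul_shift_add_const c⟩
    obtain ⟨s, hs⟩ := ih r
    refine ⟨s, ?_⟩
    have hC : extendFun φ (algebraMap k⟦X⟧ A⟦X⟧ (C a)) = algebraMap k⟦X⟧ B⟦X⟧ (C a) := by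
      rw [algebraMap_eq, algebraMap_eq, map_C, map_C, extendFun_C, AlgHom.commutes,
        PowerSeries.algebraMap_apply]
    rw [map_add, map_mul, algebraMap_X, extendFun_add, extendFun_X_mul, hC, map_add, map_mul,
      algebraMap_X, add_sub_add_right_eq_sub, ← mul_sub, hs, pow_succ', mul_assoc]

/-- The `k⟦X⟧`-linear extension `∑ aₙ Xⁿ ↦ ∑ φ(aₙ) Xⁿ` of an algebra homomorphism
`φ : A → B⟦X⟧`. -/
noncomputable def extend (φ : A →ₐ[k] B⟦X⟧) : A⟦X⟧ →ₐ[k⟦X⟧] B⟦X⟧ where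
  toFun := extendFun φ
  map_one' := by rw [← map_one (C (R := A)), extendFun_C, map_one]
  map_mul' := extendFun_mul φ
  map_zero' := by rw [← map_zero (C (R := A)), extendFun_C, map_zero]
  map_add' := extendFun_add φ
  commutes' := extendFun_algebraMap φ

theorem extend_C (φ : A →ₐ[k] B⟦X⟧) (a : A) : extend φ (C a) = φ a := extendFun_C φ a

/-- Coefficientwise application of an algebra homomorphism. -/
noncomputable def mapₐ (φ : A →ₐ[k] B) : A⟦X⟧ →ₐ[k⟦X⟧] B⟦X⟧ where
  __ := PowerSeries.map (φ : A →+* B)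
  commutes' c := by
    ext n
    simp [algebraMap_eq]

theorem mapₐ_apply (φ : A →ₐ[k] B) (p : A⟦X⟧) : mapₐ φ p = PowerSeries.map (φ : A →+* B) p := rfl

theorem mapₐ_C (φ : A →ₐ[k] B) (a : A) : mapₐ φ (C a) = C (φ a) := by
  simp [mapₐ_apply]

/-- The restriction to constants of a homomorphism on power series. -/
noncomputable def restrictC (f : A⟦X⟧ →ₐ[k⟦X⟧] B⟦X⟧) : A →ₐ[k] B⟦X⟧ where
  toFun a := f (C a)
  map_one' := by simp
  map_mul' := by simp
  map_zero' := by simp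
  map_add' := by simp
  commutes' c := by
    have := f.commutes (C c)
    rwa [algebraMap_eq, algebraMap_eq, map_C, map_C, ← PowerSeries.algebraMap_apply (A := B)]
      at this

theorem restrictC_apply (f : A⟦X⟧ →ₐ[k⟦X⟧] B⟦X⟧) (a : A) : restrictC f a = f (C a) := rfl

end basic

section tensor
variable {k : Type u} [CommRing k]
variable {A A' A'' B B' : Type*} [Ring A] [Algebra k A] [Ring A'] [Algebra k A']
  [Ring A''] [Algebra k A''] [Ring B] [Algebra k B] [Ring B'] [Algebra k B']

/-- The embedding `p ↦ p ⊗ 1`, `A⟦X⟧ → (A ⊗ B)⟦X⟧`. -/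
noncomputable def inl : A⟦X⟧ →ₐ[k⟦X⟧] (A ⊗[k] B)⟦X⟧ :=
  mapₐ Algebra.TensorProduct.includeLeft

/-- The embedding `p ↦ 1 ⊗ p`, `B⟦X⟧ → (A ⊗ B)⟦X⟧`. -/
noncomputable def inr : B⟦X⟧ →ₐ[k⟦X⟧] (A ⊗[k] B)⟦X⟧ :=
  mapₐ Algebra.TensorProduct.includeRight

theorem commute_inl_inr (p : A⟦X⟧) (q : B⟦X⟧) :
    Commute (inl (k := k) p : (A ⊗[k] B)⟦X⟧) (inr (k := k) q) := by
  ext n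
  simp only [coeff_mul, inl, inr, mapₐ_apply, coeff_map]
  rw [← Finset.Nat.sum_antidiagonal_swap]
  refine Finset.sum_congr rfl fun _ _ => ?_
  simp

/-- `(A ⊗ B)⟦X⟧` is the completed tensor product of `A⟦X⟧` and `B⟦X⟧`; for homomorphisms of
`k⟦X⟧`-algebras `f : A⟦X⟧ → A'⟦X⟧` and `g : B⟦X⟧ → B'⟦X⟧` this is the completed tensor product
`f ⊗ g : (A ⊗ B)⟦X⟧ → (A' ⊗ B')⟦X⟧`, the unique homomorphism of `k⟦X⟧`-algebras with
`a ⊗ b ↦ (f(a) ⊗ 1) (1 ⊗ g(b))`. -/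
noncomputable def tens (f : A⟦X⟧ →ₐ[k⟦X⟧] A'⟦X⟧) (g : B⟦X⟧ →ₐ[k⟦X⟧] B'⟦X⟧) :
    (A ⊗[k] B)⟦X⟧ →ₐ[k⟦X⟧] (A' ⊗[k] B')⟦X⟧ :=
  extend (Algebra.TensorProduct.lift
    (restrictC ((inl (k := k)).comp f))
    (restrictC ((inr (k := k)).comp g))
    fun a b => commute_inl_inr (f (C a)) (g (C b)))

theorem tens_inl (f : A⟦X⟧ →ₐ[k⟦X⟧] A'⟦X⟧) (g : B⟦X⟧ →ₐ[k⟦X⟧] B'⟦X⟧) (p : A⟦X⟧) :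
    tens f g (inl (k := k) p) = inl (k := k) (f p) := by
  refine DFunLike.congr_fun (f := (tens f g).comp (inl (k := k))) (g := (inl (k := k)).comp f)
    (algHom_ext fun a => ?_) p
  simp [tens, inl, mapₐ_C, extend_C, restrictC_apply]

theorem tens_inr (f : A⟦X⟧ →ₐ[k⟦X⟧] A'⟦X⟧) (g : B⟦X⟧ →ₐ[k⟦X⟧] B'⟦X⟧) (p : B⟦X⟧) :
    tens f g (inr (k := k) p) = inr (k := k) (g p) := by
  refine DFunLike.congr_fun (f := (tens f g).comp (inr (k := k))) (g := (inr (k := k)).comp g)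
    (algHom_ext fun a => ?_) p
  simp [tens, inr, mapₐ_C, extend_C, restrictC_apply]

theorem tensor_hom_ext {f g : (A ⊗[k] B)⟦X⟧ →ₐ[k⟦X⟧] B'⟦X⟧}
    (hl : ∀ p : A⟦X⟧, f (inl (k := k) p) = g (inl (k := k) p))
    (hr : ∀ p : B⟦X⟧, f (inr (k := k) p) = g (inr (k := k) p)) : f = g := by
  refine algHom_ext fun t => ?_
  have : restrictC f = restrictC g := by
    refine Algebra.TensorProduct.ext' fun a b => ?_
    have h : (C (a ⊗ₜ[k] b) : (A ⊗[k] B)⟦X⟧)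
        = inl (k := k) (C a) * inr (k := k) (C b) := by
      simp [inl, inr, mapₐ_C, ← map_mul]
    rw [restrictC_apply, restrictC_apply, h, map_mul, map_mul, hl, hr]
  exact DFunLike.congr_fun this t

theorem tens_comp (f : A⟦X⟧ →ₐ[k⟦X⟧] A'⟦X⟧) (g : B⟦X⟧ →ₐ[k⟦X⟧] B'⟦X⟧)
    (f' : A'⟦X⟧ →ₐ[k⟦X⟧] A⟦X⟧) (g' : B'⟦X⟧ →ₐ[k⟦X⟧] B⟦X⟧) (p) :
    tens f' g' (tens f g p) = tens (f'.comp f) (g'.comp g) p := by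
  refine DFunLike.congr_fun (f := (tens f' g').comp (tens f g)) (tensor_hom_ext ?_ ?_) p <;>
  intro p <;> simp [tens_inl, tens_inr]

theorem tens_id (p : (A ⊗[k] B)⟦X⟧) :
    tens (AlgHom.id k⟦X⟧ A⟦X⟧) (AlgHom.id k⟦X⟧ B⟦X⟧) p = p := by
  refine DFunLike.congr_fun (g := AlgHom.id _ _) (tensor_hom_ext ?_ ?_) p <;>
  intro p <;> simp [tens_inl, tens_inr]

end tensor


section bialgebra
variable {k : Type u} [CommRing k] {A : Type w} [Ring A] [Bialgebra k A]

/-- The automorphisms of the `k⟦X⟧`-algebra `A⟦X⟧`. -/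
abbrev AlgAut (k : Type u) [CommRing k] (A : Type w) [Ring A] [Bialgebra k A] : Type w :=
  A⟦X⟧ ≃ₐ[k⟦X⟧] A⟦X⟧

/-- `f ⊗ f` on `(A ⊗ A)⟦X⟧`. -/
noncomputable def sq (f : AlgAut k A) : (A ⊗[k] A)⟦X⟧ →ₐ[k⟦X⟧] (A ⊗[k] A)⟦X⟧ :=
  tens (f : A⟦X⟧ →ₐ[k⟦X⟧] A⟦X⟧) (f : A⟦X⟧ →ₐ[k⟦X⟧] A⟦X⟧)

/-- `f ⊗ f ⊗ f` on `(A ⊗ A ⊗ A)⟦X⟧`. -/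
noncomputable def cube (f : AlgAut k A) :
    (A ⊗[k] (A ⊗[k] A))⟦X⟧ →ₐ[k⟦X⟧] (A ⊗[k] (A ⊗[k] A))⟦X⟧ :=
  tens (f : A⟦X⟧ →ₐ[k⟦X⟧] A⟦X⟧) (sq f)

variable (k A) in
/-- The coproduct `Δ : A⟦X⟧ → (A ⊗ A)⟦X⟧`, extended coefficientwise. -/
noncomputable def comul : A⟦X⟧ →ₐ[k⟦X⟧] (A ⊗[k] A)⟦X⟧ := mapₐ (Bialgebra.comulAlgHom k A)

variable (k A) in
/-- The counit `ε : A⟦X⟧ → k⟦X⟧`, extended coefficientwise. -/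
noncomputable def counit : A⟦X⟧ →+* k⟦X⟧ := PowerSeries.map (Bialgebra.counitAlgHom k A : A →+* k)

variable (k A) in
/-- `ε ⊗ I : (A ⊗ A)⟦X⟧ → A⟦X⟧`. -/
noncomputable def counitL : (A ⊗[k] A)⟦X⟧ →ₐ[k⟦X⟧] A⟦X⟧ :=
  mapₐ ((Algebra.TensorProduct.lid k A).toAlgHom.comp
    (Algebra.TensorProduct.map (Bialgebra.counitAlgHom k A) (AlgHom.id k A)))

variable (k A) in
/-- `I ⊗ ε : (A ⊗ A)⟦X⟧ → A⟦X⟧`. -/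
noncomputable def counitR : (A ⊗[k] A)⟦X⟧ →ₐ[k⟦X⟧] A⟦X⟧ :=
  mapₐ ((Algebra.TensorProduct.rid k k A).toAlgHom.comp
    (Algebra.TensorProduct.map (AlgHom.id k A) (Bialgebra.counitAlgHom k A)))

variable (k A) in
/-- `F ↦ F ⊗ 1`, `(A ⊗ A)⟦X⟧ → (A ⊗ A ⊗ A)⟦X⟧`. -/
noncomputable def tensorOne : (A ⊗[k] A)⟦X⟧ →ₐ[k⟦X⟧] (A ⊗[k] (A ⊗[k] A))⟦X⟧ :=
  mapₐ (Algebra.TensorProduct.map (AlgHom.id k A) Algebra.TensorProduct.includeLeft)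

variable (k A) in
/-- `F ↦ 1 ⊗ F`, `(A ⊗ A)⟦X⟧ → (A ⊗ A ⊗ A)⟦X⟧`. -/
noncomputable def oneTensor : (A ⊗[k] A)⟦X⟧ →ₐ[k⟦X⟧] (A ⊗[k] (A ⊗[k] A))⟦X⟧ :=
  mapₐ Algebra.TensorProduct.includeRight

variable (k A) in
/-- `Δ ⊗ I : (A ⊗ A)⟦X⟧ → (A ⊗ A ⊗ A)⟦X⟧`. -/
noncomputable def comulL : (A ⊗[k] A)⟦X⟧ →ₐ[k⟦X⟧] (A ⊗[k] (A ⊗[k] A))⟦X⟧ :=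
  mapₐ ((Algebra.TensorProduct.assoc k k k A A A).toAlgHom.comp
    (Algebra.TensorProduct.map (Bialgebra.comulAlgHom k A) (AlgHom.id k A)))

variable (k A) in
/-- `I ⊗ Δ : (A ⊗ A)⟦X⟧ → (A ⊗ A ⊗ A)⟦X⟧`. -/
noncomputable def comulR : (A ⊗[k] A)⟦X⟧ →ₐ[k⟦X⟧] (A ⊗[k] (A ⊗[k] A))⟦X⟧ :=
  mapₐ (Algebra.TensorProduct.map (AlgHom.id k A) (Bialgebra.comulAlgHom k A))

/-! Elementary identities between these maps. -/

theorem sq_inl (f : AlgAut k A) (p : A⟦X⟧) : sq f (inl (k := k) p) = inl (k := k) (f p) :=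
  tens_inl _ _ p

theorem sq_inr (f : AlgAut k A) (p : A⟦X⟧) : sq f (inr (k := k) p) = inr (k := k) (f p) :=
  tens_inr _ _ p

theorem cube_inl (f : AlgAut k A) (p : A⟦X⟧) : cube f (inl (k := k) p) = inl (k := k) (f p) :=
  tens_inl _ _ p

theorem cube_inr (f : AlgAut k A) (p : (A ⊗[k] A)⟦X⟧) :
    cube f (inr (k := k) p) = inr (k := k) (sq f p) :=
  tens_inr _ _ p

theorem sq_mul (f g : AlgAut k A) (p) : sq (f * g) p = sq f (sq g p) := by
  refine DFunLike.congr_fun (g := (sq f).comp (sq g)) (tensor_hom_ext ?_ ?_) p <;>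
  intro p <;> simp [sq_inl, sq_inr]

theorem sq_one (p) : sq (1 : AlgAut k A) p = p := by
  refine DFunLike.congr_fun (g := AlgHom.id _ _) (tensor_hom_ext ?_ ?_) p <;>
  intro p <;> simp [sq_inl, sq_inr]

theorem cube_mul (f g : AlgAut k A) (p) : cube (f * g) p = cube f (cube g p) := by
  refine DFunLike.congr_fun (g := (cube f).comp (cube g)) (tensor_hom_ext ?_ ?_) p <;>
  intro p <;> simp [cube_inl, cube_inr, sq_mul]

theorem cube_one (p) : cube (1 : AlgAut k A) p = p := by
  refine DFunLike.congr_fun (g := AlgHom.id _ _) (tensor_hom_ext ?_ ?_) p <;>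
  intro p <;> simp [cube_inl, cube_inr, sq_one]

theorem map_congr_hom {B D : Type*} [Ring B] [Algebra k B] [Ring D] [Algebra k D]
    {f g : B⟦X⟧ →ₐ[k⟦X⟧] D⟦X⟧} (h : ∀ b, f (C b) = g (C b)) (p : B⟦X⟧) : f p = g p :=
  DFunLike.congr_fun (algHom_ext h) p

theorem oneTensor_eq (p : (A ⊗[k] A)⟦X⟧) : oneTensor k A p = inr (k := k) p := rfl

theorem tensorOne_inl (p : A⟦X⟧) : tensorOne k A (inl (k := k) p) = inl (k := k) p :=
  map_congr_hom (f := (tensorOne k A).comp (inl (k := k)))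
    (fun a => by simp [tensorOne, inl, mapₐ_C]; rfl) p

theorem tensorOne_inr (p : A⟦X⟧) :
    tensorOne k A (inr (k := k) p) = inr (k := k) (inl (k := k) p) :=
  map_congr_hom (f := (tensorOne k A).comp (inr (k := k)))
    (g := (inr (k := k)).comp (inl (k := k)))
    (fun a => by simp [tensorOne, inl, inr, mapₐ_C]) p

theorem comulL_inl (p : A⟦X⟧) : comulL k A (inl (k := k) p) = tensorOne k A (comul k A p) := by
  refine map_congr_hom (f := (comulL k A).comp (inl (k := k)))
    (g := (tensorOne k A).comp (comul k A)) (fun a => ?_) p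
  simp only [AlgHom.comp_apply, comulL, inl, tensorOne, comul, mapₐ_C]
  congr 1
  simp only [Algebra.TensorProduct.includeLeft_apply, Algebra.TensorProduct.map_tmul]
  induction Bialgebra.comulAlgHom k A a using TensorProduct.induction_on with
  | zero => simp
  | tmul x y => simp
  | add x y hx hy => simp [TensorProduct.add_tmul] at hx hy ⊢; rw [hx, hy]

theorem comulL_inr (p : A⟦X⟧) :
    comulL k A (inr (k := k) p) = inr (k := k) (inr (k := k) p) :=
  map_congr_hom (f := (comulL k A).comp (inr (k := k)))
    (g := (inr (k := k)).comp (inr (k := k)))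
    (fun a => by simp [comulL, inr, mapₐ_C, Algebra.TensorProduct.one_def]) p

theorem comulR_inl (p : A⟦X⟧) : comulR k A (inl (k := k) p) = inl (k := k) p :=
  map_congr_hom (f := (comulR k A).comp (inl (k := k)))
    (fun a => by simp [comulR, inl, mapₐ_C, Algebra.TensorProduct.one_def]) p

theorem comulR_inr (p : A⟦X⟧) :
    comulR k A (inr (k := k) p) = oneTensor k A (comul k A p) :=
  map_congr_hom (f := (comulR k A).comp (inr (k := k)))
    (g := (oneTensor k A).comp (comul k A))
    (fun a => by simp [comulR, oneTensor, comul, inr, mapₐ_C]) p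

theorem comul_coassoc (p : A⟦X⟧) : comulL k A (comul k A p) = comulR k A (comul k A p) := by
  refine map_congr_hom (f := (comulL k A).comp (comul k A))
    (g := (comulR k A).comp (comul k A)) (fun a => ?_) p
  simp only [AlgHom.comp_apply, comulL, comulR, comul, mapₐ_C]
  congr 1
  exact Coalgebra.coassoc_apply (R := k) a

theorem counitL_inl (p : A⟦X⟧) :
    counitL k A (inl (k := k) p) = algebraMap k⟦X⟧ A⟦X⟧ (counit k A p) := by
  ext n
  rw [algebraMap_eq, coeff_map]
  simp [counitL, inl, mapₐ_apply, counit, Algebra.algebraMap_eq_smul_one]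

theorem counitL_inr (p : A⟦X⟧) : counitL k A (inr (k := k) p) = p := by
  ext n
  simp [counitL, inr, mapₐ_apply]

theorem counitR_inl (p : A⟦X⟧) : counitR k A (inl (k := k) p) = p := by
  ext n
  simp [counitR, inl, mapₐ_apply]

theorem counitR_inr (p : A⟦X⟧) :
    counitR k A (inr (k := k) p) = algebraMap k⟦X⟧ A⟦X⟧ (counit k A p) := by
  ext n
  rw [algebraMap_eq, coeff_map]
  simp [counitR, inr, mapₐ_apply, counit, Algebra.algebraMap_eq_smul_one]

theorem counitL_comul (p : A⟦X⟧) : counitL k A (comul k A p) = p := by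
  refine map_congr_hom (f := (counitL k A).comp (comul k A)) (g := AlgHom.id _ _)
    (fun a => ?_) p
  have := Coalgebra.rTensor_counit_comul (R := k) a
  simp only [AlgHom.comp_apply, counitL, comul, mapₐ_C]
  change C (TensorProduct.lid k A ((Coalgebra.counit (R := k)).rTensor A
    (Coalgebra.comul (R := k) a))) = _
  rw [this]; simp

theorem counitR_comul (p : A⟦X⟧) : counitR k A (comul k A p) = p := by
  refine map_congr_hom (f := (counitR k A).comp (comul k A)) (g := AlgHom.id _ _)
    (fun a => ?_) p
  have := Coalgebra.lTensor_counit_comul (R := k) a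
  simp only [AlgHom.comp_apply, counitR, comul, mapₐ_C]
  change C (TensorProduct.rid k A ((Coalgebra.counit (R := k)).lTensor A
    (Coalgebra.comul (R := k) a))) = _
  rw [this]; simp

theorem counit_algebraMap (c : k⟦X⟧) : counit k A (algebraMap k⟦X⟧ A⟦X⟧ c) = c := by
  ext n
  simp [counit, algebraMap_eq]

theorem counit_counitL (t : (A ⊗[k] A)⟦X⟧) :
    counit k A (counitL k A t) = counit k A (counitR k A t) := by
  ext n
  simp only [counit, counitL, counitR, mapₐ_apply, coeff_map]
  induction coeff n t using TensorProduct.induction_on with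
  | zero => simp
  | tmul x y => simp [mul_comm]
  | add x y hx hy => simp only [map_add] at hx hy ⊢; rw [hx, hy]

theorem cube_tensorOne (f : AlgAut k A) (p) :
    cube f (tensorOne k A p) = tensorOne k A (sq f p) := by
  refine DFunLike.congr_fun (f := (cube f).comp (tensorOne k A))
    (g := (tensorOne k A).comp (sq f)) (tensor_hom_ext ?_ ?_) p <;>
  intro p <;> simp [tensorOne_inl, tensorOne_inr, sq_inl, sq_inr, cube_inl, cube_inr]

theorem cube_oneTensor (f : AlgAut k A) (p) :
    cube f (oneTensor k A p) = oneTensor k A (sq f p) := cube_inr f p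

theorem commute_tensorOne_inr (p : (A ⊗[k] A)⟦X⟧) (q : A⟦X⟧) :
    Commute (tensorOne k A p) (inr (k := k) (inr (k := k) q)) := by
  have h : ∀ (x : A ⊗[k] A) (y : A),
      Algebra.TensorProduct.map (AlgHom.id k A)
          (Algebra.TensorProduct.includeLeft : A →ₐ[k] A ⊗[k] A) x
        * ((1 : A) ⊗ₜ[k] ((1 : A) ⊗ₜ[k] y))
      = ((1 : A) ⊗ₜ[k] ((1 : A) ⊗ₜ[k] y)) * Algebra.TensorProduct.map (AlgHom.id k A)
          (Algebra.TensorProduct.includeLeft : A →ₐ[k] A ⊗[k] A) x := by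
    intro x y
    induction x using TensorProduct.induction_on with
    | zero => simp
    | tmul a b => simp
    | add a b ha hb => simp only [map_add, add_mul, mul_add, ha, hb]
  ext n
  simp only [coeff_mul, tensorOne, inr, mapₐ_apply, coeff_map]
  rw [← Finset.Nat.sum_antidiagonal_swap]
  exact Finset.sum_congr rfl fun _ _ => h _ _

theorem commute_oneTensor_inl (p : (A ⊗[k] A)⟦X⟧) (q : A⟦X⟧) :
    Commute (oneTensor k A p) (inl (k := k) q) :=
  (commute_inl_inr (k := k) q p).symm

variable (k) in
/-- Conjugation `x ↦ u x u⁻¹` by a unit `u`. -/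
noncomputable def conjAut {B : Type w} [Ring B] [Algebra k B] (u : B⟦X⟧ˣ) :
    B⟦X⟧ ≃ₐ[k⟦X⟧] B⟦X⟧ where
  toFun x := u * x * ↑u⁻¹
  invFun x := ↑u⁻¹ * x * u
  left_inv x := by simp [mul_assoc]
  right_inv x := by simp [mul_assoc]
  map_mul' x y := by simp [mul_assoc]
  map_add' x y := by simp [mul_add, add_mul]
  commutes' c := by rw [← Algebra.commutes, mul_assoc, Units.mul_inv, mul_one]

theorem conjAut_apply {B : Type w} [Ring B] [Algebra k B] (u : B⟦X⟧ˣ) (x : B⟦X⟧) :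
    conjAut k u x = u * x * ↑u⁻¹ := rfl

theorem conjAut_mul {B : Type w} [Ring B] [Algebra k B] (u v : B⟦X⟧ˣ) :
    conjAut k (u * v) = conjAut k u * conjAut k v := by
  ext1 x
  simp [conjAut_apply, mul_assoc]

/-- A twisted automorphism `(f, F)` of the topological bialgebra `A⟦X⟧`. -/
@[ext]
structure TwAut (k : Type u) [CommRing k] (A : Type w) [Ring A] [Bialgebra k A] : Type w where
  /-- the automorphism of the `k⟦X⟧`-algebra `A⟦X⟧` -/
  f : AlgAut k A
  /-- the twist, an invertible element of `(A ⊗ A)⟦X⟧` -/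
  F : ((A ⊗[k] A)⟦X⟧)ˣ
  /-- `F Δ(f(x)) = (f ⊗ f)(Δ(x)) F` -/
  conj : ∀ x, (F : (A ⊗[k] A)⟦X⟧) * comul k A (f x) = sq f (comul k A x) * F
  /-- `(F ⊗ 1) (Δ ⊗ I)(F) = (1 ⊗ F) (I ⊗ Δ)(F)` -/
  cocycle : tensorOne k A F * comulL k A F = oneTensor k A F * comulR k A F
  norm_left : counitL k A F = 1
  norm_right : counitR k A F = 1

namespace TwAut

theorem comulL_conj (f : AlgAut k A) (F : ((A ⊗[k] A)⟦X⟧)ˣ)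
    (conj : ∀ x, (F : (A ⊗[k] A)⟦X⟧) * comul k A (f x) = sq f (comul k A x) * F)
    (p : (A ⊗[k] A)⟦X⟧) :
    tensorOne k A F * comulL k A (sq f p) = cube f (comulL k A p) * tensorOne k A F := by
  let u := Units.map (tensorOne k A : (A ⊗[k] A)⟦X⟧ →* (A ⊗[k] (A ⊗[k] A))⟦X⟧) F
  have h : ((conjAut k u : _ →ₐ[k⟦X⟧] _).comp ((comulL k A).comp (sq f))) =
      (cube f).comp (comulL k A) := by
    refine tensor_hom_ext (fun p => ?_) fun p => ?_
    · have hc : (tensorOne k A (F : (A ⊗[k] A)⟦X⟧)) * tensorOne k A (comul k A (f p)) =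
          tensorOne k A (sq f (comul k A p)) * tensorOne k A F := by
        rw [← map_mul, conj, map_mul]
      simp only [AlgHom.comp_apply, sq_inl, comulL_inl, cube_tensorOne]
      change (u : (A ⊗[k] (A ⊗[k] A))⟦X⟧) * _ * ↑u⁻¹ = _
      rw [Units.mul_inv_eq_iff_eq_mul]
      exact hc
    · simp only [AlgHom.comp_apply, sq_inr, comulL_inr, cube_inr]
      change (u : (A ⊗[k] (A ⊗[k] A))⟦X⟧) * _ * ↑u⁻¹ = _
      rw [Units.mul_inv_eq_iff_eq_mul]
      exact (commute_tensorOne_inr (F : (A ⊗[k] A)⟦X⟧) (f p)).eq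
  have := DFunLike.congr_fun h p
  change (u : (A ⊗[k] (A ⊗[k] A))⟦X⟧) * _ * ↑u⁻¹ = _ at this
  rw [Units.mul_inv_eq_iff_eq_mul] at this
  exact this

theorem comulR_conj (f : AlgAut k A) (F : ((A ⊗[k] A)⟦X⟧)ˣ)
    (conj : ∀ x, (F : (A ⊗[k] A)⟦X⟧) * comul k A (f x) = sq f (comul k A x) * F)
    (p : (A ⊗[k] A)⟦X⟧) :
    oneTensor k A F * comulR k A (sq f p) = cube f (comulR k A p) * oneTensor k A F := by
  let u := Units.map (oneTensor k A : (A ⊗[k] A)⟦X⟧ →* (A ⊗[k] (A ⊗[k] A))⟦X⟧) F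
  have h : ((conjAut k u : _ →ₐ[k⟦X⟧] _).comp ((comulR k A).comp (sq f))) =
      (cube f).comp (comulR k A) := by
    refine tensor_hom_ext (fun p => ?_) fun p => ?_
    · simp only [AlgHom.comp_apply, sq_inl, comulR_inl, cube_inl]
      change (u : (A ⊗[k] (A ⊗[k] A))⟦X⟧) * _ * ↑u⁻¹ = _
      rw [Units.mul_inv_eq_iff_eq_mul]
      exact (commute_oneTensor_inl (F : (A ⊗[k] A)⟦X⟧) (f p)).eq
    · have hc : (oneTensor k A (F : (A ⊗[k] A)⟦X⟧)) * oneTensor k A (comul k A (f p)) =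
          oneTensor k A (sq f (comul k A p)) * oneTensor k A F := by
        rw [← map_mul, conj, map_mul]
      simp only [AlgHom.comp_apply, sq_inr, comulR_inr, cube_oneTensor]
      change (u : (A ⊗[k] (A ⊗[k] A))⟦X⟧) * _ * ↑u⁻¹ = _
      rw [Units.mul_inv_eq_iff_eq_mul]
      exact hc
  have := DFunLike.congr_fun h p
  change (u : (A ⊗[k] (A ⊗[k] A))⟦X⟧) * _ * ↑u⁻¹ = _ at this
  rw [Units.mul_inv_eq_iff_eq_mul] at this
  exact this

theorem counitL_sq (f : AlgAut k A) (p : (A ⊗[k] A)⟦X⟧) :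
    counitL k A (sq f p) = f (counitL k A (tens (f : A⟦X⟧ →ₐ[k⟦X⟧] A⟦X⟧) (AlgHom.id _ _) p)) := by
  refine DFunLike.congr_fun (f := (counitL k A).comp (sq f))
    (g := (f : A⟦X⟧ →ₐ[k⟦X⟧] A⟦X⟧).comp ((counitL k A).comp
      (tens (f : A⟦X⟧ →ₐ[k⟦X⟧] A⟦X⟧) (AlgHom.id _ _)))) (tensor_hom_ext ?_ ?_) p <;>
  intro p <;> simp [sq_inl, sq_inr, tens_inl, tens_inr, counitL_inl, counitL_inr]

theorem counitR_tens (f : AlgAut k A) (p : (A ⊗[k] A)⟦X⟧) :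
    counitR k A (tens (f : A⟦X⟧ →ₐ[k⟦X⟧] A⟦X⟧) (AlgHom.id _ _) p) = f (counitR k A p) := by
  refine DFunLike.congr_fun (g := (f : A⟦X⟧ →ₐ[k⟦X⟧] A⟦X⟧).comp (counitR k A))
    (f := (counitR k A).comp
      (tens (f : A⟦X⟧ →ₐ[k⟦X⟧] A⟦X⟧) (AlgHom.id _ _))) (tensor_hom_ext ?_ ?_) p <;>
  intro p <;> simp [tens_inl, tens_inr, counitR_inl, counitR_inr]

/-- The first component of a twisted automorphism preserves the counit. -/
theorem counit_f (t : TwAut k A) (x : A⟦X⟧) : counit k A (t.f x) = counit k A x := by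
  have h1 := congrArg (counitL k A) (t.conj x)
  rw [map_mul, map_mul, t.norm_left, one_mul, mul_one, counitL_comul, counitL_sq] at h1
  have h2 := t.f.injective h1
  conv_rhs => rw [h2]
  rw [counit_counitL, counitR_tens, counitR_comul]

theorem counitL_sq' (t : TwAut k A) (p : (A ⊗[k] A)⟦X⟧) :
    counitL k A (sq t.f p) = t.f (counitL k A p) := by
  refine DFunLike.congr_fun (f := (counitL k A).comp (sq t.f))
    (g := (t.f : A⟦X⟧ →ₐ[k⟦X⟧] A⟦X⟧).comp (counitL k A)) (tensor_hom_ext ?_ ?_) p <;>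
  intro p <;> simp [sq_inl, sq_inr, counitL_inl, counitL_inr, counit_f]

theorem counitR_sq' (t : TwAut k A) (p : (A ⊗[k] A)⟦X⟧) :
    counitR k A (sq t.f p) = t.f (counitR k A p) := by
  refine DFunLike.congr_fun (f := (counitR k A).comp (sq t.f))
    (g := (t.f : A⟦X⟧ →ₐ[k⟦X⟧] A⟦X⟧).comp (counitR k A)) (tensor_hom_ext ?_ ?_) p <;>
  intro p <;> simp [sq_inl, sq_inr, counitR_inl, counitR_inr, counit_f]

/-- The identity twisted automorphism `(id, 1)`. -/
noncomputable instance : One (TwAut k A) where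
  one :=
    { f := 1
      F := 1
      conj := fun x => by simp [sq_one]
      cocycle := by simp
      norm_left := by simp
      norm_right := by simp }

/-- The composition `(f', F') ∘ (f, F) = (f' f, (f' ⊗ f')(F) F')`. -/
noncomputable instance : Mul (TwAut k A) where
  mul t s :=
    { f := t.f * s.f
      F := Units.map (sq t.f : (A ⊗[k] A)⟦X⟧ →* (A ⊗[k] A)⟦X⟧) s.F * t.F
      conj := fun x => by
        have h := congrArg (sq t.f) (s.conj x)
        rw [map_mul, map_mul] at h
        simp only [Units.val_mul, Units.coe_map, MonoidHom.coe_coe, AlgEquiv.mul_apply, sq_mul]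
        rw [mul_assoc, t.conj, ← mul_assoc, h, mul_assoc]
      cocycle := by
        have h := congrArg (cube t.f) s.cocycle
        rw [map_mul, map_mul, cube_tensorOne, cube_oneTensor] at h
        simp only [Units.val_mul, Units.coe_map, MonoidHom.coe_coe, map_mul]
        rw [mul_assoc, ← mul_assoc (tensorOne k A t.F), comulL_conj t.f t.F t.conj, mul_assoc,
          ← mul_assoc, h, t.cocycle, mul_assoc, ← mul_assoc (cube t.f (comulR k A s.F)),
          ← comulR_conj t.f t.F t.conj]
        simp only [mul_assoc]
      norm_left := by
        simp [counitL_sq', s.norm_left, t.norm_left]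
      norm_right := by
        simp [counitR_sq', s.norm_right, t.norm_right] }

theorem sq_inv_sq (f : AlgAut k A) (p) : sq f⁻¹ (sq f p) = p := by
  rw [← sq_mul, inv_mul_cancel, sq_one]

theorem sq_sq_inv (f : AlgAut k A) (p) : sq f (sq f⁻¹ p) = p := by
  rw [← sq_mul, mul_inv_cancel, sq_one]

theorem cube_injective (f : AlgAut k A) : Function.Injective (cube f) := by
  intro p q h
  rw [← cube_one p, ← cube_one q, ← inv_mul_cancel f, cube_mul, cube_mul, h]

theorem counit_f_inv (t : TwAut k A) (x : A⟦X⟧) : counit k A (t.f⁻¹ x) = counit k A x := by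
  conv_rhs => rw [← AlgEquiv.apply_symm_apply t.f x]
  rw [counit_f]; rfl

/-- The inverse of `(f, F)` is `(f⁻¹, (f⁻¹ ⊗ f⁻¹)(F⁻¹))`. -/
noncomputable instance : Inv (TwAut k A) where
  inv t :=
    { f := t.f⁻¹
      F := Units.map (sq t.f⁻¹ : (A ⊗[k] A)⟦X⟧ →* (A ⊗[k] A)⟦X⟧) t.F⁻¹
      conj := fun x => by
        have hx := t.conj (t.f⁻¹ x)
        have e : t.f (t.f⁻¹ x) = x := t.f.apply_symm_apply x
        rw [e] at hx
        have hx' : ((t.F⁻¹ : ((A ⊗[k] A)⟦X⟧)ˣ) : (A ⊗[k] A)⟦X⟧)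
            * sq t.f (comul k A (t.f⁻¹ x)) = comul k A x * ↑t.F⁻¹ := by
          rw [Units.inv_mul_eq_iff_eq_mul, ← mul_assoc, hx, mul_assoc, Units.mul_inv, mul_one]
        have h := congrArg (sq t.f⁻¹) hx'
        rw [map_mul, map_mul, sq_inv_sq] at h
        exact h
      cocycle := by
        apply cube_injective t.f
        have aux : sq t.f (sq t.f⁻¹ (↑(t.F⁻¹) : (A ⊗[k] A)⟦X⟧)) = ↑t.F⁻¹ := sq_sq_inv _ _
        have h1 := comulL_conj t.f t.F t.conj (sq t.f⁻¹ (↑(t.F⁻¹) : (A ⊗[k] A)⟦X⟧))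
        have h2 := comulR_conj t.f t.F t.conj (sq t.f⁻¹ (↑(t.F⁻¹) : (A ⊗[k] A)⟦X⟧))
        rw [aux] at h1 h2
        simp only [Units.coe_map, MonoidHom.coe_coe, map_mul, cube_tensorOne, cube_oneTensor, aux]
        let a := Units.map (tensorOne k A : (A ⊗[k] A)⟦X⟧ →* (A ⊗[k] (A ⊗[k] A))⟦X⟧) t.F
        let b := Units.map (oneTensor k A : (A ⊗[k] A)⟦X⟧ →* (A ⊗[k] (A ⊗[k] A))⟦X⟧) t.F
        let c := Units.map (comulL k A : (A ⊗[k] A)⟦X⟧ →* (A ⊗[k] (A ⊗[k] A))⟦X⟧) t.F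
        let d := Units.map (comulR k A : (A ⊗[k] A)⟦X⟧ →* (A ⊗[k] (A ⊗[k] A))⟦X⟧) t.F
        have hu : a * c = b * d := Units.ext t.cocycle
        have h1' : cube t.f (comulL k A (sq t.f⁻¹ (↑(t.F⁻¹) : (A ⊗[k] A)⟦X⟧))) =
            ↑(a * c⁻¹ * a⁻¹) := by
          rw [Units.val_mul, Units.eq_mul_inv_iff_mul_eq, ← map_inv]; exact h1.symm
        have h2' : cube t.f (comulR k A (sq t.f⁻¹ (↑(t.F⁻¹) : (A ⊗[k] A)⟦X⟧))) =
            ↑(b * d⁻¹ * b⁻¹) := by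
          rw [Units.val_mul, Units.eq_mul_inv_iff_mul_eq, ← map_inv]; exact h2.symm
        rw [h1', h2']
        have e1 : tensorOne k A (↑(t.F⁻¹) : (A ⊗[k] A)⟦X⟧) = ↑a⁻¹ := by
          rw [← map_inv]; rfl
        have e2 : oneTensor k A (↑(t.F⁻¹) : (A ⊗[k] A)⟦X⟧) = ↑b⁻¹ := by
          rw [← map_inv]; rfl
        rw [e1, e2, ← Units.val_mul, ← Units.val_mul]
        congr 1
        have := congrArg (·⁻¹) hu
        simp only [mul_inv_rev] at this
        simp only [← mul_assoc, inv_mul_cancel, one_mul, this]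
      norm_left := by
        have hl : counitL k A (↑(t.F⁻¹) : (A ⊗[k] A)⟦X⟧) = 1 := by
          have := congrArg (counitL k A) t.F.mul_inv
          rwa [map_mul, t.norm_left, one_mul, map_one] at this
        apply t.f.injective
        simp only [Units.coe_map, MonoidHom.coe_coe]
        rw [← counitL_sq', sq_sq_inv, hl, map_one]
      norm_right := by
        have hl : counitR k A (↑(t.F⁻¹) : (A ⊗[k] A)⟦X⟧) = 1 := by
          have := congrArg (counitR k A) t.F.mul_inv
          rwa [map_mul, t.norm_right, one_mul, map_one] at this
        apply t.f.injective
        simp only [Units.coe_map, MonoidHom.coe_coe]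
        rw [← counitR_sq', sq_sq_inv, hl, map_one] }

@[simp] theorem one_f : (1 : TwAut k A).f = 1 := rfl
@[simp] theorem one_F : (1 : TwAut k A).F = 1 := rfl
@[simp] theorem mul_f (t s : TwAut k A) : (t * s).f = t.f * s.f := rfl
theorem mul_F (t s : TwAut k A) :
    (t * s).F = Units.map (sq t.f : (A ⊗[k] A)⟦X⟧ →* (A ⊗[k] A)⟦X⟧) s.F * t.F := rfl
@[simp] theorem inv_f (t : TwAut k A) : t⁻¹.f = t.f⁻¹ := rfl
theorem inv_F (t : TwAut k A) : t⁻¹.F = Units.map (sq t.f⁻¹ : (A ⊗[k] A)⟦X⟧ →* (A ⊗[k] A)⟦X⟧) t.F⁻¹ := rfl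

/-- The group of twisted automorphisms. -/
noncomputable instance : Group (TwAut k A) :=
  Group.ofLeftAxioms
    (fun r s t => TwAut.ext (mul_assoc _ _ _) (Units.ext (by simp [mul_F, sq_mul, mul_assoc])))
    (fun t => TwAut.ext (one_mul _) (Units.ext (by simp [mul_F, sq_one])))
    (fun t => TwAut.ext (inv_mul_cancel _) (Units.ext (by
      rw [mul_F, inv_F, inv_f, ← map_mul, mul_inv_cancel, map_one, one_F])))

end TwAut

/-- The element `u ⊗ u` of `(A ⊗ A)⟦X⟧` for a unit `u` of `A⟦X⟧`. -/
noncomputable def dbl (u : A⟦X⟧ˣ) : ((A ⊗[k] A)⟦X⟧)ˣ :=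
  Units.map ((inl : A⟦X⟧ →ₐ[k⟦X⟧] (A ⊗[k] A)⟦X⟧) : A⟦X⟧ →* (A ⊗[k] A)⟦X⟧) u *
    Units.map ((inr : A⟦X⟧ →ₐ[k⟦X⟧] (A ⊗[k] A)⟦X⟧) : A⟦X⟧ →* (A ⊗[k] A)⟦X⟧) u

/-- The unit `Δ(u)`. -/
noncomputable def comulUnit : A⟦X⟧ˣ →* ((A ⊗[k] A)⟦X⟧)ˣ :=
  Units.map (comul k A : A⟦X⟧ →* (A ⊗[k] A)⟦X⟧)

theorem dbl_val (u : A⟦X⟧ˣ) :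
    (dbl (k := k) u : (A ⊗[k] A)⟦X⟧) = inl (k := k) (u : A⟦X⟧) * inr (k := k) (u : A⟦X⟧) := rfl

theorem comulUnit_val (u : A⟦X⟧ˣ) :
    (comulUnit (k := k) u : (A ⊗[k] A)⟦X⟧) = comul k A u := rfl

theorem dbl_mul (u v : A⟦X⟧ˣ) : dbl (k := k) (u * v) = dbl u * dbl v := by
  apply Units.ext
  simp only [dbl_val, Units.val_mul, map_mul]
  have := (commute_inl_inr (k := k) (v : A⟦X⟧) (u : A⟦X⟧)).eq
  simp only [mul_assoc]
  rw [← mul_assoc (inr (k := k) (u : A⟦X⟧)), ← this]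
  simp only [mul_assoc]

theorem dbl_one : dbl (k := k) (1 : A⟦X⟧ˣ) = 1 := by
  apply Units.ext
  simp [dbl_val]

theorem sq_dbl (f : AlgAut k A) (u : A⟦X⟧ˣ) :
    sq f (dbl (k := k) u : (A ⊗[k] A)⟦X⟧) =
      dbl (k := k) (Units.map (f : A⟦X⟧ →* A⟦X⟧) u) := by
  simp [dbl_val, sq_inl, sq_inr]

theorem sq_conjAut (u : A⟦X⟧ˣ) (p : (A ⊗[k] A)⟦X⟧) :
    sq (conjAut k u) p = conjAut k (dbl u) p := by
  have hc : ∀ x y : A⟦X⟧, (inr (k := k) x : (A ⊗[k] A)⟦X⟧) * inl (k := k) y =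
      inl (k := k) y * inr (k := k) x := fun x y => (commute_inl_inr y x).eq.symm
  refine DFunLike.congr_fun 
    (g := ((conjAut k (dbl (k := k) u) : (A ⊗[k] A)⟦X⟧ ≃ₐ[k⟦X⟧] (A ⊗[k] A)⟦X⟧) :
      (A ⊗[k] A)⟦X⟧ →ₐ[k⟦X⟧] (A ⊗[k] A)⟦X⟧))
    (tensor_hom_ext (fun x => ?_) fun x => ?_) p
  · change sq (conjAut k u) (inl (k := k) x) = (dbl (k := k) u : (A ⊗[k] A)⟦X⟧) * _ * _
    rw [Units.eq_mul_inv_iff_mul_eq, sq_inl, conjAut_apply, dbl_val]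
    simp only [map_mul, mul_assoc]
    rw [← mul_assoc (inl (k := k) ((u⁻¹ : A⟦X⟧ˣ) : A⟦X⟧)), ← map_mul, Units.inv_mul, map_one,
      one_mul, hc]
  · change sq (conjAut k u) (inr (k := k) x) = (dbl (k := k) u : (A ⊗[k] A)⟦X⟧) * _ * _
    rw [Units.eq_mul_inv_iff_mul_eq, sq_inr, conjAut_apply, dbl_val]
    simp only [map_mul, mul_assoc]
    rw [← mul_assoc (inr (k := k) ((u⁻¹ : A⟦X⟧ˣ) : A⟦X⟧)), hc, mul_assoc, ← map_mul,
      Units.inv_mul, map_one, mul_one, hc x, ← mul_assoc, hc, mul_assoc]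

variable (k A) in
/-- The group of units of `A⟦X⟧` of counit `1`. -/
noncomputable def unitsOne : Subgroup A⟦X⟧ˣ :=
  (Units.map (counit k A : A⟦X⟧ →* k⟦X⟧)).ker

theorem mem_unitsOne {u : A⟦X⟧ˣ} : u ∈ unitsOne k A ↔ counit k A u = 1 := by
  rw [unitsOne, MonoidHom.mem_ker, Units.ext_iff]; rfl

/-- The inner twisted automorphism `(x ↦ u x u⁻¹, (u ⊗ u) Δ(u)⁻¹)`. -/
noncomputable def TwAut.inner (u : unitsOne k A) : TwAut k A where
  f := conjAut k (u : A⟦X⟧ˣ)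
  F := dbl (u : A⟦X⟧ˣ) * (comulUnit (u : A⟦X⟧ˣ))⁻¹
  conj x := by
    rw [sq_conjAut, conjAut_apply, conjAut_apply, map_mul, map_mul]
    rw [← comulUnit_val]
    have : comul k A (↑((u : A⟦X⟧ˣ)⁻¹) : A⟦X⟧) = ↑(comulUnit (k := k) (u : A⟦X⟧ˣ))⁻¹ := by
      rw [← map_inv]; rfl
    rw [this]
    simp [mul_assoc]
  cocycle := by
    set u' : A⟦X⟧ˣ := (u : A⟦X⟧ˣ)
    let tO : ((A ⊗[k] A)⟦X⟧)ˣ →* ((A ⊗[k] (A ⊗[k] A))⟦X⟧)ˣ := Units.map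
      (tensorOne k A : (A ⊗[k] A)⟦X⟧ →* (A ⊗[k] (A ⊗[k] A))⟦X⟧)
    let oT : ((A ⊗[k] A)⟦X⟧)ˣ →* ((A ⊗[k] (A ⊗[k] A))⟦X⟧)ˣ := Units.map
      (oneTensor k A : (A ⊗[k] A)⟦X⟧ →* (A ⊗[k] (A ⊗[k] A))⟦X⟧)
    let cL : ((A ⊗[k] A)⟦X⟧)ˣ →* ((A ⊗[k] (A ⊗[k] A))⟦X⟧)ˣ := Units.map
      (comulL k A : (A ⊗[k] A)⟦X⟧ →* (A ⊗[k] (A ⊗[k] A))⟦X⟧)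
    let cR : ((A ⊗[k] A)⟦X⟧)ˣ →* ((A ⊗[k] (A ⊗[k] A))⟦X⟧)ˣ := Units.map
      (comulR k A : (A ⊗[k] A)⟦X⟧ →* (A ⊗[k] (A ⊗[k] A))⟦X⟧)
    let r : A⟦X⟧ˣ →* ((A ⊗[k] A)⟦X⟧)ˣ := Units.map
      ((inr : A⟦X⟧ →ₐ[k⟦X⟧] (A ⊗[k] A)⟦X⟧) : A⟦X⟧ →* (A ⊗[k] A)⟦X⟧)
    let l : A⟦X⟧ˣ →* ((A ⊗[k] A)⟦X⟧)ˣ := Units.map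
      ((inl : A⟦X⟧ →ₐ[k⟦X⟧] (A ⊗[k] A)⟦X⟧) : A⟦X⟧ →* (A ⊗[k] A)⟦X⟧)
    let l3 : A⟦X⟧ˣ →* ((A ⊗[k] (A ⊗[k] A))⟦X⟧)ˣ := Units.map
      ((inl : A⟦X⟧ →ₐ[k⟦X⟧] (A ⊗[k] (A ⊗[k] A))⟦X⟧) :
        A⟦X⟧ →* (A ⊗[k] (A ⊗[k] A))⟦X⟧)
    have hco : cL (comulUnit u') = cR (comulUnit u') := Units.ext (comul_coassoc _)
    have hL : cL (dbl u') = tO (comulUnit u') * oT (r u') := by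
      rw [dbl, map_mul]
      exact congrArg₂ (· * ·) (Units.ext (comulL_inl _)) (Units.ext (comulL_inr _))
    have hR : cR (dbl u') = l3 u' * oT (comulUnit u') := by
      rw [dbl, map_mul]
      exact congrArg₂ (· * ·) (Units.ext (comulR_inl _)) (Units.ext (comulR_inr _))
    have hcomm : l3 u' * oT (comulUnit u') = oT (comulUnit u') * l3 u' :=
      Units.ext (commute_inl_inr (k := k) _ _).eq
    have hcomm' : l3 u' * oT (dbl u') = oT (dbl u') * l3 u' :=
      Units.ext (commute_inl_inr (k := k) _ _).eq
    have h3 : tO (dbl u') * oT (r u') = oT (dbl u') * l3 u' := by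
      rw [← hcomm', dbl, map_mul, map_mul]
      have e1 : tO (l u') = l3 u' := Units.ext (tensorOne_inl _)
      have e2 : tO (r u') = oT (l u') := Units.ext (tensorOne_inr _)
      change tO (l u') * tO (r u') * oT (r u') = l3 u' * (oT (l u') * oT (r u'))
      rw [e1, e2, mul_assoc]
    have main : tO (dbl u' * (comulUnit u')⁻¹) * cL (dbl u' * (comulUnit u')⁻¹) =
        oT (dbl u' * (comulUnit u')⁻¹) * cR (dbl u' * (comulUnit u')⁻¹) := by
      simp only [map_mul, map_inv]
      rw [hL, hR, hcomm, hco]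
      simp only [mul_assoc, inv_mul_cancel_left]
      rw [← mul_assoc, h3, mul_assoc]
    exact congrArg Units.val main
  norm_left := by
    have hu := mem_unitsOne.1 u.2
    rw [← Units.val_one, ← map_one (Units.map (counitL k A : (A ⊗[k] A)⟦X⟧ →* A⟦X⟧))]
    change ((Units.map (counitL k A : (A ⊗[k] A)⟦X⟧ →* A⟦X⟧)) _ : A⟦X⟧) = _
    rw [Units.val_inj, map_one, map_mul, map_inv, mul_inv_eq_one]
    apply Units.ext
    simp [dbl_val, comulUnit_val, counitL_inl, counitL_inr, counitL_comul, hu]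
  norm_right := by
    have hu := mem_unitsOne.1 u.2
    rw [← Units.val_one, ← map_one (Units.map (counitR k A : (A ⊗[k] A)⟦X⟧ →* A⟦X⟧))]
    change ((Units.map (counitR k A : (A ⊗[k] A)⟦X⟧ →* A⟦X⟧)) _ : A⟦X⟧) = _
    rw [Units.val_inj, map_one, map_mul, map_inv, mul_inv_eq_one]
    apply Units.ext
    simp [dbl_val, comulUnit_val, counitR_inl, counitR_inr, counitR_comul, hu]

variable (k A) in
/-- The action of algebra automorphisms of `A⟦X⟧` on the units. -/
noncomputable def unitsAct : AlgAut k A →* MulAut A⟦X⟧ˣ where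
  toFun f := Units.mapEquiv (f : A⟦X⟧ ≃* A⟦X⟧)
  map_one' := by ext; rfl
  map_mul' f g := by ext; rfl

theorem unitsAct_val (f : AlgAut k A) (u : A⟦X⟧ˣ) : (unitsAct k A f u : A⟦X⟧) = f u := rfl

theorem conjAut_unitsAct (f : AlgAut k A) (u : A⟦X⟧ˣ) :
    conjAut k (unitsAct k A f u) = f * conjAut k u * f⁻¹ := by
  ext1 x
  have e : f (f⁻¹ x) = x := f.apply_symm_apply x
  rw [AlgEquiv.mul_apply, AlgEquiv.mul_apply, conjAut_apply, conjAut_apply, map_mul, map_mul, e,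
    ← map_inv]
  rfl

/-- Restriction of an action by automorphisms to an invariant subgroup. -/
def restrictAct {P G : Type w} [Group P] [Group G] (ρ : P →* MulAut G) (S : Subgroup G)
    (h : ∀ p, ∀ x ∈ S, ρ p x ∈ S) : P →* MulAut S where
  toFun p :=
    { toFun x := ⟨ρ p x, h p x x.2⟩
      invFun x := ⟨ρ p⁻¹ x, h p⁻¹ x x.2⟩
      left_inv x := Subtype.ext (by simp)
      right_inv x := Subtype.ext (by simp)
      map_mul' x y := Subtype.ext (by simp) }
  map_one' := by ext; simp
  map_mul' p q := by ext; simp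

variable (k A) in
/-- The projection `(f, F) ↦ f`. -/
def TwAut.fst : TwAut k A →* AlgAut k A where
  toFun t := t.f
  map_one' := rfl
  map_mul' _ _ := rfl

variable (k A) in
/-- The crossed module of twisted automorphisms: the group of twisted automorphisms, the group
of units of counit `1`, the action `(f, F)(u) = f(u)` and
`∂(u) = (x ↦ u x u⁻¹, (u ⊗ u) Δ(u)⁻¹)`. -/
noncomputable def twCrossed : CrossedModule (TwAut k A) (unitsOne k A) where
  act := restrictAct ((unitsAct k A).comp (TwAut.fst k A)) (unitsOne k A) fun t u hu => by
    rw [mem_unitsOne] at hu ⊢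
    exact (t.counit_f u).trans hu
  bd := MonoidHom.mk' TwAut.inner fun u v => by
    refine TwAut.ext (conjAut_mul _ _) (Units.ext ?_)
    simp only [TwAut.inner, TwAut.mul_F, Subgroup.coe_mul, dbl_mul, map_mul, Units.val_mul,
      Units.coe_map, MonoidHom.coe_coe, sq_conjAut, conjAut_apply, mul_inv_rev]
    simp only [mul_assoc, Units.inv_mul_cancel_left]
  bd_act t u := by
    rw [_root_.eq_mul_inv_iff_mul_eq]
    refine TwAut.ext ?_ (Units.ext ?_)
    · change conjAut k (unitsAct k A t.f u) * t.f = t.f * conjAut k (u : A⟦X⟧ˣ)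
      rw [conjAut_unitsAct, inv_mul_cancel_right]
    · change sq (conjAut k (unitsAct k A t.f u)) (t.F : (A ⊗[k] A)⟦X⟧) *
        ((dbl (k := k) (unitsAct k A t.f u) * (comulUnit (k := k) (unitsAct k A t.f u))⁻¹ :
          ((A ⊗[k] A)⟦X⟧)ˣ) : (A ⊗[k] A)⟦X⟧) =
        (Units.map (sq t.f : (A ⊗[k] A)⟦X⟧ →* (A ⊗[k] A)⟦X⟧)
          (dbl (k := k) (u : A⟦X⟧ˣ) * (comulUnit (k := k) (u : A⟦X⟧ˣ))⁻¹) * t.F :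
            ((A ⊗[k] A)⟦X⟧)ˣ)
      rw [sq_conjAut, conjAut_apply]
      simp only [← Units.val_mul]
      rw [Units.val_inj, map_mul, map_inv]
      have e1 : Units.map (sq t.f : (A ⊗[k] A)⟦X⟧ →* (A ⊗[k] A)⟦X⟧)
          (dbl (k := k) (u : A⟦X⟧ˣ)) = dbl (k := k) (unitsAct k A t.f u) :=
        Units.ext (sq_dbl _ _)
      have e2 : t.F * comulUnit (k := k) (unitsAct k A t.f u) =
          Units.map (sq t.f : (A ⊗[k] A)⟦X⟧ →* (A ⊗[k] A)⟦X⟧)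
            (comulUnit (k := k) (u : A⟦X⟧ˣ)) * t.F := Units.ext (t.conj _)
      rw [e1, mul_assoc, mul_assoc, mul_assoc, inv_mul_cancel_left, mul_right_inj,
        eq_inv_mul_iff_mul_eq, ← mul_assoc, ← e2, mul_inv_cancel_right]
  peiffer u v := Subtype.ext (Units.ext rfl)

variable (k A) in
/-- The group of automorphisms of the topological bialgebra `A⟦X⟧`. -/
noncomputable def bialgAut : Subgroup (AlgAut k A) where
  carrier := {f | (∀ x, comul k A (f x) = sq f (comul k A x)) ∧
    ∀ x, counit k A (f x) = counit k A x}
  one_mem' := ⟨fun x => by rw [sq_one]; rfl, fun x => rfl⟩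
  mul_mem' {f g} hf hg := ⟨fun x => by rw [sq_mul, AlgEquiv.mul_apply, hf.1, hg.1],
    fun x => by rw [AlgEquiv.mul_apply, hf.2, hg.2]⟩
  inv_mem' {f} hf := by
    have e : ∀ x, f (f⁻¹ x) = x := f.apply_symm_apply
    refine ⟨fun x => ?_, fun x => ?_⟩
    · conv_rhs => rw [← e x, hf.1, TwAut.sq_inv_sq]
    · conv_rhs => rw [← e x, hf.2]

variable (k A) in
/-- The group of group-like elements of `A⟦X⟧`. -/
noncomputable def groupLike : Subgroup A⟦X⟧ˣ where
  carrier := {u | comul k A (u : A⟦X⟧) = inl (k := k) (u : A⟦X⟧) * inr (k := k) (u : A⟦X⟧)}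
  one_mem' := by simp
  mul_mem' {u v} hu hv := by
    have h := congrArg Units.val (dbl_mul (k := k) u v)
    rw [Units.val_mul, dbl_val, dbl_val, dbl_val] at h
    change comul k A ((u * v : A⟦X⟧ˣ) : A⟦X⟧) = _
    change comul k A (u : A⟦X⟧) = _ at hu
    change comul k A (v : A⟦X⟧) = _ at hv
    rw [h, Units.val_mul, map_mul, hu, hv]
  inv_mem' {u} hu := by
    have h1 : comulUnit (k := k) u = dbl u := Units.ext hu
    have h2 : dbl (k := k) u⁻¹ = (dbl u)⁻¹ := by
      rw [_root_.eq_inv_iff_mul_eq_one, ← dbl_mul, inv_mul_cancel, dbl_one]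
    have h3 : comulUnit (k := k) u⁻¹ = dbl u⁻¹ := by rw [map_inv, h1, h2]
    exact congrArg Units.val h3

theorem mem_groupLike {u : A⟦X⟧ˣ} :
    u ∈ groupLike k A ↔ comulUnit (k := k) u = dbl u := by
  rw [Units.ext_iff]; rfl

theorem groupLike_le : groupLike k A ≤ unitsOne k A := by
  intro u hu
  rw [mem_unitsOne]
  have h := congrArg (counitL k A) (show comul k A (u : A⟦X⟧) = _ from hu)
  rw [counitL_comul, map_mul, counitL_inl, counitL_inr] at h
  have h2 : algebraMap k⟦X⟧ A⟦X⟧ (counit k A (u : A⟦X⟧)) = 1 := by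
    rw [← Units.mul_left_inj u, one_mul]; exact h.symm
  have := congrArg (counit k A) h2
  rwa [counit_algebraMap, map_one] at this

theorem conjAut_mem {u : A⟦X⟧ˣ} (hu : u ∈ groupLike k A) : conjAut k u ∈ bialgAut k A := by
  refine ⟨fun x => ?_, (TwAut.inner ⟨u, groupLike_le hu⟩).counit_f⟩
  have := (TwAut.inner ⟨u, groupLike_le hu⟩).conj x
  have hF : (TwAut.inner ⟨u, groupLike_le hu⟩).F = 1 := by
    change dbl u * (comulUnit u)⁻¹ = 1
    rw [mem_groupLike.1 hu, mul_inv_cancel]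
  rw [hF, Units.val_one, one_mul, mul_one] at this
  exact this

variable (k A) in
/-- The crossed module of bialgebra automorphisms: the group of bialgebra automorphisms, the
group of group-like elements, the action `f(u)` and `∂(u) = (x ↦ u x u⁻¹)`. -/
noncomputable def bialgCrossed : CrossedModule (bialgAut k A) (groupLike k A) where
  act := restrictAct ((unitsAct k A).comp (bialgAut k A).subtype) (groupLike k A)
    fun f u hu => by
      rw [mem_groupLike] at hu ⊢
      apply Units.ext
      have h := congrArg (sq f.1) (congrArg Units.val hu)
      rw [sq_dbl] at h
      rw [← show dbl (k := k) (Units.map (f.1 : A⟦X⟧ →* A⟦X⟧) u) = _ from rfl] at h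
      exact (f.2.1 _).trans h
  bd := MonoidHom.mk' (fun u => ⟨conjAut k (u : A⟦X⟧ˣ), conjAut_mem u.2⟩) fun u v =>
    Subtype.ext (conjAut_mul _ _)
  bd_act f u := Subtype.ext (conjAut_unitsAct f.1 u)
  peiffer u v := Subtype.ext (Units.ext rfl)

/-- The twisted automorphism `(f, 1)` of a bialgebra automorphism `f`. -/
noncomputable def TwAut.ofBialg : bialgAut k A →* TwAut k A where
  toFun f :=
    { f := f.1
      F := 1
      conj := fun x => by rw [Units.val_one, one_mul, mul_one, f.2.1]
      cocycle := by simp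
      norm_left := by simp
      norm_right := by simp }
  map_one' := rfl
  map_mul' f g := TwAut.ext rfl (Units.ext (by simp [TwAut.mul_F]))

variable (k A) in
/-- The inclusion of the crossed module of bialgebra automorphisms into that of twisted
automorphisms, `f ↦ (f, 1)` and `u ↦ u`. -/
noncomputable def incl : CrossedModule.Hom (bialgCrossed k A) (twCrossed k A) where
  obj := TwAut.ofBialg
  mor := Subgroup.inclusion groupLike_le
  comm u := TwAut.ext rfl (by
    change dbl (u : A⟦X⟧ˣ) * (comulUnit (u : A⟦X⟧ˣ))⁻¹ = 1
    rw [mem_groupLike.1 u.2, mul_inv_cancel])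
  equivariant _ _ := rfl

end bialgebra

section enveloping
variable (k : Type u) [CommRing k] (g : Type v) [LieRing g] [LieAlgebra k g]

attribute [local instance 100] LieRing.ofAssociativeRing

theorem enveloping_hom_ext {B : Type*} [Ring B] [Algebra k B]
    {φ ψ : UniversalEnvelopingAlgebra k g →ₐ[k] B}
    (h : ∀ x : g, φ (UniversalEnvelopingAlgebra.ι k x) = ψ (UniversalEnvelopingAlgebra.ι k x)) :
    φ = ψ :=
  UniversalEnvelopingAlgebra.hom_ext k (LieHom.ext h)

/-- The Lie algebra map `x ↦ x ⊗ 1 + 1 ⊗ x` from `g` to `U(g) ⊗ U(g)`. -/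
noncomputable def primitive :
    g →ₗ⁅k⁆ UniversalEnvelopingAlgebra k g ⊗[k] UniversalEnvelopingAlgebra k g where
  toFun x := UniversalEnvelopingAlgebra.ι k x ⊗ₜ[k] 1 + 1 ⊗ₜ[k] UniversalEnvelopingAlgebra.ι k x
  map_add' x y := by
    simp only [map_add, TensorProduct.add_tmul, TensorProduct.tmul_add]; abel
  map_smul' c x := by
    simp only [map_smul, TensorProduct.smul_tmul', TensorProduct.tmul_smul, smul_add,
      RingHom.id_apply]
  map_lie' {x y} := by
    simp only [LieHom.map_lie, LieRing.of_associative_ring_bracket, TensorProduct.sub_tmul,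
      TensorProduct.tmul_sub, mul_add, add_mul, Algebra.TensorProduct.tmul_mul_tmul, one_mul,
      mul_one]
    abel

theorem primitive_apply (x : g) : primitive k g x =
    UniversalEnvelopingAlgebra.ι k x ⊗ₜ[k] 1 + 1 ⊗ₜ[k] UniversalEnvelopingAlgebra.ι k x := rfl

/-- The bialgebra structure of the universal enveloping algebra: `Δ(x) = x ⊗ 1 + 1 ⊗ x` and
`ε(x) = 0` for `x ∈ g`. -/
noncomputable instance envelopingBialgebra : Bialgebra k (UniversalEnvelopingAlgebra k g) :=
  Bialgebra.ofAlgHom (UniversalEnvelopingAlgebra.lift k (primitive k g))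
    (UniversalEnvelopingAlgebra.lift k 0)
    (enveloping_hom_ext k g fun x => by
      have h := UniversalEnvelopingAlgebra.lift_ι_apply k (primitive k g) x
      rw [primitive_apply] at h
      simp only [AlgHom.comp_apply, h]
      simp [h, -UniversalEnvelopingAlgebra.ι_apply, TensorProduct.add_tmul,
        TensorProduct.tmul_add, Algebra.TensorProduct.one_def, add_assoc])
    (enveloping_hom_ext k g fun x => by
      have h := UniversalEnvelopingAlgebra.lift_ι_apply k (primitive k g) x
      rw [primitive_apply] at h
      have h0 := UniversalEnvelopingAlgebra.lift_ι_apply k (0 : g →ₗ⁅k⁆ k) x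
      simp only [AlgHom.comp_apply, h]
      simp [h0, -UniversalEnvelopingAlgebra.ι_apply])
    (enveloping_hom_ext k g fun x => by
      have h := UniversalEnvelopingAlgebra.lift_ι_apply k (primitive k g) x
      rw [primitive_apply] at h
      have h0 := UniversalEnvelopingAlgebra.lift_ι_apply k (0 : g →ₗ⁅k⁆ k) x
      simp only [AlgHom.comp_apply, h]
      simp [h0, -UniversalEnvelopingAlgebra.ι_apply])

end enveloping

section main
variable (k : Type u) [CommRing k] (g : Type v) [LieRing g] [LieAlgebra k g]

/-- The crossed module of twisted automorphisms of `U(g)⟦h⟧`. -/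
noncomputable abbrev twU := twCrossed k (UniversalEnvelopingAlgebra k g)

/-- The crossed module of bialgebra automorphisms of `U(g)⟦h⟧`. -/
noncomputable abbrev bialgU := bialgCrossed k (UniversalEnvelopingAlgebra k g)

/-- The inclusion of the crossed module of bialgebra automorphisms of `U(g)⟦h⟧` into that of
twisted automorphisms. -/
noncomputable abbrev inclU : CrossedModule.Hom (bialgU k g) (twU k g) :=
  incl k (UniversalEnvelopingAlgebra k g)

variable {k g}

/-- `p` is the projection of `π₀` of the twisted automorphisms onto `π₀` of the bialgebra
automorphisms: it is left inverse to the inclusion `[f] ↦ [(f, 1)]`, and its kernel consists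
of the classes of the invariant twists `(id, F)`. -/
def IsProjection (p : (twU k g).Pi0 →* (bialgU k g).Pi0) : Prop :=
  (∀ x, p ((inclU k g).pi0 x) = x) ∧
    ∀ y, p y = 1 ↔ ∃ t : TwAut k (UniversalEnvelopingAlgebra k g),
      t.f = 1 ∧ (t : (twU k g).Pi0) = y

end main

end HAdic

/-! ### Associators and coboundaries in group cohomology -/

namespace CrossedModule

open CategoryTheory groupCohomology

variable {P C P' C' : Type u} [Group P] [Group C] [Group P'] [Group C']
  {M : CrossedModule P C} {N : CrossedModule P' C'}

/-! The argument runs for any bialgebra `A` over a field of characteristic zero that is generated by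
its primitive elements (`PrimGen`); such an `A` is cocommutative, and `primGen_enveloping` supplies
the case of U(g). Put H = A⟦X⟧.

The heart is that every twisted automorphism (f, F) satisfies f = conj(v) ∘ g with `g` a bialgebra
automorphism (`TwAut.exists_conj_mem_bialgAut`). Units of A ⊗ A are scalars, so F ≡ 1 mod X. If F ≡
1 mod Xⁿ, its n-th coefficient is an additive 2-cocycle of the cobar complex. Its symmetric part is
a coboundary, and is killed by composing with the inner twisted automorphism of an exponential
exp(-Xⁿu). Its skew part is invariant, because F and its flip intertwine the same two homomorphisms;
hence exp(Xⁿr), with r minus the skew part, is an invariant twist, which kills the rest without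
touching f. The inner corrections converge X-adically to the required v. In the same way, if conj(u)
is a bialgebra automorphism, its twist is symmetric and invariant, the correcting elements can be
taken central, and u becomes group-like after multiplication by a central unit
(`exists_central_mul_mem_groupLike`). So the class of `g` is well defined and (f, F) ↦ g is the
projection p. It is unique, since modulo inner twisted automorphisms (f, F) is an invariant twist
times (g, 1).

The linear algebra rests on the Adams operation ψ : x ↦ x₁x₂, which acts by 2ᵐ on the m-th graded
piece of the filtration by number of primitive factors. On symmetric cocycles ψ ⊗ ψ is 2 up to an
explicit coboundary, whereas normalized tensors only have weights m ≥ 2; as 2ᵐ ≠ 2, descending the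
filtration gives a primitive (`exists_cobound_of_mem`). The same gap of eigenvalues gives A = ker(ψ
- 2) ⊕ im(ψ - 2) with ker(ψ - 2) the primitive elements, hence a projection e onto them that
commutes with everything commuting with ψ. The statement on units uses symbols with values in a
polynomial ring, which is a domain.

For the associators, lift sections of both crossed modules so that σ(x) has first component
conj(v_x) ∘ g_{p(x)}. The two families a(x, y) then differ by central units ζ(x, y), and the two
3-cocycles differ by the coboundary of ζ (`IsRetraction.exists_central_cochain`). But ζ lies in all
central units, while π₁ consists of the central group-like ones. The map exp ∘ e ∘ log retracts the
former equivariantly onto the latter; applying it to ζ gives a cochain ω in π₁ with the same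
coboundary (`IsRetraction.exists_cochain`). This is the second claim, and restricting the identity
along i, where p ∘ i = id, is the third. -/

theorem contractNth_three {G : Type*} [Mul G] (g : Fin 3 → G) :
    Fin.contractNth (0 : Fin 3) (· * ·) g = ![g 0 * g 1, g 2] ∧
    Fin.contractNth (1 : Fin 3) (· * ·) g = ![g 0, g 1 * g 2] ∧
    Fin.contractNth (2 : Fin 3) (· * ·) g = ![g 0, g 1] := by
  refine ⟨?_, ?_, ?_⟩ <;> ext i <;> fin_cases i <;> rfl

/-- Cocycles of degree `3` differing by the coboundary of a `2`-cochain have the same class. -/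
theorem π_eq_of_sub_eq_d {k G : Type u} [CommRing k] [Group G] (A : Rep k G) {n : ℕ}
    (x y : cocycles A (n + 1)) (w : (Fin n → G) → A)
    (h : iCocycles A (n + 1) x = iCocycles A (n + 1) y + inhomogeneousCochains.d A n w) :
    π A (n + 1) x = π A (n + 1) y := by
  have hx : x = y + toCocycles A n (n + 1) w := by
    -- Cocycles embed in cochains, so the equality can be tested there.
    apply (ModuleCat.mono_iff_injective (iCocycles A (n + 1))).1 inferInstance
    rw [map_add, h]
    congr 1
    have := ConcreteCategory.congr_hom ((inhomogeneousCochains A).toCycles_i n (n + 1)) w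
    rw [inhomogeneousCochains.d_def] at this
    exact this.symm
  have h0 : π A (n + 1) (toCocycles A n (n + 1) w) = 0 := by
    have := ConcreteCategory.congr_hom
      ((inhomogeneousCochains A).toCycles_comp_homologyπ n (n + 1)) w
    exact this
  rw [hx, map_add, h0, add_zero]

/-- If the cocycle of a choice for `M` is the pullback of that of a choice for `N` up to a
coboundary, then the associator of `M` is the pullback of that of `N`. -/
theorem associator_eq_map (D : M.Choice) (E : N.Choice) (p : M.Pi0 →* N.Pi0)
    (α : Rep.res p N.rep ⟶ M.rep) (a : N.Pi1 → M.Pi1)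
    (ha : ∀ c : N.Pi1, α.hom (Additive.ofMul c) = Additive.ofMul (a c))
    (ω : M.Pi0 → M.Pi0 → M.Pi1)
    (h : ∀ x y z, D.cochain x y z = a (E.cochain (p x) (p y) (p z)) *
      (M.pi0Act x (ω y z) * (ω (x * y) z)⁻¹ * ω x (y * z) * (ω x y)⁻¹)) :
    associator D = groupCohomology.map p α 3 (associator E) := by
  have e := ConcreteCategory.congr_hom (π_map (A := N.rep) (B := M.rep) p α 3)
    (cocyclesMk E.cochain₃ E.d_cochain₃)
  rw [associator, associator]
  refine Eq.trans ?_ e.symm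
  -- The factor built from `ω` in `h` is, written additively, the inhomogeneous differential of this
  -- 2-cochain.
  let w : (Fin 2 → M.Pi0) → M.rep := fun g => Additive.ofMul (ω (g 0) (g 1))
  refine π_eq_of_sub_eq_d M.rep _ (cocyclesMap p α 3 (cocyclesMk E.cochain₃ E.d_cochain₃))
    w ?_
  have e2 := ConcreteCategory.congr_hom
    (HomologicalComplex.cyclesMap_i (cochainsMap (A := N.rep) (B := M.rep) p α) 3)
    (cocyclesMk E.cochain₃ E.d_cochain₃)
  refine Eq.trans (iCocycles_mk _ _) ?_
  refine Eq.trans ?_ (congrArg (· + _) e2.symm)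
  have e3 := iCocycles_mk (A := N.rep) E.cochain₃ E.d_cochain₃
  refine Eq.trans ?_ (congrArg (fun t => (cochainsMap (A := N.rep) (B := M.rep) p α).f 3 t + _)
    e3.symm)
  funext g
  obtain ⟨c0, c1, c2⟩ := contractNth_three g
  change D.cochain₃ g = α.hom (E.cochain₃ (p ∘ g)) +
    (M.rep.ρ (g 0) (w fun i => g i.succ) +
    Finset.univ.sum (fun j : Fin 3 => (-1 : ULift.{u} ℤ) ^ ((j : ℕ) + 1) •
      w (Fin.contractNth j (· * ·) g)))
  rw [Fin.sum_univ_three, c0, c1, c2]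
  have h' := congrArg (fun c : M.Pi1 => (Additive.ofMul c : Additive M.Pi1))
    (h (g 0) (g 1) (g 2))
  simp only [ofMul_mul, ofMul_inv] at h'
  refine Eq.trans h' (congrArg₂ (· + ·) (ha _).symm ?_)
  norm_num [pow_succ]
  change _ = (Additive.ofMul (M.pi0Act (g 0) (ω (g 1) (g 2))) : Additive M.Pi1) + _
  abel

end CrossedModule

namespace HAdic

open PowerSeries
open scoped TensorProduct

/-! ### X-adic congruences and limits -/

section congruence
variable {k : Type u} [CommRing k] {A B : Type*} [Ring A] [Algebra k A] [Ring B] [Algebra k B]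

/-- Congruence of power series modulo `Xⁿ`. -/
def Cong (n : ℕ) (p q : B⟦X⟧) : Prop := ∀ i < n, coeff i p = coeff i q

theorem cong_iff_dvd {n : ℕ} {p q : B⟦X⟧} : Cong n p q ↔ X ^ n ∣ p - q := by
  rw [X_pow_dvd_iff]
  simp only [Cong, map_sub, sub_eq_zero]

theorem cong_zero_iff_dvd {n : ℕ} {p : B⟦X⟧} : Cong n p 0 ↔ X ^ n ∣ p := by
  rw [cong_iff_dvd, sub_zero]

namespace Cong
variable {n m : ℕ} {p q r p' q' : B⟦X⟧}

theorem refl (p : B⟦X⟧) : Cong n p p := fun _ _ => rfl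

theorem of_eq (h : p = q) : Cong n p q := h ▸ refl p

theorem symm (h : Cong n p q) : Cong n q p := fun i hi => (h i hi).symm

theorem trans (h : Cong n p q) (h' : Cong n q r) : Cong n p r :=
  fun i hi => (h i hi).trans (h' i hi)

theorem mono (h : Cong n p q) (hm : m ≤ n) : Cong m p q := fun i hi => h i (hi.trans_le hm)

theorem add (h : Cong n p q) (h' : Cong n p' q') : Cong n (p + p') (q + q') := fun i hi => by
  rw [map_add, map_add, h i hi, h' i hi]

theorem sub (h : Cong n p q) (h' : Cong n p' q') : Cong n (p - p') (q - q') := fun i hi => by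
  rw [map_sub, map_sub, h i hi, h' i hi]

theorem neg (h : Cong n p q) : Cong n (-p) (-q) := fun i hi => by
  rw [map_neg, map_neg, h i hi]

theorem mul (h : Cong n p q) (h' : Cong n p' q') : Cong n (p * p') (q * q') := fun i hi => by
  rw [coeff_mul, coeff_mul]
  refine Finset.sum_congr rfl fun x hx => ?_
  have := Finset.HasAntidiagonal.mem_antidiagonal.1 hx
  rw [h _ (by omega), h' _ (by omega)]

theorem mul_zero (h : Cong m p 0) (h' : Cong n q 0) : Cong (m + n) (p * q) 0 := by
  rw [cong_zero_iff_dvd] at *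
  obtain ⟨a, rfl⟩ := h
  obtain ⟨b, rfl⟩ := h'
  refine ⟨a * b, ?_⟩
  rw [mul_assoc, ← mul_assoc a, ← (commute_X_pow a n).eq.symm, pow_add]
  simp only [mul_assoc]

/-- Homomorphisms of `k⟦X⟧`-algebras fix `X`, so they preserve divisibility by powers of `X`:
continuity is automatic. -/
theorem map (f : A⟦X⟧ →ₐ[k⟦X⟧] B⟦X⟧) {p q : A⟦X⟧} (h : Cong n p q) : Cong n (f p) (f q) := by
  rw [cong_iff_dvd] at *
  obtain ⟨a, ha⟩ := h
  exact ⟨f a, by rw [← map_sub, ha, map_mul, map_pow, map_X_eq]⟩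

theorem pow (h : Cong n p q) (j : ℕ) : Cong n (p ^ j) (q ^ j) := by
  induction j with
  | zero => simpa using refl 1
  | succ j ih => rw [pow_succ, pow_succ]; exact ih.mul h

theorem inv {a : B⟦X⟧ˣ} (h : Cong n (a : B⟦X⟧) 1) : Cong n (↑a⁻¹ : B⟦X⟧) 1 := by
  have := (h.mul (refl (↑a⁻¹ : B⟦X⟧))).symm
  simpa using this

/-- Power series congruent to `1` multiply additively in the leading coefficient. -/
theorem coeff_mul_one (hn : 1 ≤ n) (hp : Cong n p 1) (hq : Cong n q 1) :
    coeff n (p * q) = coeff n p + coeff n q := by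
  have h : Cong (n + 1) ((p - 1) * (q - 1)) 0 := by
    have hp' : Cong n (p - 1) 0 := by simpa using hp.sub (refl 1)
    have hq' : Cong n (q - 1) 0 := by simpa using hq.sub (refl 1)
    exact (hp'.mul_zero hq').mono (by omega)
  have h1 := h n (by omega)
  have e : (p - 1) * (q - 1) = p * q - p - q + 1 := by noncomm_ring
  rw [e, map_add, map_sub, map_sub, coeff_one, if_neg (by omega), add_zero, map_zero,
    sub_sub, sub_eq_zero] at h1
  exact h1

theorem one_succ (h : Cong n p 1) (hn : 1 ≤ n) (h0 : coeff n p = 0) : Cong (n + 1) p 1 := by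
  intro i hi
  rcases (Nat.lt_succ_iff.1 hi).lt_or_eq with h' | rfl
  · exact h i h'
  · rw [h0, coeff_one, if_neg (by omega)]

end Cong

theorem eq_of_cong {p q : B⟦X⟧} (h : ∀ n, Cong n p q) : p = q := by
  ext n
  exact h (n + 1) n (by omega)

/-- Cauchy sequences of power series converge. -/
theorem exists_limit (s : ℕ → B⟦X⟧) (h : ∀ n, Cong n (s (n + 1)) (s n)) :
    ∃ l : B⟦X⟧, ∀ n, Cong n l (s n) := by
  have h2 : ∀ n j, Cong n (s (n + j)) (s n) := by
    intro n j
    induction j with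
    | zero => exact Cong.refl _
    | succ j ih => exact ((h (n + j)).mono (by omega)).trans ih
  refine ⟨PowerSeries.mk fun n => coeff n (s (n + 1)), fun n i hi => ?_⟩
  rw [coeff_mk]
  obtain ⟨j, rfl⟩ := Nat.exists_eq_add_of_lt hi
  have := h2 (i + 1) j i (by omega)
  rw [← this, add_right_comm]

theorem isUnit_of_cong_one {p : B⟦X⟧} (h : Cong 1 p 1) : IsUnit p := by
  have h0 : constantCoeff p = 1 := by simpa using h 0 (by omega)
  exact isUnit_iff_constantCoeff.2 (by rw [h0]; exact isUnit_one)

end congruence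

/-! ### Exponential and logarithm of power series -/

section exponential
variable (k : Type u) [Field k] {A B : Type*} [Ring A] [Algebra k A] [Ring B] [Algebra k B]

/-- The `j`-th term `zʲ / j!` of the exponential series. -/
noncomputable def expTerm (z : B⟦X⟧) (j : ℕ) : B⟦X⟧ :=
  algebraMap k⟦X⟧ B⟦X⟧ (C ((j.factorial : k)⁻¹)) * z ^ j

/-- The exponential `∑ zʲ / j!` of a power series `z` without constant term. -/
noncomputable def hexp (z : B⟦X⟧) : B⟦X⟧ :=
  PowerSeries.mk fun n => ∑ j ∈ Finset.range (n + 1), coeff n (expTerm k z j)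

variable {k}

theorem expTerm_cong_zero {z : B⟦X⟧} (hz : Cong 1 z 0) (j : ℕ) : Cong j (expTerm k z j) 0 := by
  have h : Cong j (z ^ j) 0 := by
    induction j with
    | zero => intro i hi; omega
    | succ j ih => rw [pow_succ]; exact ih.mul_zero hz
  simpa [expTerm] using (Cong.refl (algebraMap k⟦X⟧ B⟦X⟧ (C ((j.factorial : k)⁻¹)))).mul h

theorem hexp_cong {z : B⟦X⟧} (hz : Cong 1 z 0) (n : ℕ) {N : ℕ} (hN : n ≤ N) :
    Cong n (hexp k z) (∑ j ∈ Finset.range N, expTerm k z j) := by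
  intro i hi
  rw [hexp, coeff_mk, map_sum]
  refine Finset.sum_subset (fun j hj => ?_) fun j _ hj => ?_
  · rw [Finset.mem_range] at *; omega
  · rw [Finset.mem_range] at hj
    rw [expTerm_cong_zero hz j i (by omega), map_zero]

theorem map_expTerm (f : A⟦X⟧ →ₐ[k⟦X⟧] B⟦X⟧) (z : A⟦X⟧) (j : ℕ) :
    f (expTerm k z j) = expTerm k (f z) j := by
  rw [expTerm, map_mul, f.commutes, map_pow, expTerm]

theorem map_hexp (f : A⟦X⟧ →ₐ[k⟦X⟧] B⟦X⟧) {z : A⟦X⟧} (hz : Cong 1 z 0) :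
    f (hexp k z) = hexp k (f z) := by
  refine eq_of_cong fun n => ((hexp_cong hz n le_rfl).map f).trans ?_
  have hz' : Cong 1 (f z) 0 := by simpa using hz.map f
  rw [map_sum]
  simp only [map_expTerm]
  exact (hexp_cong hz' n le_rfl).symm

theorem hexp_zero : hexp k (0 : B⟦X⟧) = 1 := by
  refine eq_of_cong fun n => (hexp_cong (Cong.refl _) n (Nat.le_succ n)).trans (Cong.of_eq ?_)
  rw [Finset.sum_range_succ', Finset.sum_eq_zero]
  · simp [expTerm]
  · intro j _; simp [expTerm]

theorem hexp_add [CharZero k] {z w : B⟦X⟧} (hz : Cong 1 z 0) (hw : Cong 1 w 0)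
    (h : Commute z w) : hexp k (z + w) = hexp k z * hexp k w := by
  have hzw : Cong 1 (z + w) 0 := by simpa using hz.add hw
  have key : ∀ N, ∑ j ∈ Finset.range N, expTerm k (z + w) j =
      ∑ j ∈ Finset.range N, ∑ x ∈ Finset.HasAntidiagonal.antidiagonal j,
        expTerm k z x.1 * expTerm k w x.2 := by
    intro N
    refine Finset.sum_congr rfl fun j _ => ?_
    rw [expTerm, h.add_pow', Finset.mul_sum]
    refine Finset.sum_congr rfl fun x hx => ?_
    have hx' := Finset.HasAntidiagonal.mem_antidiagonal.1 hx
    have hf : (j.factorial : k)⁻¹ * (j.choose x.1 : k) =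
        (x.1.factorial : k)⁻¹ * (x.2.factorial : k)⁻¹ := by
      have hj : (j.factorial : k) ≠ 0 := by exact_mod_cast j.factorial_ne_zero
      have h1 : (x.1.factorial : k) ≠ 0 := by exact_mod_cast x.1.factorial_ne_zero
      have h2 : (x.2.factorial : k) ≠ 0 := by exact_mod_cast x.2.factorial_ne_zero
      have := Nat.add_choose_mul_factorial_mul_factorial x.1 x.2
      rw [hx', ← Nat.choose_symm_of_eq_add hx'.symm] at this
      have := congrArg (Nat.cast (R := k)) this
      push_cast at this
      field_simp
      linear_combination this
    rw [expTerm, expTerm, mul_assoc, ← mul_assoc (z ^ x.1), ← Algebra.commutes, mul_assoc,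
      ← mul_assoc (algebraMap _ _ _), ← map_mul, ← map_mul, ← hf, nsmul_eq_mul, ← mul_assoc]
    congr 1
    rw [map_mul, map_mul, map_natCast, map_natCast]
  refine eq_of_cong fun n => ?_
  refine (hexp_cong hzw n le_rfl).trans ?_
  -- The triangle a + b < n sits inside the square a, b < n, and the remaining terms of the square
  -- are divisible by `Xⁿ`.
  refine Cong.trans ?_ ((hexp_cong hz n le_rfl).mul (hexp_cong hw n le_rfl)).symm
  rw [key, Finset.sum_mul_sum, Finset.sum_sigma', ← Finset.sum_product']
  intro i hi
  rw [map_sum, map_sum]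
  refine Finset.sum_of_injOn (fun x => x.2) ?_ ?_ ?_ ?_
  · rintro ⟨j, x⟩ hx ⟨j', x'⟩ hx' hxx
    simp only [Finset.coe_sigma, Set.mem_sigma_iff, Finset.mem_coe,
      Finset.HasAntidiagonal.mem_antidiagonal] at hx hx'
    simp only at hxx
    subst hxx
    obtain rfl := hx.2.symm.trans hx'.2
    rfl
  · rintro ⟨j, x⟩ hx
    simp only [Finset.coe_sigma, Set.mem_sigma_iff, Finset.mem_coe, Finset.mem_range,
      Finset.HasAntidiagonal.mem_antidiagonal] at hx
    simp only [Finset.coe_product, Set.mem_prod, Finset.mem_coe, Finset.mem_range]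
    omega
  · rintro ⟨a, b⟩ _ hx
    have hab : n ≤ a + b := by
      by_contra hc
      refine hx ⟨⟨a + b, a, b⟩, ?_, rfl⟩
      simp only [Finset.coe_sigma, Set.mem_sigma_iff, Finset.mem_coe, Finset.mem_range,
        Finset.HasAntidiagonal.mem_antidiagonal]
      exact ⟨by omega, trivial⟩
    have := (expTerm_cong_zero (k := k) hz a).mul_zero (expTerm_cong_zero (k := k) hw b)
    exact (this i (by omega)).trans (map_zero _)
  · rintro ⟨j, x⟩ _
    rfl

/-- Modulo `Xⁿ⁺¹`, the difference of the exponentials of series congruent modulo `Xⁿ` is the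
difference of the series. -/
theorem hexp_sub_cong {n : ℕ} {z w : B⟦X⟧} (hz : Cong 1 z 0) (hw : Cong 1 w 0)
    (h : Cong n z w) : Cong (n + 1) (hexp k z - z) (hexp k w - w) := by
  -- A power with exponent at least 2 gains one order of congruence, since each difference `z - w`
  -- is multiplied by a series without constant term.
  have hp : ∀ j, Cong (n + 1) (z ^ (j + 2)) (w ^ (j + 2)) := by
    intro j
    have e : z ^ (j + 2) - w ^ (j + 2) = z ^ (j + 1) * (z - w) + (z ^ (j + 1) - w ^ (j + 1)) * w := by
      rw [pow_succ z, pow_succ w]; noncomm_ring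
    have h1 : Cong 1 (z ^ (j + 1)) 0 := by simpa using hz.pow (j + 1)
    have h2 : Cong n (z - w) 0 := by simpa using h.sub (Cong.refl w)
    have h3 : Cong n (z ^ (j + 1) - w ^ (j + 1)) 0 := by
      simpa using (h.pow (j + 1)).sub (Cong.refl (w ^ (j + 1)))
    rw [cong_iff_dvd, ← cong_zero_iff_dvd, e]
    simpa using ((h1.mul_zero h2).mono (by omega)).add (h3.mul_zero hw)
  have hs : ∀ x : B⟦X⟧, (∑ j ∈ Finset.range (n + 1 + 2), expTerm k x j) - x =
      ∑ j ∈ Finset.range (n + 1), expTerm k x (j + 2) + 1 := by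
    intro x
    rw [Finset.sum_range_succ', Finset.sum_range_succ']
    simp only [expTerm]
    norm_num
    abel
  refine ((hexp_cong hz (n + 1) (by omega : n + 1 ≤ n + 1 + 2)).sub (Cong.refl z)).trans ?_
  refine Cong.trans ?_
    ((hexp_cong hw (n + 1) (by omega : n + 1 ≤ n + 1 + 2)).sub (Cong.refl w)).symm
  rw [hs, hs]
  refine Cong.add ?_ (Cong.refl _)
  intro i hi
  rw [map_sum, map_sum]
  exact Finset.sum_congr rfl fun j _ => ((Cong.refl _).mul (hp j)) i hi

theorem hexp_cong_one_add {n : ℕ} (hn : 1 ≤ n) {z : B⟦X⟧} (hz : Cong n z 0) :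
    Cong (n + 1) (hexp k z) (1 + z) := by
  have := (hexp_sub_cong (k := k) (hz.mono hn) (Cong.refl 0) hz).add (Cong.refl z)
  simpa [hexp_zero] using this

theorem hexp_cong_one {n : ℕ} (hn : 1 ≤ n) {z : B⟦X⟧} (hz : Cong n z 0) :
    Cong n (hexp k z) 1 := by
  simpa using ((hexp_cong_one_add hn hz).mono (Nat.le_succ n)).trans ((Cong.refl 1).add hz)

/-- By `hexp_sub_cong`, equality of the exponentials upgrades a congruence of `z` and `w` modulo
`Xⁿ` to one modulo `Xⁿ⁺¹`. -/
theorem hexp_injective {z w : B⟦X⟧} (hz : Cong 1 z 0) (hw : Cong 1 w 0)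
    (h : hexp k z = hexp k w) : z = w := by
  refine eq_of_cong fun n => ?_
  induction n with
  | zero => intro i hi; omega
  | succ n ih =>
    have := hexp_sub_cong (k := k) hz hw ih
    rw [h] at this
    simpa using ((Cong.refl (hexp k w)).sub this)

/-- The logarithm is the fixed point of z ↦ z + p - exp(z), an X-adic contraction by
`hexp_sub_cong`. No logarithm series is needed. -/
theorem exists_hexp_eq {p : B⟦X⟧} (hp : Cong 1 p 1) : ∃ z, Cong 1 z 0 ∧ hexp k z = p := by
  let T : B⟦X⟧ → B⟦X⟧ := fun z => z + p - hexp k z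
  have hT : ∀ z, Cong 1 z 0 → Cong 1 (T z) 0 := fun z hz => by
    simpa using (hz.add hp).sub (hexp_cong_one (k := k) le_rfl hz)
  have hT2 : ∀ n z w, Cong 1 z 0 → Cong 1 w 0 → Cong n z w → Cong (n + 1) (T z) (T w) := by
    intro n z w hz hw h
    have := (Cong.refl p).sub (hexp_sub_cong (k := k) hz hw h)
    have e : ∀ x : B⟦X⟧, p - (hexp k x - x) = T x := fun x => by simp only [T]; abel
    rwa [e, e] at this
  let s : ℕ → B⟦X⟧ := fun n => T^[n] 0
  have hs1 : ∀ n, s (n + 1) = T (s n) := fun n => Function.iterate_succ_apply' T n 0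
  have hs0 : ∀ n, Cong 1 (s n) 0 := by
    intro n
    induction n with
    | zero => exact Cong.refl 0
    | succ n ih => rw [hs1]; exact hT _ ih
  have hs : ∀ n, Cong n (s (n + 1)) (s n) := by
    intro n
    induction n with
    | zero => intro i hi; omega
    | succ n ih => rw [hs1 (n + 1)]; nth_rewrite 2 [hs1 n]; exact hT2 n _ _ (hs0 _) (hs0 _) ih
  obtain ⟨l, hl⟩ := exists_limit s hs
  have hl0 : Cong 1 l 0 := (hl 1).trans (hs0 1)
  refine ⟨l, hl0, ?_⟩
  have : T l = l := eq_of_cong fun n =>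
    ((hT2 n l (s n) hl0 (hs0 n) (hl n)).mono (Nat.le_succ n)).trans
      (((Cong.of_eq (hs1 n).symm).trans (hs n)).trans (hl n).symm)
  simp only [T] at this
  rw [add_sub_assoc, add_eq_left, sub_eq_zero] at this
  exact this.symm

variable (k) in
/-- The exponential as a unit. -/
noncomputable def hexpUnit [CharZero k] (z : B⟦X⟧) (hz : Cong 1 z 0) : B⟦X⟧ˣ where
  val := hexp k z
  inv := hexp k (-z)
  val_inv := by
    have hz' : Cong 1 (-z) 0 := by simpa using hz.neg
    rw [← hexp_add hz hz' ((Commute.refl z).neg_right), add_neg_cancel, hexp_zero]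
  inv_val := by
    have hz' : Cong 1 (-z) 0 := by simpa using hz.neg
    rw [← hexp_add hz' hz ((Commute.refl z).neg_left), neg_add_cancel, hexp_zero]

theorem commute_hexp {z y : B⟦X⟧} (hz : Cong 1 z 0) (h : Commute z y) :
    Commute (hexp k z) y := by
  refine eq_of_cong fun n => ?_
  have e := hexp_cong (k := k) hz n le_rfl
  refine (e.mul (Cong.refl y)).trans (Cong.trans (Cong.of_eq ?_) ((Cong.refl y).mul e).symm)
  rw [Finset.sum_mul, Finset.mul_sum]
  refine Finset.sum_congr rfl fun j _ => ?_
  have : Commute (expTerm k z j) y :=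
    Commute.mul_left (Algebra.commutes (C ((j.factorial : k)⁻¹)) y) (h.pow_left j)
  exact this

end exponential

/-! ### The primitive filtration and the Adams operation -/

section filtration
variable (k : Type u) [Field k] (A : Type w) [Ring A] [Bialgebra k A]

/-- The primitive elements of a bialgebra. -/
noncomputable def prims : Submodule k A where
  carrier := {x | Bialgebra.comulAlgHom k A x = x ⊗ₜ[k] 1 + 1 ⊗ₜ[k] x}
  add_mem' {x y} hx hy := by
    simp only [Set.mem_ofPred_eq, map_add, TensorProduct.add_tmul, TensorProduct.tmul_add] at *
    rw [hx, hy]; abel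
  zero_mem' := by simp
  smul_mem' c x hx := by
    simp only [Set.mem_ofPred_eq, map_smul] at *
    rw [hx, smul_add, TensorProduct.smul_tmul', TensorProduct.tmul_smul]

/-- A bialgebra generated by its primitive elements. -/
def PrimGen : Prop := Algebra.adjoin k (prims k A : Set A) = ⊤

/-- The filtration by the number of primitive factors. -/
noncomputable def filt (m : ℕ) : Submodule k A := (1 ⊔ prims k A) ^ m

/-- The product filtration on `A ⊗ A`. -/
def tfilt (m : ℕ) : Submodule k (A ⊗[k] A) :=
  Submodule.span k {t | ∃ i j, i + j ≤ m ∧ ∃ a ∈ filt k A i, ∃ b ∈ filt k A j, a ⊗ₜ[k] b = t}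

/-- The second Adams operation `x ↦ x₁ x₂`. -/
noncomputable def adams : A →ₗ[k] A :=
  LinearMap.mul' k A ∘ₗ (Bialgebra.comulAlgHom k A).toLinearMap

variable {k A}

theorem mem_prims {x : A} :
    x ∈ prims k A ↔ Bialgebra.comulAlgHom k A x = x ⊗ₜ[k] 1 + 1 ⊗ₜ[k] x := Iff.rfl

theorem commutator_mem_prims {x y : A} (hx : x ∈ prims k A) (hy : y ∈ prims k A) :
    x * y - y * x ∈ prims k A := by
  rw [mem_prims] at *
  rw [map_sub, map_mul, map_mul, hx, hy]
  simp only [add_mul, mul_add, Algebra.TensorProduct.tmul_mul_tmul, one_mul, mul_one,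
    TensorProduct.sub_tmul, TensorProduct.tmul_sub]
  abel

theorem counit_prims {x : A} (hx : x ∈ prims k A) : Bialgebra.counitAlgHom k A x = 0 := by
  have h := Coalgebra.rTensor_counit_comul (R := k) x
  change (Coalgebra.counit (R := k)).rTensor A (Bialgebra.comulAlgHom k A x) = _ at h
  rw [mem_prims.1 hx, map_add, LinearMap.rTensor_tmul, LinearMap.rTensor_tmul,
    Bialgebra.counit_one, add_eq_right] at h
  have h2 := congrArg (Bialgebra.counitAlgHom k A) (congrArg (TensorProduct.lid k A) h)
  simpa using h2

theorem filt_zero : filt k A 0 = 1 := pow_zero _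

theorem filt_mono {m n : ℕ} (h : m ≤ n) : filt k A m ≤ filt k A n := by
  induction h with
  | refl => exact le_rfl
  | step _ ih =>
    refine ih.trans ?_
    rw [filt, filt, pow_succ]
    conv_lhs => rw [← mul_one ((1 ⊔ prims k A) ^ _)]
    exact mul_le_mul' le_rfl le_sup_left

theorem mul_mem_filt {m n : ℕ} {x y : A} (hx : x ∈ filt k A m) (hy : y ∈ filt k A n) :
    x * y ∈ filt k A (m + n) := by
  rw [filt, pow_add]
  exact Submodule.mul_mem_mul hx hy

theorem prims_le_filt : prims k A ≤ filt k A 1 := by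
  rw [filt, pow_one]; exact le_sup_right

theorem mul_prim_mem_filt {m : ℕ} {x y : A} (hx : x ∈ filt k A m) (hy : y ∈ prims k A) :
    x * y ∈ filt k A (m + 1) := mul_mem_filt hx (prims_le_filt hy)

theorem one_mem_filt (m : ℕ) : (1 : A) ∈ filt k A m :=
  filt_mono (Nat.zero_le m) (by rw [filt_zero]; exact Submodule.one_le.1 le_rfl)

theorem mem_filt_zero {x : A} : x ∈ filt k A 0 ↔ ∃ c : k, algebraMap k A c = x := by
  rw [filt_zero, Submodule.mem_one]

theorem filt_succ_induction {m : ℕ} {C : A → Prop} (h0 : ∀ y ∈ filt k A m, C y)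
    (hmul : ∀ y ∈ filt k A m, ∀ p ∈ prims k A, C (y * p))
    (hadd : ∀ x y, C x → C y → C (x + y)) {x : A} (hx : x ∈ filt k A (m + 1)) : C x := by
  rw [filt, pow_succ] at hx
  refine Submodule.mul_induction_on hx (fun y hy z hz => ?_) hadd
  obtain ⟨c, hc, p, hp, rfl⟩ := Submodule.mem_sup.1 hz
  obtain ⟨c, rfl⟩ := Submodule.mem_one.1 hc
  rw [mul_add]
  refine hadd _ _ (h0 _ ?_) (hmul y hy p hp)
  rw [← Algebra.commutes, ← Algebra.smul_def]
  exact Submodule.smul_mem _ _ hy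

theorem exists_mem_filt (hA : PrimGen k A) (x : A) : ∃ m, x ∈ filt k A m := by
  have hx : x ∈ Algebra.adjoin k (prims k A : Set A) := by rw [hA]; trivial
  induction hx using Algebra.adjoin_induction with
  | mem x hx => exact ⟨1, prims_le_filt hx⟩
  | algebraMap c => exact ⟨0, mem_filt_zero.2 ⟨c, rfl⟩⟩
  | add x y _ _ hx hy =>
    obtain ⟨m, hm⟩ := hx
    obtain ⟨n, hn⟩ := hy
    exact ⟨m + n, add_mem (filt_mono (by omega) hm) (filt_mono (by omega) hn)⟩
  | mul x y _ _ hx hy =>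
    obtain ⟨m, hm⟩ := hx
    obtain ⟨n, hn⟩ := hy
    exact ⟨m + n, mul_mem_filt hm hn⟩

/-- The bracket with a primitive element is a derivation that preserves the primitive elements, so
it does not lengthen products. -/
theorem commutator_mem_filt {m : ℕ} {x p : A} (hx : x ∈ filt k A m) (hp : p ∈ prims k A) :
    p * x - x * p ∈ filt k A m := by
  induction m generalizing x with
  | zero =>
    obtain ⟨c, rfl⟩ := mem_filt_zero.1 hx
    rw [Algebra.commutes, sub_self]; exact zero_mem _
  | succ m ih =>
    refine filt_succ_induction (C := fun x => p * x - x * p ∈ filt k A (m + 1))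
      (fun y hy => filt_mono (Nat.le_succ m) (ih hy)) (fun y hy q hq => ?_)
      (fun x y hx hy => ?_) hx
    · have e : p * (y * q) - y * q * p = (p * y - y * p) * q + y * (p * q - q * p) := by
        noncomm_ring
      rw [e]
      exact add_mem (mul_prim_mem_filt (ih hy) hq)
        (mul_prim_mem_filt hy (commutator_mem_prims hp hq))
    · have e : p * (x + y) - (x + y) * p = (p * x - x * p) + (p * y - y * p) := by noncomm_ring
      rw [e]; exact add_mem hx hy

theorem tfilt_mono {m n : ℕ} (h : m ≤ n) : tfilt k A m ≤ tfilt k A n := by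
  refine Submodule.span_mono ?_
  rintro _ ⟨i, j, hij, r⟩
  exact ⟨i, j, hij.trans h, r⟩

theorem tmul_mem_tfilt {i j m : ℕ} (h : i + j ≤ m) {a b : A} (ha : a ∈ filt k A i)
    (hb : b ∈ filt k A j) : a ⊗ₜ[k] b ∈ tfilt k A m :=
  Submodule.subset_span ⟨i, j, h, a, ha, b, hb, rfl⟩

theorem tfilt_induction {m : ℕ} {C : A ⊗[k] A → Prop} (h0 : C 0)
    (hadd : ∀ x y, C x → C y → C (x + y))
    (ht : ∀ i j, i + j ≤ m → ∀ a ∈ filt k A i, ∀ b ∈ filt k A j, C (a ⊗ₜ[k] b))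
    {t : A ⊗[k] A} (hx : t ∈ tfilt k A m) : C t := by
  suffices h : ∀ c : k, C (c • t) by simpa using h 1
  induction hx using Submodule.span_induction with
  | mem x hx =>
    obtain ⟨i, j, hij, a, ha, b, hb, rfl⟩ := hx
    intro c
    rw [TensorProduct.smul_tmul']
    exact ht i j hij _ (Submodule.smul_mem _ _ ha) b hb
  | zero => intro c; rwa [smul_zero]
  | add x y _ _ hx hy => intro c; rw [smul_add]; exact hadd _ _ (hx c) (hy c)
  | smul d x _ hx => intro c; rw [smul_smul]; exact hx _

theorem comul_mem_tfilt {m : ℕ} {x : A} (hx : x ∈ filt k A m) :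
    Bialgebra.comulAlgHom k A x ∈ tfilt k A m := by
  induction m generalizing x with
  | zero =>
    obtain ⟨c, rfl⟩ := mem_filt_zero.1 hx
    rw [AlgHom.commutes, Algebra.algebraMap_eq_smul_one, Algebra.TensorProduct.one_def]
    exact Submodule.smul_mem _ _ (tmul_mem_tfilt (i := 0) (j := 0) le_rfl (one_mem_filt _)
      (one_mem_filt _))
  | succ m ih =>
    refine filt_succ_induction (C := fun x => Bialgebra.comulAlgHom k A x ∈ tfilt k A (m + 1))
      (fun y hy => tfilt_mono (Nat.le_succ m) (ih hy)) (fun y hy q hq => ?_)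
      (fun x y hx hy => ?_) hx
    · rw [map_mul, mem_prims.1 hq]
      refine tfilt_induction (C := fun t => t * (q ⊗ₜ[k] 1 + 1 ⊗ₜ[k] q) ∈ tfilt k A (m + 1))
        ?_ (fun x y hx hy => ?_) (fun i j hij a ha b hb => ?_) (ih hy)
      · rw [zero_mul]; exact zero_mem _
      · rw [add_mul]; exact add_mem hx hy
      · rw [mul_add, Algebra.TensorProduct.tmul_mul_tmul, Algebra.TensorProduct.tmul_mul_tmul,
          mul_one, mul_one]
        exact add_mem (tmul_mem_tfilt (by omega) (mul_prim_mem_filt ha hq) hb)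
          (tmul_mem_tfilt (by omega) ha (mul_prim_mem_filt hb hq))
    · rw [map_add]; exact add_mem hx hy

theorem adams_one : adams k A 1 = 1 := by
  simp [adams, Algebra.TensorProduct.one_def]

theorem adams_prim {p : A} (hp : p ∈ prims k A) : adams k A p = (2 : k) • p := by
  simp only [adams, LinearMap.comp_apply, AlgHom.toLinearMap_apply, mem_prims.1 hp]
  simp [two_smul]

/-- Multiplying out (a ⊗ b)(p ⊗ 1 + 1 ⊗ p) gives apb + abp = 2abp + a[p, b], and the commutator term
stays in the filtration step of ab. This is the source of the factor 2 per primitive factor. -/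
theorem adams_mul_prim {m : ℕ} {y p : A} (hy : y ∈ filt k A m) (hp : p ∈ prims k A) :
    adams k A (y * p) - (2 : k) • (adams k A y * p) ∈ filt k A m := by
  simp only [adams, LinearMap.comp_apply, AlgHom.toLinearMap_apply, map_mul, mem_prims.1 hp]
  refine tfilt_induction (C := fun t => LinearMap.mul' k A (t * (p ⊗ₜ[k] 1 + 1 ⊗ₜ[k] p)) -
    (2 : k) • (LinearMap.mul' k A t * p) ∈ filt k A m) ?_ (fun x y hx hy => ?_)
    (fun i j hij a ha b hb => ?_) (comul_mem_tfilt hy)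
  · simp
  · have e : LinearMap.mul' k A ((x + y) * (p ⊗ₜ[k] 1 + 1 ⊗ₜ[k] p)) -
        (2 : k) • (LinearMap.mul' k A (x + y) * p) =
        (LinearMap.mul' k A (x * (p ⊗ₜ[k] 1 + 1 ⊗ₜ[k] p)) -
          (2 : k) • (LinearMap.mul' k A x * p)) +
        (LinearMap.mul' k A (y * (p ⊗ₜ[k] 1 + 1 ⊗ₜ[k] p)) -
          (2 : k) • (LinearMap.mul' k A y * p)) := by
      rw [add_mul, map_add, map_add, add_mul, smul_add]; abel
    rw [e]; exact add_mem hx hy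
  · have e : LinearMap.mul' k A (a ⊗ₜ[k] b * (p ⊗ₜ[k] 1 + 1 ⊗ₜ[k] p)) -
        (2 : k) • (LinearMap.mul' k A (a ⊗ₜ[k] b) * p) = a * (p * b - b * p) := by
      rw [mul_add, Algebra.TensorProduct.tmul_mul_tmul, Algebra.TensorProduct.tmul_mul_tmul,
          map_add, two_smul]
      simp only [LinearMap.mul'_apply]
      noncomm_ring
    rw [e]
    exact filt_mono hij (mul_mem_filt ha (commutator_mem_filt hb hp))

theorem adams_filt_zero {x : A} (hx : x ∈ filt k A 0) : adams k A x = x := by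
  obtain ⟨c, rfl⟩ := mem_filt_zero.1 hx
  rw [Algebra.algebraMap_eq_smul_one, map_smul, adams_one]

/-- The Adams operation acts by `2ᵐ` on the `m`-th graded piece. -/
theorem adams_sub_mem {m : ℕ} {x : A} (hx : x ∈ filt k A (m + 1)) :
    adams k A x - (2 : k) ^ (m + 1) • x ∈ filt k A m := by
  induction m generalizing x with
  | zero =>
    refine filt_succ_induction (C := fun x => adams k A x - (2 : k) ^ (0 + 1) • x ∈ filt k A 0)
      (fun y hy => ?_) (fun y hy p hp => ?_) (fun x y hx hy => ?_) hx
    · rw [adams_filt_zero hy]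
      exact sub_mem hy (Submodule.smul_mem _ _ hy)
    · have := adams_mul_prim hy hp
      rw [adams_filt_zero hy, ← pow_one (2 : k)] at this
      exact this
    · rw [map_add, smul_add, add_sub_add_comm]; exact add_mem hx hy
  | succ m ih =>
    refine filt_succ_induction
      (C := fun x => adams k A x - (2 : k) ^ (m + 1 + 1) • x ∈ filt k A (m + 1))
      (fun y hy => ?_) (fun y hy p hp => ?_) (fun x y hx hy => ?_) hx
    · have e : adams k A y - (2 : k) ^ (m + 1 + 1) • y = (adams k A y - (2 : k) ^ (m + 1) • y) +
        ((2 : k) ^ (m + 1) - (2 : k) ^ (m + 1 + 1)) • y := by module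
      rw [e]
      exact add_mem (filt_mono (Nat.le_succ m) (ih hy)) (Submodule.smul_mem _ _ hy)
    · have e : adams k A (y * p) - (2 : k) ^ (m + 1 + 1) • (y * p) =
          (adams k A (y * p) - (2 : k) • (adams k A y * p)) +
          (2 : k) • ((adams k A y - (2 : k) ^ (m + 1) • y) * p) := by
        rw [sub_mul, smul_mul_assoc, smul_sub, smul_smul, ← pow_succ']; abel
      rw [e]
      exact add_mem (adams_mul_prim hy hp)
        (Submodule.smul_mem _ _ (mul_prim_mem_filt (ih hy) hp))
    · rw [map_add, smul_add, add_sub_add_comm]; exact add_mem hx hy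

theorem adams_mem_filt {m : ℕ} {x : A} (hx : x ∈ filt k A m) : adams k A x ∈ filt k A m := by
  cases m with
  | zero => rwa [adams_filt_zero hx]
  | succ m =>
    rw [← sub_add_cancel (adams k A x) ((2 : k) ^ (m + 1) • x)]
    exact add_mem (filt_mono (Nat.le_succ m) (adams_sub_mem hx)) (Submodule.smul_mem _ _ hx)

/-- The gap between the eigenvalue 2 of weight one and the eigenvalues of all higher weights; this
is what makes the inductions on the filtration work. -/
theorem two_pow_sub_ne_zero [CharZero k] (m : ℕ) : (2 : k) ^ (m + 2) - 2 ≠ 0 := by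
  rw [sub_ne_zero, pow_succ, Ne, mul_eq_right₀ two_ne_zero]
  have : (2 : k) ^ (m + 1) = ((2 ^ (m + 1) : ℕ) : k) := by push_cast; rfl
  rw [this, Nat.cast_eq_one]
  exact (Nat.one_lt_two_pow (by omega)).ne'

variable (k A) in
/-- The endomorphism `ψ² - 2`. -/
noncomputable def adamsSub : A →ₗ[k] A := adams k A - (2 : k) • LinearMap.id

theorem adamsSub_apply (x : A) : adamsSub k A x = adams k A x - (2 : k) • x := rfl

theorem adams_adamsSub (x : A) : adams k A (adamsSub k A x) = adamsSub k A (adams k A x) := by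
  rw [adamsSub_apply, adamsSub_apply, map_sub, map_smul]

theorem adamsSub_filt_zero {x : A} (hx : x ∈ filt k A 0) : adamsSub k A x = -x := by
  rw [adamsSub_apply, adams_filt_zero hx]; module

/-- On weight m + 2 the operator ψ - 2 is an invertible scalar up to lower filtration, so `x` is in
its range modulo a lower step. Weight one lies in the kernel and weight zero in the range. -/
theorem mem_sup_ker_range [CharZero k] {m : ℕ} {x : A} (hx : x ∈ filt k A m) :
    x ∈ LinearMap.ker (adamsSub k A) ⊔ LinearMap.range (adamsSub k A) := by
  have h0 : ∀ x ∈ filt k A 0,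
      x ∈ LinearMap.ker (adamsSub k A) ⊔ LinearMap.range (adamsSub k A) := fun x hx =>
    Submodule.mem_sup_right ⟨-x, by rw [adamsSub_filt_zero (neg_mem hx), neg_neg]⟩
  induction m generalizing x with
  | zero => exact h0 x hx
  | succ m ih =>
    cases m with
    | zero =>
      refine filt_succ_induction (C := fun x =>
        x ∈ LinearMap.ker (adamsSub k A) ⊔ LinearMap.range (adamsSub k A)) (fun y hy => h0 y hy)
        (fun y hy p hp => ?_) (fun _ _ => add_mem) hx
      obtain ⟨c, rfl⟩ := mem_filt_zero.1 hy
      rw [← Algebra.smul_def]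
      refine Submodule.smul_mem _ _ (Submodule.mem_sup_left ?_)
      rw [LinearMap.mem_ker, adamsSub_apply, adams_prim hp, sub_self]
    | succ m =>
      have h1 := ih (adams_sub_mem hx)
      have h2 : adamsSub k A x ∈ LinearMap.ker (adamsSub k A) ⊔ LinearMap.range (adamsSub k A) :=
        Submodule.mem_sup_right ⟨x, rfl⟩
      have e : x = ((2 : k) ^ (m + 2) - 2)⁻¹ •
          (adamsSub k A x - (adams k A x - (2 : k) ^ (m + 1 + 1) • x)) := by
        rw [eq_inv_smul_iff₀ (two_pow_sub_ne_zero m), adamsSub_apply]; module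
      rw [e]
      exact Submodule.smul_mem _ _ (sub_mem h2 h1)

/-- The generalized eigenspace of ψ for 2 is the eigenspace. By induction applied to ψx - 2ᵐ⁺²x, the
vector (ψ - 2)x is an eigenvector for 2ᵐ⁺² as well as for 2, hence zero. -/
theorem adamsSub_eq_zero_of_sq [CharZero k] {m : ℕ} {x : A} (hx : x ∈ filt k A m)
    (h : adamsSub k A (adamsSub k A x) = 0) : adamsSub k A x = 0 := by
  induction m generalizing x with
  | zero =>
    rw [adamsSub_filt_zero hx, map_neg, adamsSub_filt_zero hx, neg_neg] at h
    rw [h, map_zero]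
  | succ m ih =>
    cases m with
    | zero =>
      have h1 : adamsSub k A x ∈ filt k A 0 := by
        have := adams_sub_mem hx
        rwa [zero_add, pow_one] at this
      rw [adamsSub_filt_zero h1, neg_eq_zero] at h
      exact h
    | succ m =>
      have h1 := ih (adams_sub_mem hx) (by
        rw [map_sub, map_sub, map_smul, map_smul, h, smul_zero, sub_zero, ← adams_adamsSub,
          ← adams_adamsSub, h, map_zero])
      rw [map_sub, map_smul, ← adams_adamsSub, sub_eq_zero] at h1
      rw [adamsSub_apply, h1, ← sub_smul] at h
      exact (smul_eq_zero.1 h).resolve_left (two_pow_sub_ne_zero m)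

theorem isCompl_adamsSub [CharZero k] (hA : PrimGen k A) :
    IsCompl (LinearMap.ker (adamsSub k A)) (LinearMap.range (adamsSub k A)) := by
  refine ⟨Submodule.disjoint_def.2 ?_, codisjoint_iff.2 (eq_top_iff.2 fun x _ => ?_)⟩
  · rintro _ h ⟨x, rfl⟩
    obtain ⟨m, hm⟩ := exists_mem_filt hA x
    exact adamsSub_eq_zero_of_sq hm h
  · obtain ⟨m, hm⟩ := exists_mem_filt hA x
    exact mem_sup_ker_range hm

theorem comm_comul (hA : PrimGen k A) (x : A) :
    Algebra.TensorProduct.comm k A A (Bialgebra.comulAlgHom k A x) =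
      Bialgebra.comulAlgHom k A x := by
  have : (Algebra.TensorProduct.comm k A A).toAlgHom.comp (Bialgebra.comulAlgHom k A) =
      Bialgebra.comulAlgHom k A := by
    refine AlgHom.ext_of_adjoin_eq_top hA fun p hp => ?_
    have := mem_prims.1 hp
    simp only [AlgHom.comp_apply, this, map_add]
    simp [add_comm]
  exact DFunLike.congr_fun this x

theorem commute_of_prims (hA : PrimGen k A) {u : A} (h : ∀ p ∈ prims k A, Commute p u) (x : A) :
    Commute x u := by
  have hx : x ∈ Algebra.adjoin k (prims k A : Set A) := by rw [hA]; trivial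
  induction hx using Algebra.adjoin_induction with
  | mem x hx => exact h x hx
  | algebraMap c => exact Algebra.commutes c u
  | add x y _ _ hx hy => exact hx.add_left hy
  | mul x y _ _ hx hy => exact hx.mul_left hy

end filtration

/-! ### Additive 2-cocycles of the cobar complex -/

section cobar
variable (k : Type u) [Field k] (A : Type w) [Ring A] [Bialgebra k A]

/-- `a ⊗ b ↦ a ⊗ b ⊗ 1`. -/
noncomputable abbrev leg12 : A ⊗[k] A →ₐ[k] A ⊗[k] (A ⊗[k] A) :=
  Algebra.TensorProduct.map (AlgHom.id k A) Algebra.TensorProduct.includeLeft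

/-- `a ⊗ b ↦ 1 ⊗ a ⊗ b`. -/
noncomputable abbrev leg23 : A ⊗[k] A →ₐ[k] A ⊗[k] (A ⊗[k] A) :=
  Algebra.TensorProduct.includeRight

/-- `a ⊗ b ↦ a ⊗ 1 ⊗ b`. -/
noncomputable abbrev leg13 : A ⊗[k] A →ₐ[k] A ⊗[k] (A ⊗[k] A) :=
  Algebra.TensorProduct.map (AlgHom.id k A) Algebra.TensorProduct.includeRight

/-- `Δ ⊗ I`. -/
noncomputable abbrev comul12 : A ⊗[k] A →ₐ[k] A ⊗[k] (A ⊗[k] A) :=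
  (Algebra.TensorProduct.assoc k k k A A A).toAlgHom.comp
    (Algebra.TensorProduct.map (Bialgebra.comulAlgHom k A) (AlgHom.id k A))

/-- `I ⊗ Δ`. -/
noncomputable abbrev comul23 : A ⊗[k] A →ₐ[k] A ⊗[k] (A ⊗[k] A) :=
  Algebra.TensorProduct.map (AlgHom.id k A) (Bialgebra.comulAlgHom k A)

/-- The flip `a ⊗ b ↦ b ⊗ a`. -/
noncomputable abbrev flip : A ⊗[k] A →ₐ[k] A ⊗[k] A :=
  (Algebra.TensorProduct.comm k A A).toAlgHom

/-- `ε ⊗ I`. -/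
noncomputable abbrev epsL : A ⊗[k] A →ₐ[k] A :=
  (Algebra.TensorProduct.lid k A).toAlgHom.comp
    (Algebra.TensorProduct.map (Bialgebra.counitAlgHom k A) (AlgHom.id k A))

/-- `I ⊗ ε`. -/
noncomputable abbrev epsR : A ⊗[k] A →ₐ[k] A :=
  (Algebra.TensorProduct.rid k k A).toAlgHom.comp
    (Algebra.TensorProduct.map (AlgHom.id k A) (Bialgebra.counitAlgHom k A))

/-- The exchange of the first two factors. -/
noncomputable abbrev swap12 : A ⊗[k] (A ⊗[k] A) →ₗ[k] A ⊗[k] (A ⊗[k] A) :=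
  (TensorProduct.leftComm k A A A).toLinearMap

/-- The exchange of the last two factors. -/
noncomputable abbrev swap23 : A ⊗[k] (A ⊗[k] A) →ₗ[k] A ⊗[k] (A ⊗[k] A) :=
  LinearMap.lTensor A (TensorProduct.comm k A A).toLinearMap

variable {A}

/-- Additive `2`-cocycles of the cobar complex. -/
def IsAddCocycle (F : A ⊗[k] A) : Prop :=
  leg12 k A F + comul12 k A F = leg23 k A F + comul23 k A F

/-- The coboundary `u ⊗ 1 + 1 ⊗ u - Δ(u)`. -/
noncomputable def cobound : A →ₗ[k] A ⊗[k] A :=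
  (Algebra.TensorProduct.includeLeft : A →ₐ[k] A ⊗[k] A).toLinearMap +
    (Algebra.TensorProduct.includeRight : A →ₐ[k] A ⊗[k] A).toLinearMap -
    (Bialgebra.comulAlgHom k A).toLinearMap

variable {k}

theorem cobound_apply (u : A) :
    cobound k u = u ⊗ₜ[k] 1 + 1 ⊗ₜ[k] u - Bialgebra.comulAlgHom k A u := rfl

theorem comul12_tmul (a b : A) :
    comul12 k A (a ⊗ₜ b) = TensorProduct.assoc k A A A (Bialgebra.comulAlgHom k A a ⊗ₜ b) := rfl

theorem swap12_assoc (t : A ⊗[k] A) (b : A) :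
    swap12 k A (TensorProduct.assoc k A A A (t ⊗ₜ b)) =
      TensorProduct.assoc k A A A (flip k A t ⊗ₜ b) := by
  induction t using TensorProduct.induction_on with
  | zero => simp
  | tmul x y => simp
  | add x y hx hy => simp only [TensorProduct.add_tmul, map_add, hx, hy]

theorem swap12_leg13 (F : A ⊗[k] A) : swap12 k A (leg13 k A F) = leg23 k A F := by
  induction F using TensorProduct.induction_on with
  | zero => simp
  | tmul x y => simp
  | add x y hx hy => simp only [map_add, hx, hy]

theorem swap12_leg23 (F : A ⊗[k] A) : swap12 k A (leg23 k A F) = leg13 k A F := by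
  induction F using TensorProduct.induction_on with
  | zero => simp
  | tmul x y => simp
  | add x y hx hy => simp only [map_add, hx, hy]

theorem swap12_leg12 (F : A ⊗[k] A) : swap12 k A (leg12 k A F) = leg12 k A (flip k A F) := by
  induction F using TensorProduct.induction_on with
  | zero => simp
  | tmul x y => simp
  | add x y hx hy => simp only [map_add, hx, hy]

theorem swap23_leg12 (F : A ⊗[k] A) : swap23 k A (leg12 k A F) = leg13 k A F := by
  induction F using TensorProduct.induction_on with
  | zero => simp
  | tmul x y => simp
  | add x y hx hy => simp only [map_add, hx, hy]

theorem swap23_leg13 (F : A ⊗[k] A) : swap23 k A (leg13 k A F) = leg12 k A F := by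
  induction F using TensorProduct.induction_on with
  | zero => simp
  | tmul x y => simp
  | add x y hx hy => simp only [map_add, hx, hy]

theorem swap23_leg23 (F : A ⊗[k] A) : swap23 k A (leg23 k A F) = leg23 k A (flip k A F) := by
  induction F using TensorProduct.induction_on with
  | zero => simp
  | tmul x y => simp
  | add x y hx hy => simp only [map_add, hx, hy]

theorem swap12_comul12 (hA : PrimGen k A) (F : A ⊗[k] A) :
    swap12 k A (comul12 k A F) = comul12 k A F := by
  induction F using TensorProduct.induction_on with
  | zero => simp
  | tmul x y =>
    rw [comul12_tmul, swap12_assoc]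
    exact congrArg (fun t => TensorProduct.assoc k A A A (t ⊗ₜ y)) (comm_comul hA x)
  | add x y hx hy => simp only [map_add, hx, hy]

theorem swap23_comul23 (hA : PrimGen k A) (F : A ⊗[k] A) :
    swap23 k A (comul23 k A F) = comul23 k A F := by
  induction F using TensorProduct.induction_on with
  | zero => simp
  | tmul x y => exact congrArg (fun t => x ⊗ₜ[k] t) (comm_comul hA y)
  | add x y hx hy => simp only [map_add, hx, hy]

theorem swap12_swap23_comul12 (F : A ⊗[k] A) :
    swap12 k A (swap23 k A (comul12 k A F)) = comul23 k A (flip k A F) := by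
  have h : ∀ (t : A ⊗[k] A) (b : A), swap12 k A (swap23 k A
      (TensorProduct.assoc k A A A (t ⊗ₜ b))) = b ⊗ₜ t := by
    intro t b
    induction t using TensorProduct.induction_on with
    | zero => simp
    | tmul x y => simp
    | add x y hx hy => simp only [TensorProduct.add_tmul, TensorProduct.tmul_add, map_add, hx, hy]
  induction F using TensorProduct.induction_on with
  | zero => simp
  | tmul x y => exact h _ _
  | add x y hx hy => simp only [map_add, hx, hy]

/-- A skew-symmetric `2`-cocycle is primitive in both arguments. -/
theorem skew_cocycle [CharZero k] (hA : PrimGen k A) {F : A ⊗[k] A} (hF : IsAddCocycle k F)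
    (hs : flip k A F = -F) :
    comul12 k A F = leg13 k A F + leg23 k A F ∧ comul23 k A F = leg12 k A F + leg13 k A F := by
  -- The cocycle identity says that the two defects of primitivity coincide. By cocommutativity the
  -- first form is fixed by the exchange of factors 1, 2 and the second by that of 2, 3; by skewness
  -- a composite of both exchanges changes the sign. Hence twice the defect vanishes.
  have hLM : comul12 k A F - leg13 k A F - leg23 k A F =
      comul23 k A F - leg12 k A F - leg13 k A F := by
    have := eq_sub_of_add_eq' hF
    rw [this]; abel
  have h12 : swap12 k A (comul12 k A F - leg13 k A F - leg23 k A F) =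
      comul12 k A F - leg13 k A F - leg23 k A F := by
    rw [map_sub, map_sub, swap12_comul12 hA, swap12_leg13, swap12_leg23]; abel
  have h23 : swap23 k A (comul23 k A F - leg12 k A F - leg13 k A F) =
      comul23 k A F - leg12 k A F - leg13 k A F := by
    rw [map_sub, map_sub, swap23_comul23 hA, swap23_leg13, swap23_leg12]; abel
  have hc : swap12 k A (swap23 k A (comul12 k A F - leg13 k A F - leg23 k A F)) =
      -(comul23 k A F - leg12 k A F - leg13 k A F) := by
    rw [map_sub, map_sub, map_sub, map_sub, swap12_swap23_comul12, swap23_leg13, swap12_leg12,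
      swap23_leg23, swap12_leg23, hs, map_neg, map_neg, map_neg]
    abel
  rw [hLM, h23, ← hLM, h12] at hc
  have h0 : comul12 k A F - leg13 k A F - leg23 k A F = 0 := by
    rw [eq_neg_iff_add_eq_zero, ← two_smul k] at hc
    exact (smul_eq_zero.1 hc).resolve_left two_ne_zero
  refine ⟨by rw [sub_sub, sub_eq_zero] at h0; exact h0, ?_⟩
  rw [hLM, sub_sub, sub_eq_zero] at h0; exact h0

theorem comul12_comul (u : A) :
    comul12 k A (Bialgebra.comulAlgHom k A u) = comul23 k A (Bialgebra.comulAlgHom k A u) :=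
  Coalgebra.coassoc_apply (R := k) u

theorem comul12_left (u : A) :
    comul12 k A (u ⊗ₜ 1) = leg12 k A (Bialgebra.comulAlgHom k A u) := by
  rw [comul12_tmul]
  induction Bialgebra.comulAlgHom k A u using TensorProduct.induction_on with
  | zero => simp
  | tmul x y => simp
  | add x y hx hy => simp only [TensorProduct.add_tmul, map_add, hx, hy]

theorem cobound_isAddCocycle (u : A) : IsAddCocycle k (cobound k u) := by
  have h1 : comul12 k A (1 ⊗ₜ u) = 1 ⊗ₜ (1 ⊗ₜ u) := by
    rw [comul12_tmul, map_one, Algebra.TensorProduct.one_def, TensorProduct.assoc_tmul]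
  rw [IsAddCocycle, cobound_apply]
  simp only [map_sub, map_add, comul12_left, h1, comul12_comul]
  simp only [Algebra.TensorProduct.map_tmul, map_one, AlgHom.coe_id, id_eq,
    Algebra.TensorProduct.includeLeft_apply, Algebra.TensorProduct.includeRight_apply,
    Algebra.TensorProduct.one_def]
  abel

theorem flip_cobound (hA : PrimGen k A) (u : A) : flip k A (cobound k u) = cobound k u := by
  rw [cobound_apply, map_sub, map_add]
  have : flip k A (Bialgebra.comulAlgHom k A u) = _ := comm_comul hA u
  rw [this]
  simp [add_comm]

/-- `ψ² ⊗ ψ²` on symmetric `2`-cocycles is multiplication by `2` up to a coboundary. -/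
theorem adams_symm_cocycle (hA : PrimGen k A) {F : A ⊗[k] A} (hF : IsAddCocycle k F)
    (hs : flip k A F = F) :
    TensorProduct.map (adams k A) (adams k A) F =
      (2 : k) • F - cobound k (LinearMap.mul' k A F) := by
  -- The claim is a linear combination of four contractions of the cocycle identity from three
  -- factors to two. The first produces ψ ⊗ ψ from (Δ ⊗ I)F, the third produces Δ(μF), and the
  -- second and fourth eliminate the mixed terms.
  let Θ₁ : A ⊗[k] (A ⊗[k] A) →ₗ[k] A ⊗[k] A :=
    TensorProduct.map (LinearMap.mul' k A) (adams k A) ∘ₗ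
      (TensorProduct.assoc k A A A).symm.toLinearMap
  let Θ₂ : A ⊗[k] (A ⊗[k] A) →ₗ[k] A ⊗[k] A := LinearMap.lTensor A (LinearMap.mul' k A)
  let Θ₃ : A ⊗[k] (A ⊗[k] A) →ₗ[k] A ⊗[k] A :=
    LinearMap.mul' k (A ⊗[k] A) ∘ₗ
      TensorProduct.map LinearMap.id (Bialgebra.comulAlgHom k A).toLinearMap ∘ₗ
      (TensorProduct.assoc k A A A).symm.toLinearMap
  let Θ₄ : A ⊗[k] (A ⊗[k] A) →ₗ[k] A ⊗[k] A := Θ₂ ∘ₗ swap12 k A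
  have t1 : ∀ a b c, Θ₁ (a ⊗ₜ (b ⊗ₜ c)) = (a * b) ⊗ₜ adams k A c := fun _ _ _ => rfl
  have t2 : ∀ a b c, Θ₂ (a ⊗ₜ (b ⊗ₜ c)) = a ⊗ₜ (b * c) := fun _ _ _ => rfl
  have t3 : ∀ a b c, Θ₃ (a ⊗ₜ (b ⊗ₜ c)) = (a ⊗ₜ b) * Bialgebra.comulAlgHom k A c :=
    fun _ _ _ => rfl
  have t4 : ∀ a b c, Θ₄ (a ⊗ₜ (b ⊗ₜ c)) = b ⊗ₜ (a * c) := fun _ _ _ => rfl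
  have a1 : adams k A 1 = 1 := adams_one
  have e1a : ∀ G, Θ₁ (leg12 k A G) = LinearMap.mul' k A G ⊗ₜ 1 := by
    intro G
    induction G using TensorProduct.induction_on with
    | zero => simp
    | tmul x y => simp [t1, a1]
    | add x y hx hy => simp only [map_add, hx, hy, TensorProduct.add_tmul]
  have e1b : ∀ G, Θ₁ (comul12 k A G) = TensorProduct.map (adams k A) (adams k A) G := by
    intro G
    induction G using TensorProduct.induction_on with
    | zero => simp
    | tmul x y =>
      have h : ∀ t : A ⊗[k] A, Θ₁ (TensorProduct.assoc k A A A (t ⊗ₜ y)) =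
          LinearMap.mul' k A t ⊗ₜ adams k A y := by
        intro t
        induction t using TensorProduct.induction_on with
        | zero => simp
        | tmul x y => simp [t1]
        | add x y hx hy => simp only [map_add, hx, hy, TensorProduct.add_tmul]
      exact h _
    | add x y hx hy => simp only [map_add, hx, hy]
  have e1c : ∀ G, Θ₁ (leg23 k A G) = LinearMap.lTensor A (adams k A) G := by
    intro G
    induction G using TensorProduct.induction_on with
    | zero => simp
    | tmul x y => simp [t1]
    | add x y hx hy => simp only [map_add, hx, hy]
  have e2a : ∀ G, Θ₂ (leg12 k A G) = G := by
    intro G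
    induction G using TensorProduct.induction_on with
    | zero => simp
    | tmul x y => simp [t2]
    | add x y hx hy => simp only [map_add, hx, hy]
  have e2c : ∀ G, Θ₂ (leg23 k A G) = 1 ⊗ₜ LinearMap.mul' k A G := by
    intro G
    induction G using TensorProduct.induction_on with
    | zero => simp
    | tmul x y => simp [t2]
    | add x y hx hy => simp only [map_add, hx, hy, TensorProduct.tmul_add]
  have e2d : ∀ G, Θ₂ (comul23 k A G) = LinearMap.lTensor A (adams k A) G := by
    intro G
    induction G using TensorProduct.induction_on with
    | zero => simp
    | tmul x y => rfl
    | add x y hx hy => simp only [map_add, hx, hy]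
  have e3a : ∀ G, Θ₃ (leg12 k A G) = G := by
    intro G
    induction G using TensorProduct.induction_on with
    | zero => simp
    | tmul x y => simp [t3]
    | add x y hx hy => simp only [map_add, hx, hy]
  have e3b : ∀ G, Θ₃ (comul12 k A G) = Bialgebra.comulAlgHom k A (LinearMap.mul' k A G) := by
    intro G
    induction G using TensorProduct.induction_on with
    | zero => simp
    | tmul x y =>
      have h : ∀ t : A ⊗[k] A, Θ₃ (TensorProduct.assoc k A A A (t ⊗ₜ y)) =
          t * Bialgebra.comulAlgHom k A y := by
        intro t
        induction t using TensorProduct.induction_on with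
        | zero => simp
        | tmul x y => simp [t3]
        | add x y hx hy => simp only [map_add, hx, hy, TensorProduct.add_tmul, add_mul]
      rw [comul12_tmul, h, LinearMap.mul'_apply, map_mul]
    | add x y hx hy => simp only [map_add, hx, hy]
  have e34 : ∀ G, Θ₃ (leg23 k A G) = Θ₄ (comul23 k A G) := by
    intro G
    induction G using TensorProduct.induction_on with
    | zero => simp
    | tmul x y =>
      have h : ∀ t : A ⊗[k] A, Θ₄ (x ⊗ₜ t) = (1 ⊗ₜ x) * t := by
        intro t
        induction t using TensorProduct.induction_on with
        | zero => simp
        | tmul x y => simp [t4]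
        | add x y hx hy => simp only [map_add, hx, hy, TensorProduct.tmul_add, mul_add]
      have h2 : comul23 k A (x ⊗ₜ y) = x ⊗ₜ Bialgebra.comulAlgHom k A y := rfl
      rw [h2, h]
      exact t3 1 x y
    | add x y hx hy => simp only [map_add, hx, hy]
  -- Both sides contract x ⊗ Δ²(y), and differ by an exchange of two of the three factors of the
  -- iterated coproduct of `y`; cocommutativity identifies them.
  have e13 : ∀ G, Θ₃ (comul23 k A G) = Θ₁ (comul23 k A G) := by
    intro G
    induction G using TensorProduct.induction_on with
    | zero => simp
    | tmul x y =>
      have h1 : ∀ t : A ⊗[k] A, Θ₁ (x ⊗ₜ t) = (x ⊗ₜ 1) * Θ₂ (comul23 k A t) := by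
        intro t
        rw [e2d]
        induction t using TensorProduct.induction_on with
        | zero => simp
        | tmul x y => simp [t1]
        | add x y hx hy => simp only [map_add, hx, hy, TensorProduct.tmul_add, mul_add]
      have h3 : ∀ t : A ⊗[k] A, Θ₃ (x ⊗ₜ t) = (x ⊗ₜ 1) * Θ₂ (swap12 k A (comul23 k A t)) := by
        intro t
        induction t using TensorProduct.induction_on with
        | zero => simp
        | tmul a b =>
          have h2 : comul23 k A (a ⊗ₜ b) = a ⊗ₜ Bialgebra.comulAlgHom k A b := rfl
          rw [t3, h2]
          induction Bialgebra.comulAlgHom k A b using TensorProduct.induction_on with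
          | zero => simp
          | tmul c d => simp [t2]
          | add c d hc hd => simp only [map_add, hc, hd, TensorProduct.tmul_add, mul_add]
        | add x y hx hy => simp only [map_add, hx, hy, TensorProduct.tmul_add, mul_add]
      have h2 : comul23 k A (x ⊗ₜ y) = x ⊗ₜ Bialgebra.comulAlgHom k A y := rfl
      rw [h2, h1, h3, ← comul12_comul, swap12_comul12 hA]
    | add x y hx hy => simp only [map_add, hx, hy]
  have e4a : ∀ G, Θ₄ (leg12 k A G) = flip k A G := by
    intro G
    rw [← e2a (flip k A G), ← swap12_leg12]; rfl
  have e4b : ∀ G, Θ₄ (comul12 k A G) = Θ₂ (comul12 k A G) := by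
    intro G
    rw [← swap12_comul12 hA G]
    change Θ₂ (swap12 k A (swap12 k A _)) = _
    rw [swap12_comul12 hA, swap12_comul12 hA]
  have e4c : ∀ G, Θ₄ (leg23 k A G) = G := by
    intro G
    induction G using TensorProduct.induction_on with
    | zero => simp
    | tmul x y => simp [t4]
    | add x y hx hy => simp only [map_add, hx, hy]
  have H : leg12 k A F + comul12 k A F = leg23 k A F + comul23 k A F := hF
  have H1 := congrArg Θ₁ H
  have H2 := congrArg Θ₂ H
  have H3 := congrArg Θ₃ H
  have H4 := congrArg Θ₄ H
  rw [map_add, map_add, e1a, e1b, e1c] at H1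
  rw [map_add, map_add, e2a, e2c, e2d] at H2
  rw [map_add, map_add, e3a, e3b, e34, e13] at H3
  rw [map_add, map_add, e4a, e4b, e4c, hs] at H4
  rw [cobound_apply]
  -- Symmetry of `F` makes the outer terms of the fourth relation cancel, leaving the equality of
  -- the mixed terms that links the second relation to the third.
  have H4' := add_left_cancel H4
  rw [H4'] at H2
  rw [eq_sub_of_add_eq' H1, eq_sub_of_add_eq' H3.symm, eq_sub_of_add_eq' H2.symm, two_smul]
  abel

end cobar

/-! ### Weights on normalized cocycles -/

section cobar
variable (k : Type u) [Field k] (A : Type w) [Ring A] [Bialgebra k A]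

/-- The filtration on the tensor square of the augmentation ideal. -/
noncomputable def augFilt (m : ℕ) : Submodule k (A ⊗[k] A) :=
  Submodule.span k {t | ∃ i j, i + j ≤ m ∧
    ∃ a ∈ filt k A i ⊓ LinearMap.ker (Bialgebra.counitAlgHom k A).toLinearMap,
    ∃ b ∈ filt k A j ⊓ LinearMap.ker (Bialgebra.counitAlgHom k A).toLinearMap, a ⊗ₜ[k] b = t}

variable {k A}

theorem augFilt_mono {m n : ℕ} (h : m ≤ n) : augFilt k A m ≤ augFilt k A n := by
  refine Submodule.span_mono ?_
  rintro _ ⟨i, j, hij, r⟩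
  exact ⟨i, j, hij.trans h, r⟩

theorem eq_zero_of_filt_zero {a : A}
    (ha : a ∈ filt k A 0 ⊓ LinearMap.ker (Bialgebra.counitAlgHom k A).toLinearMap) : a = 0 := by
  obtain ⟨h1, h2⟩ := ha
  obtain ⟨c, rfl⟩ := mem_filt_zero.1 h1
  have h3 : Bialgebra.counitAlgHom k A (algebraMap k A c) = 0 := h2
  rw [AlgHom.commutes] at h3
  have h4 : c = 0 := h3
  rw [h4, map_zero]

/-- Each leg in the augmentation ideal has weight at least one, so a nonzero normalized tensor has
weight at least two. This starts the inductions below and excludes the eigenvalue 2. -/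
theorem augFilt_one : augFilt k A 1 = ⊥ := by
  rw [eq_bot_iff, augFilt, Submodule.span_le]
  rintro _ ⟨i, j, hij, a, ha, b, hb, rfl⟩
  rcases Nat.eq_zero_or_pos i with rfl | hi
  · rw [eq_zero_of_filt_zero ha, TensorProduct.zero_tmul]; exact zero_mem _
  · obtain rfl : j = 0 := by omega
    rw [eq_zero_of_filt_zero hb, TensorProduct.tmul_zero]; exact zero_mem _

theorem counit_mul' (t : A ⊗[k] A) :
    Bialgebra.counitAlgHom k A (LinearMap.mul' k A t) =
      Bialgebra.counitAlgHom k A (epsL k A t) := by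
  induction t using TensorProduct.induction_on with
  | zero => simp
  | tmul x y => simp
  | add x y hx hy => simp only [map_add, hx, hy]

theorem epsL_comul (a : A) : epsL k A (Bialgebra.comulAlgHom k A a) = a := by
  have := Coalgebra.rTensor_counit_comul (R := k) a
  change TensorProduct.lid k A ((Coalgebra.counit (R := k)).rTensor A
    (Coalgebra.comul (R := k) a)) = _
  rw [this]; simp

theorem epsR_comul (a : A) : epsR k A (Bialgebra.comulAlgHom k A a) = a := by
  have := Coalgebra.lTensor_counit_comul (R := k) a
  change TensorProduct.rid k A ((Coalgebra.counit (R := k)).lTensor A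
    (Coalgebra.comul (R := k) a)) = _
  rw [this]; simp

theorem counit_adams (a : A) :
    Bialgebra.counitAlgHom k A (adams k A a) = Bialgebra.counitAlgHom k A a := by
  rw [adams, LinearMap.comp_apply, counit_mul', AlgHom.toLinearMap_apply, epsL_comul]

theorem adams_sub_mem_aug {m : ℕ} {a : A}
    (ha : a ∈ filt k A (m + 1) ⊓ LinearMap.ker (Bialgebra.counitAlgHom k A).toLinearMap) :
    adams k A a - (2 : k) ^ (m + 1) • a ∈
      filt k A m ⊓ LinearMap.ker (Bialgebra.counitAlgHom k A).toLinearMap := by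
  refine ⟨adams_sub_mem ha.1, ?_⟩
  have h : Bialgebra.counitAlgHom k A a = 0 := ha.2
  change Bialgebra.counitAlgHom k A (_ - _) = 0
  rw [map_sub, map_smul, counit_adams, h, smul_zero, sub_zero]

theorem adams_mem_aug {m : ℕ} {a : A}
    (ha : a ∈ filt k A m ⊓ LinearMap.ker (Bialgebra.counitAlgHom k A).toLinearMap) :
    adams k A a ∈ filt k A m ⊓ LinearMap.ker (Bialgebra.counitAlgHom k A).toLinearMap :=
  ⟨adams_mem_filt ha.1, (counit_adams a).trans ha.2⟩

/-- Weights add under tensor products: 2ⁱ · 2ʲ = 2ⁱ⁺ʲ on the bidegree (i, j) part. Tensors of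
smaller total degree are absorbed in the error term. -/
theorem adams_sub_mem_augFilt {m : ℕ} {F : A ⊗[k] A} (hF : F ∈ augFilt k A (m + 1)) :
    TensorProduct.map (adams k A) (adams k A) F - (2 : k) ^ (m + 1) • F ∈ augFilt k A m := by
  induction hF using Submodule.span_induction with
  | mem x hx =>
    obtain ⟨i, j, hij, a, ha, b, hb, rfl⟩ := hx
    rcases Nat.eq_zero_or_pos i with rfl | hi
    · rw [eq_zero_of_filt_zero ha, TensorProduct.zero_tmul, map_zero, smul_zero, sub_zero]
      exact zero_mem _
    rcases Nat.eq_zero_or_pos j with rfl | hj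
    · rw [eq_zero_of_filt_zero hb, TensorProduct.tmul_zero, map_zero, smul_zero, sub_zero]
      exact zero_mem _
    obtain ⟨i, rfl⟩ := Nat.exists_eq_add_of_le' hi
    obtain ⟨j, rfl⟩ := Nat.exists_eq_add_of_le' hj
    rw [TensorProduct.map_tmul]
    rcases hij.lt_or_eq with h | h
    · exact sub_mem (Submodule.subset_span ⟨i + 1, j + 1, by omega, _, adams_mem_aug ha, _,
        adams_mem_aug hb, rfl⟩) (Submodule.smul_mem _ _ (Submodule.subset_span
          ⟨i + 1, j + 1, by omega, _, ha, _, hb, rfl⟩))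
    · have e : adams k A a ⊗ₜ[k] adams k A b - (2 : k) ^ (m + 1) • (a ⊗ₜ[k] b) =
          (adams k A a - (2 : k) ^ (i + 1) • a) ⊗ₜ[k] adams k A b +
          (2 : k) ^ (i + 1) • (a ⊗ₜ[k] (adams k A b - (2 : k) ^ (j + 1) • b)) := by
        rw [TensorProduct.sub_tmul, TensorProduct.tmul_sub, smul_sub, ← h, pow_add (2 : k) (i + 1),
          TensorProduct.tmul_smul, smul_smul, ← TensorProduct.smul_tmul']
        abel
      rw [e]
      exact add_mem (Submodule.subset_span ⟨i, j + 1, by omega, _, adams_sub_mem_aug ha, _,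
        adams_mem_aug hb, rfl⟩) (Submodule.smul_mem _ _ (Submodule.subset_span
          ⟨i + 1, j, by omega, _, ha, _, adams_sub_mem_aug hb, rfl⟩))
  | zero => rw [map_zero, smul_zero, sub_zero]; exact zero_mem _
  | add x y _ _ hx hy => rw [map_add, smul_add, add_sub_add_comm]; exact add_mem hx hy
  | smul c x _ hx =>
    rw [map_smul, smul_comm, ← smul_sub]; exact Submodule.smul_mem _ _ hx

/-- A tensor killed by the counit in each argument lies in some step of the filtration. -/
theorem exists_mem_augFilt (hA : PrimGen k A) {F : A ⊗[k] A} (hl : epsL k A F = 0)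
    (hr : epsR k A F = 0) : ∃ m, F ∈ augFilt k A m := by
  -- The projection id - ηε onto the augmentation ideal. Its tensor square fixes `F`, because the
  -- correction terms involve only the two counits of `F`.
  let π : A →ₗ[k] A := LinearMap.id - (Algebra.linearMap k A) ∘ₗ
    (Bialgebra.counitAlgHom k A).toLinearMap
  have hπ : ∀ a, π a = a - algebraMap k A (Bialgebra.counitAlgHom k A a) := fun _ => rfl
  have h1 : ∀ G : A ⊗[k] A, TensorProduct.map π π G = G - 1 ⊗ₜ epsL k A G - epsR k A G ⊗ₜ 1 +
      Bialgebra.counitAlgHom k A (epsL k A G) • 1 ⊗ₜ 1 := by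
    intro G
    induction G using TensorProduct.induction_on with
    | zero => simp
    | tmul x y =>
      simp only [TensorProduct.map_tmul, hπ, Algebra.algebraMap_eq_smul_one,
        TensorProduct.sub_tmul, TensorProduct.tmul_sub, TensorProduct.smul_tmul',
        TensorProduct.tmul_smul]
      simp [← TensorProduct.smul_tmul']
      module
    | add x y hx hy =>
      simp only [map_add, hx, hy, TensorProduct.add_tmul, TensorProduct.tmul_add, add_smul]
      abel
  have h2 : ∀ G : A ⊗[k] A, ∃ m, TensorProduct.map π π G ∈ augFilt k A m := by
    intro G
    induction G using TensorProduct.induction_on with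
    | zero => exact ⟨0, by rw [map_zero]; exact zero_mem _⟩
    | tmul x y =>
      obtain ⟨i, hi⟩ := exists_mem_filt hA x
      obtain ⟨j, hj⟩ := exists_mem_filt hA y
      have hm : ∀ {i} {x : A}, x ∈ filt k A i → π x ∈
          filt k A i ⊓ LinearMap.ker (Bialgebra.counitAlgHom k A).toLinearMap := by
        intro i x hx
        refine ⟨sub_mem hx (filt_mono (Nat.zero_le i) (mem_filt_zero.2 ⟨_, rfl⟩)), ?_⟩
        change Bialgebra.counitAlgHom k A (π x) = 0
        rw [hπ, map_sub, AlgHom.commutes]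
        exact sub_self _
      exact ⟨i + j, Submodule.subset_span ⟨i, j, le_rfl, _, hm hi, _, hm hj, rfl⟩⟩
    | add x y hx hy =>
      obtain ⟨m, hm⟩ := hx
      obtain ⟨n, hn⟩ := hy
      rw [map_add]
      exact ⟨m + n, add_mem (augFilt_mono (by omega) hm) (augFilt_mono (by omega) hn)⟩
  obtain ⟨m, hm⟩ := h2 F
  rw [h1, hl, hr] at hm
  exact ⟨m, by simpa using hm⟩

theorem commute_cobound {p v : A} (hp : p ∈ prims k A) (h : Commute p v) :
    Commute (Bialgebra.comulAlgHom k A p) (cobound k v) := by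
  rw [cobound_apply]
  refine Commute.sub_right ?_ (h.map (Bialgebra.comulAlgHom k A))
  rw [mem_prims.1 hp]
  have h' : p * v = v * p := h
  rw [Commute, SemiconjBy]
  simp only [mul_add, add_mul, Algebra.TensorProduct.tmul_mul_tmul, mul_one, one_mul, h']
  abel

/-- Multiplication is equivariant for the adjoint action of primitive elements: in p(xy) - (xy)p the
middle terms xpy cancel. It makes μF central for invariant `F`, and makes ψ commute with ad(p). -/
theorem mul'_commutator {p : A} (hp : p ∈ prims k A) (F : A ⊗[k] A) :
    LinearMap.mul' k A (Bialgebra.comulAlgHom k A p * F - F * Bialgebra.comulAlgHom k A p) =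
      p * LinearMap.mul' k A F - LinearMap.mul' k A F * p := by
  induction F using TensorProduct.induction_on with
  | zero => simp
  | tmul x y =>
    simp only [mem_prims.1 hp, mul_add, add_mul, Algebra.TensorProduct.tmul_mul_tmul, map_add,
      map_sub, LinearMap.mul'_apply, one_mul, mul_one]
    noncomm_ring
  | add x y hx hy =>
    rw [mul_add (Bialgebra.comulAlgHom k A p), add_mul, add_sub_add_comm, map_add, map_add,
      hx, hy]
    noncomm_ring

theorem commute_mul' {p : A} (hp : p ∈ prims k A) {F : A ⊗[k] A}
    (h : Commute (Bialgebra.comulAlgHom k A p) F) : Commute p (LinearMap.mul' k A F) := by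
  have := mul'_commutator hp F
  rw [h.eq, sub_self, map_zero] at this
  exact sub_eq_zero.1 this.symm

/-- Symmetric `2`-cocycles are coboundaries, invariant ones are coboundaries of central elements. -/
theorem exists_cobound_of_mem [CharZero k] (hA : PrimGen k A) {m : ℕ} {F : A ⊗[k] A}
    (hm : F ∈ augFilt k A m) (hF : IsAddCocycle k F) (hs : flip k A F = F) :
    ∃ u : A, F = cobound k u ∧ ((∀ p ∈ prims k A, Commute (Bialgebra.comulAlgHom k A p) F) →
      ∀ p ∈ prims k A, Commute p u) := by
  have h0 : F ∈ augFilt k A 1 → ∃ u : A, F = cobound k u ∧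
      ((∀ p ∈ prims k A, Commute (Bialgebra.comulAlgHom k A p) F) →
      ∀ p ∈ prims k A, Commute p u) := by
    intro h
    rw [augFilt_one, Submodule.mem_bot] at h
    exact ⟨0, by rw [h, map_zero], fun _ p _ => Commute.zero_right p⟩
  induction m generalizing F with
  | zero => exact h0 (augFilt_mono zero_le_one hm)
  | succ m ih =>
    cases m with
    | zero => exact h0 hm
    | succ m =>
      have hG := adams_sub_mem_augFilt hm
      have e := adams_symm_cocycle hA hF hs
      set c : k := (2 : k) ^ (m + 2) - 2 with hc
      have hc0 : c ≠ 0 := two_pow_sub_ne_zero m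
      -- The left side has lower filtration, and the right side shows that it is still a symmetric
      -- cocycle, equal to -cF up to a coboundary. The induction hypothesis applies, and `F` is
      -- recovered after division by `c`.
      have eG : TensorProduct.map (adams k A) (adams k A) F - (2 : k) ^ (m + 1 + 1) • F =
          -(c • F) - cobound k (LinearMap.mul' k A F) := by
        rw [e, hc]; module
      have hcob := cobound_isAddCocycle (k := k) (LinearMap.mul' k A F)
      rw [eG] at hG
      obtain ⟨u, hu, hu2⟩ := ih hG (by
        rw [IsAddCocycle] at *
        simp only [map_sub, map_neg, map_smul]
        have e1 := congrArg (c • ·) hF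
        simp only [smul_add] at e1
        rw [sub_add_sub_comm, sub_add_sub_comm, hcob, ← neg_add, ← neg_add, e1]) (by
        rw [map_sub, map_neg, map_smul, hs, flip_cobound hA]) (fun h => by
          rw [augFilt_one, Submodule.mem_bot] at h
          exact ⟨0, by rw [h, map_zero], fun _ p _ => Commute.zero_right p⟩)
      refine ⟨-(c⁻¹ • (u + LinearMap.mul' k A F)), ?_, fun h p hp => ?_⟩
      · rw [map_neg, map_smul, map_add, ← hu, sub_add_cancel, smul_neg, neg_neg, smul_smul,
          inv_mul_cancel₀ hc0, one_smul]
      -- For invariant `F` the correction μF commutes with primitive elements, so its coboundary is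
      -- invariant and the hypothesis of invariance passes to the induction.
      · have h1 := commute_mul' hp (h p hp)
        refine (Commute.smul_right ((hu2 (fun q hq => ?_) p hp).add_right h1) _).neg_right
        have h2 := commute_mul' hq (h q hq)
        exact ((h q hq).smul_right c).neg_right.sub_right (commute_cobound hq h2)

/-- An eigenvector for 2 drops from each step of weight m + 2 to the preceding one, since 2ᵐ⁺² ≠ 2,
and the step of weight one is zero. -/
theorem eq_zero_of_adams_eq [CharZero k] {m : ℕ} {F : A ⊗[k] A}
    (hm : F ∈ augFilt k A m) (hF : TensorProduct.map (adams k A) (adams k A) F = (2 : k) • F) :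
    F = 0 := by
  induction m with
  | zero =>
    have := augFilt_mono zero_le_one hm
    rwa [augFilt_one, Submodule.mem_bot] at this
  | succ m ih =>
    cases m with
    | zero => rwa [zero_add, augFilt_one, Submodule.mem_bot] at hm
    | succ m =>
      have hG := adams_sub_mem_augFilt hm
      refine ih ?_
      rw [hF, ← sub_smul] at hG
      have h0 := two_pow_sub_ne_zero (k := k) m
      rw [← neg_ne_zero, neg_sub] at h0
      exact (Submodule.smul_mem_iff _ h0).1 hG

/-- The elements of weight `1` for the Adams operation are primitive. -/
theorem ker_adamsSub_le [CharZero k] (hA : PrimGen k A) :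
    LinearMap.ker (adamsSub k A) ≤ prims k A := by
  intro x hx
  rw [LinearMap.mem_ker, adamsSub_apply, sub_eq_zero] at hx
  have hε : Bialgebra.counitAlgHom k A x = 0 := by
    have h := counit_adams (k := k) x
    rw [hx, map_smul, two_smul, add_eq_left] at h
    exact h
  have hl : epsL k A (cobound k x) = 0 := by
    rw [cobound_apply, map_sub, map_add, epsL_comul]
    simp [hε]
  have hr : epsR k A (cobound k x) = 0 := by
    rw [cobound_apply, map_sub, map_add, epsR_comul]
    simp [hε]
  obtain ⟨m, hm⟩ := exists_mem_augFilt hA hl hr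
  -- The product of the coboundary of `x` is 2x - ψ(x) = 0. Hence the coboundary, a symmetric
  -- cocycle, is an exact eigenvector of ψ ⊗ ψ for 2 and vanishes.
  have hμ : LinearMap.mul' k A (cobound k x) = 0 := by
    have e : LinearMap.mul' k A (Bialgebra.comulAlgHom k A x) = adams k A x := rfl
    rw [cobound_apply, map_sub, map_add, e, hx, LinearMap.mul'_apply, LinearMap.mul'_apply,
      mul_one, one_mul, two_smul, sub_self]
  have h := adams_symm_cocycle hA (cobound_isAddCocycle x) (flip_cobound hA x)
  rw [hμ, map_zero, sub_zero] at h
  have h0 := eq_zero_of_adams_eq hm h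
  rw [cobound_apply, sub_eq_zero] at h0
  exact h0.symm

theorem prims_le_ker : prims k A ≤ LinearMap.ker (adamsSub k A) := fun p hp => by
  rw [LinearMap.mem_ker, adamsSub_apply, adams_prim hp, sub_self]

end cobar

/-! ### Symbols of elements of the filtration -/

section symbol
variable {k : Type u} [Field k] {A : Type w} [Ring A] [Bialgebra k A]
  {R : Type*} [CommRing R] [Algebra k R]

/-- The symbol maps: the `m`-th divided convolution power of a linear map `l : A → R`. -/
noncomputable def symb (l : A →ₗ[k] R) : ℕ → (A →ₗ[k] R)
  | 0 => Algebra.linearMap k R ∘ₗ (Bialgebra.counitAlgHom k A).toLinearMap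
  | m + 1 => ((m + 1 : k)⁻¹) • (LinearMap.mul' k R ∘ₗ TensorProduct.map (symb l m) l ∘ₗ
      (Bialgebra.comulAlgHom k A).toLinearMap)

theorem symb_zero (l : A →ₗ[k] R) (x : A) :
    symb l 0 x = algebraMap k R (Bialgebra.counitAlgHom k A x) := rfl

theorem symb_succ (l : A →ₗ[k] R) (m : ℕ) (x : A) : symb l (m + 1) x = ((m + 1 : k)⁻¹) •
    LinearMap.mul' k R (TensorProduct.map (symb l m) l (Bialgebra.comulAlgHom k A x)) := rfl

variable {l : A →ₗ[k] R} (h1 : l 1 = 0)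
include h1

theorem map_filt_zero {b : A} (hb : b ∈ filt k A 0) : l b = 0 := by
  obtain ⟨c, rfl⟩ := mem_filt_zero.1 hb
  rw [Algebra.algebraMap_eq_smul_one, map_smul, h1, smul_zero]

/-- As `l` kills scalars, every nonzero term of the m-th convolution power distributes weight at
least one to each of m factors, which needs weight m. -/
theorem symb_eq_zero {m j : ℕ} (hj : j < m) {x : A} (hx : x ∈ filt k A j) : symb l m x = 0 := by
  induction m generalizing j x with
  | zero => omega
  | succ m ih =>
    rw [symb_succ]
    refine (congrArg _ ?_).trans (smul_zero _)
    refine tfilt_induction (C := fun t => LinearMap.mul' k R (TensorProduct.map (symb l m) l t) = 0)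
      (by simp) (fun x y hx hy => by rw [map_add, map_add, hx, hy, add_zero])
      (fun i i' hi a ha b hb => ?_) (comul_mem_tfilt hx)
    rw [TensorProduct.map_tmul, LinearMap.mul'_apply]
    rcases lt_or_ge i m with h | h
    · rw [ih h ha, zero_mul]
    · obtain rfl : i' = 0 := by omega
      rw [map_filt_zero h1 hb, mul_zero]

/-- In Δ(b)(p ⊗ 1 + 1 ⊗ p) the new factor `p` falls either on the convolution power or on the last
`l`. For `b` of weight m + 1 the first case contributes m + 1 copies of the answer and the second
one copy, which cancels the denominator m + 2. -/
theorem symb_mul_prim [CharZero k] {m : ℕ} {b p : A} (hb : b ∈ filt k A m) (hp : p ∈ prims k A) :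
    symb l (m + 1) (b * p) = symb l m b * l p := by
  induction m generalizing b with
  | zero =>
    obtain ⟨c, rfl⟩ := mem_filt_zero.1 hb
    rw [← Algebra.smul_def, map_smul, symb_succ, mem_prims.1 hp]
    simp only [map_add, TensorProduct.map_tmul, LinearMap.mul'_apply, h1, symb_zero, map_one,
      AlgHom.commutes]
    simp [Algebra.smul_def]
  | succ m ih =>
    have t1 : LinearMap.mul' k R (TensorProduct.map (symb l (m + 1)) l
        (Bialgebra.comulAlgHom k A b * (p ⊗ₜ 1))) =
        LinearMap.mul' k R (TensorProduct.map (symb l m) l (Bialgebra.comulAlgHom k A b)) * l p := by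
      refine tfilt_induction (C := fun t => LinearMap.mul' k R (TensorProduct.map (symb l (m + 1)) l
        (t * (p ⊗ₜ 1))) = LinearMap.mul' k R (TensorProduct.map (symb l m) l t) * l p)
        (by simp) (fun x y hx hy => by rw [add_mul, map_add, map_add, map_add, map_add, add_mul,
          hx, hy]) (fun i j hij a ha b hb => ?_) (comul_mem_tfilt hb)
      rw [Algebra.TensorProduct.tmul_mul_tmul, TensorProduct.map_tmul, TensorProduct.map_tmul,
        LinearMap.mul'_apply, LinearMap.mul'_apply, mul_one]
      rcases Nat.eq_zero_or_pos j with rfl | hj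
      · rw [map_filt_zero h1 hb, mul_zero, mul_zero, zero_mul]
      · rw [ih (filt_mono (by omega) ha), mul_right_comm]
    have t2 : LinearMap.mul' k R (TensorProduct.map (symb l (m + 1)) l
        (Bialgebra.comulAlgHom k A b * (1 ⊗ₜ p))) =
        symb l (m + 1) (epsR k A (Bialgebra.comulAlgHom k A b)) * l p := by
      refine tfilt_induction (C := fun t => LinearMap.mul' k R (TensorProduct.map (symb l (m + 1)) l
        (t * (1 ⊗ₜ p))) = symb l (m + 1) (epsR k A t) * l p)
        (by simp) (fun x y hx hy => by rw [add_mul, map_add, map_add, map_add, map_add, add_mul,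
          hx, hy]) (fun i j hij a ha b hb => ?_) (comul_mem_tfilt hb)
      have e : epsR k A (a ⊗ₜ b) = Bialgebra.counitAlgHom k A b • a := by simp
      rw [Algebra.TensorProduct.tmul_mul_tmul, TensorProduct.map_tmul, LinearMap.mul'_apply,
        mul_one, e, map_smul]
      rcases lt_or_ge i (m + 1) with h | h
      · rw [symb_eq_zero h1 h ha, zero_mul, smul_zero, zero_mul]
      · obtain rfl : j = 0 := by omega
        obtain ⟨c, rfl⟩ := mem_filt_zero.1 hb
        rw [AlgHom.commutes, ← Algebra.smul_def, map_smul, mul_smul_comm, smul_mul_assoc]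
        rfl
    have hm : ((m + 1 : ℕ) + 1 : k) ≠ 0 := by exact_mod_cast (m + 1).succ_ne_zero
    have hm' : ((m : k) + 1) ≠ 0 := by exact_mod_cast m.succ_ne_zero
    rw [epsR_comul] at t2
    rw [symb_succ, map_mul, mem_prims.1 hp, mul_add, map_add, map_add, t1, t2, inv_smul_eq_iff₀ hm]
    have e : LinearMap.mul' k R (TensorProduct.map (symb l m) l (Bialgebra.comulAlgHom k A b)) =
        ((m : k) + 1) • symb l (m + 1) b := by
      rw [symb_succ, smul_smul, mul_inv_cancel₀ hm', one_smul]
    rw [e, ← add_mul, ← smul_mul_assoc]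
    congr 1
    push_cast
    module

theorem symb_mul [CharZero k] {m n : ℕ} {a b : A} (ha : a ∈ filt k A m) (hb : b ∈ filt k A n) :
    symb l (m + n) (a * b) = symb l m a * symb l n b := by
  induction n generalizing b with
  | zero =>
    obtain ⟨c, rfl⟩ := mem_filt_zero.1 hb
    rw [symb_zero, AlgHom.commutes, ← Algebra.commutes, ← Algebra.smul_def, map_smul, mul_comm]
    exact Algebra.smul_def _ _
  | succ n ih =>
    refine filt_succ_induction
      (C := fun b => symb l (m + (n + 1)) (a * b) = symb l m a * symb l (n + 1) b)
      (fun y hy => ?_) (fun y hy p hp => ?_) (fun x y hx hy => ?_) hb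
    · rw [symb_eq_zero h1 (Nat.lt_succ_self n) hy, mul_zero,
        symb_eq_zero h1 (by omega : m + n < m + (n + 1)) (mul_mem_filt ha hy)]
    · rw [← mul_assoc, ← add_assoc, symb_mul_prim h1 (mul_mem_filt ha hy) hp, ih hy,
        symb_mul_prim h1 hy hp, mul_assoc]
    · rw [mul_add, map_add, map_add, mul_add, hx, hy]

end symbol

/-! ### Units of primitively generated bialgebras -/

section units
variable {k : Type u} [Field k] {A : Type w} [Ring A] [Bialgebra k A]

theorem list_prod_mem_filt {I : Type*} {b : I → A} (hb : ∀ i, b i ∈ prims k A) (L : List I) :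
    (L.map b).prod ∈ filt k A L.length := by
  induction L with
  | nil => exact one_mem_filt 0
  | cons i L ih =>
    rw [List.map_cons, List.prod_cons, List.length_cons, add_comm]
    exact mul_mem_filt (prims_le_filt (hb i)) ih

/-- Primitive elements commute up to lower filtration. -/
theorem perm_prod_sub_mem {I : Type*} {b : I → A} (hb : ∀ i, b i ∈ prims k A) {L L' : List I}
    (h : L.Perm L') {m : ℕ} (hm : L.length ≤ m + 1) :
    (L.map b).prod - (L'.map b).prod ∈ filt k A m := by
  induction h generalizing m with
  | nil => rw [sub_self]; exact zero_mem _
  | @cons i L₁ L₂ h ih =>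
    rw [List.map_cons, List.map_cons, List.prod_cons, List.prod_cons, ← mul_sub]
    rw [List.length_cons] at hm
    cases m with
    | zero =>
      obtain rfl := List.length_eq_zero_iff.1 (by omega : L₁.length = 0)
      rw [h.nil_eq, sub_self, mul_zero]; exact zero_mem _
    | succ m =>
      rw [add_comm m 1]
      exact mul_mem_filt (prims_le_filt (hb i)) (ih (by omega))
  | swap i j L =>
    rw [List.length_cons, List.length_cons] at hm
    simp only [List.map_cons, List.prod_cons]
    rw [← mul_assoc, ← mul_assoc, ← sub_mul]
    exact filt_mono (by omega) (mul_mem_filt (prims_le_filt (commutator_mem_prims (hb _) (hb _)))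
      (list_prod_mem_filt hb L))
  | trans h h' ih ih' =>
    rw [← sub_add_sub_cancel]
    exact add_mem (ih hm) (ih' (by rwa [← h.length_eq]))

theorem filt_le_span {I : Type*} {b : I → A}
    (hb : prims k A ≤ Submodule.span k (Set.range b)) (m : ℕ) :
    filt k A m ≤ Submodule.span k {x | ∃ L : List I, L.length ≤ m ∧ (L.map b).prod = x} := by
  induction m with
  | zero =>
    intro x hx
    obtain ⟨c, rfl⟩ := mem_filt_zero.1 hx
    rw [Algebra.algebraMap_eq_smul_one]
    exact Submodule.smul_mem _ _ (Submodule.subset_span ⟨[], le_rfl, rfl⟩)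
  | succ m ih =>
    intro x hx
    refine filt_succ_induction (C := fun x => x ∈ Submodule.span k _) (fun y hy => ?_)
      (fun y hy p hp => ?_) (fun _ _ => add_mem) hx
    · refine Submodule.span_mono ?_ (ih hy)
      rintro _ ⟨L, hL, rfl⟩
      exact ⟨L, by omega, rfl⟩
    · have := Submodule.mul_mem_mul (ih hy) (hb hp)
      rw [Submodule.span_mul_span] at this
      refine Submodule.span_mono ?_ this
      rintro _ ⟨_, ⟨L, hL, rfl⟩, _, ⟨i, rfl⟩, rfl⟩
      exact ⟨L ++ [i], by simpa using hL, by simp⟩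

/-- The symbol of exact filtration degree does not vanish. -/
theorem mem_filt_of_symb_eq_zero [CharZero k] {I : Type*} {b : I → A}
    (hb : ∀ i, b i ∈ prims k A) (hspan : prims k A ≤ Submodule.span k (Set.range b))
    {l : A →ₗ[k] MvPolynomial I k} (h1 : l 1 = 0) (hl : ∀ i, l (b i) = MvPolynomial.X i)
    {m : ℕ} {x : A} (hx : x ∈ filt k A (m + 1)) (h : symb l (m + 1) x = 0) : x ∈ filt k A m := by
  classical
  -- A section of the symbol: a monomial goes to the product of its variables in some order. The
  -- order is irrelevant modulo lower filtration, so x - T(symbol of x) has lower filtration.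
  let T : MvPolynomial I k →ₗ[k] A := (MvPolynomial.basisMonomials I k).constr k
    fun s => ((Finsupp.toMultiset s).toList.map b).prod
  have hT : ∀ s, T (MvPolynomial.monomial s 1) = ((Finsupp.toMultiset s).toList.map b).prod := by
    intro s
    have := (MvPolynomial.basisMonomials I k).constr_basis k
      (fun s => ((Finsupp.toMultiset s).toList.map b).prod) s
    rwa [MvPolynomial.coe_basisMonomials] at this
  have hsymb : ∀ L : List I, symb l L.length (L.map b).prod =
      MvPolynomial.monomial (Multiset.toFinsupp (L : Multiset I)) 1 := by
    intro L
    induction L with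
    | nil => simp [symb_zero]
    | cons i L ih =>
      have h0 : symb l 1 (b i) = MvPolynomial.X i := by
        have := symb_mul_prim h1 (one_mem_filt 0) (hb i)
        rwa [one_mul, symb_zero, map_one, map_one, one_mul, hl] at this
      rw [List.map_cons, List.prod_cons, List.length_cons, add_comm,
        symb_mul h1 (prims_le_filt (hb i)) (list_prod_mem_filt hb L), h0, ih,
        MvPolynomial.X, MvPolynomial.monomial_mul, one_mul, ← Multiset.cons_coe,
        ← Multiset.singleton_add, map_add, Multiset.toFinsupp_singleton]
  have key : Submodule.span k {x | ∃ L : List I, L.length ≤ m + 1 ∧ (L.map b).prod = x} ≤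
      (filt k A m).comap (LinearMap.id - T ∘ₗ symb l (m + 1)) := by
    rw [Submodule.span_le]
    rintro _ ⟨L, hL, rfl⟩
    change (L.map b).prod - T (symb l (m + 1) (L.map b).prod) ∈ filt k A m
    rcases hL.lt_or_eq with h | h
    · rw [symb_eq_zero h1 h (list_prod_mem_filt hb L), map_zero, sub_zero]
      exact filt_mono (by omega) (list_prod_mem_filt hb L)
    · rw [← h, hsymb, hT, Multiset.toFinsupp_toMultiset]
      refine perm_prod_sub_mem hb (Multiset.coe_eq_coe.1 ?_) h.le
      rw [Multiset.coe_toList]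
  have := key (filt_le_span hspan _ hx)
  change x - T (symb l (m + 1) x) ∈ filt k A m at this
  rwa [h, map_zero, sub_zero] at this

/-- The units of a bialgebra generated by primitive elements are scalars. -/
theorem mem_filt_zero_of_mul_eq_one [CharZero k] (hA : PrimGen k A) {x y : A} (h : x * y = 1) :
    x ∈ filt k A 0 := by
  classical
  let bas := Module.Basis.ofVectorSpace k (prims k A)
  let b := fun i => (bas i : A)
  have hb : ∀ i, b i ∈ prims k A := fun i => (bas i).2
  have hspan : prims k A ≤ Submodule.span k (Set.range b) := by
    have e : Set.range b = (prims k A).subtype '' Set.range bas := by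
      rw [← Set.range_comp]; rfl
    rw [e, ← Submodule.map_span, bas.span_eq, Submodule.map_top, Submodule.range_subtype]
  obtain ⟨g, hg⟩ := (bas.constr k (M' := MvPolynomial _ k) MvPolynomial.X).exists_extend
  -- A linear extension to `A` of the map from a basis of the primitive elements to the variables,
  -- corrected by the counit so that it vanishes on 1.
  let l : A →ₗ[k] MvPolynomial _ k := g ∘ₗ (LinearMap.id - (Algebra.linearMap k A) ∘ₗ
    (Bialgebra.counitAlgHom k A).toLinearMap)
  have hl' : ∀ a, l a = g (a - algebraMap k A (Bialgebra.counitAlgHom k A a)) := fun _ => rfl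
  have h1 : l 1 = 0 := by rw [hl', map_one, map_one, sub_self, map_zero]
  have hl : ∀ i, l (b i) = MvPolynomial.X i := by
    intro i
    rw [hl', counit_prims (hb i), map_zero, sub_zero]
    have := congrArg (· (bas i)) hg
    simp only [LinearMap.comp_apply, Module.Basis.constr_basis] at this
    exact this
  have h10 : (1 : A) ≠ 0 := by
    intro h0
    have := congrArg (Bialgebra.counitAlgHom k A) h0
    rw [map_one, map_zero] at this
    exact one_ne_zero this
  -- Every nonzero element has a nonzero symbol in its exact degree. Polynomial rings being domains,
  -- degrees add under multiplication, so the factors of 1 have degree zero.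
  have hne : ∀ x : A, x ≠ 0 → ∃ m, x ∈ filt k A m ∧ symb l m x ≠ 0 := by
    intro x hx
    have hex := exists_mem_filt hA x
    refine ⟨Nat.find hex, Nat.find_spec hex, fun h0 => ?_⟩
    rcases hm : Nat.find hex with _ | m
    · have hs := Nat.find_spec hex
      rw [hm] at h0 hs
      obtain ⟨c, rfl⟩ := mem_filt_zero.1 hs
      rw [symb_zero, AlgHom.commutes] at h0
      have hc : c = 0 := by
        have h0' : MvPolynomial.C c = (0 : MvPolynomial _ k) := h0
        rwa [MvPolynomial.C_eq_zero] at h0'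
      exact hx (by rw [hc, map_zero])
    · have hs := Nat.find_spec hex
      rw [hm] at h0 hs
      exact Nat.find_min hex (by rw [hm]; exact Nat.lt_succ_self m)
        (mem_filt_of_symb_eq_zero hb hspan h1 hl hs h0)
  obtain ⟨m, hxm, hxm'⟩ := hne x fun hx => h10 (by rw [← h, hx, zero_mul])
  obtain ⟨n, hyn, hyn'⟩ := hne y fun hy => h10 (by rw [← h, hy, mul_zero])
  have hxy := symb_mul h1 hxm hyn
  rw [h] at hxy
  rcases Nat.eq_zero_or_pos (m + n) with h0 | h0
  · obtain rfl : m = 0 := by omega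
    exact hxm
  · rw [symb_eq_zero h1 h0 (one_mem_filt 0)] at hxy
    exact absurd hxy.symm (mul_ne_zero hxm' hyn')

/-- Needed to apply the result on units to the constant term of a twist, which lives in A ⊗ A. -/
theorem primGen_tensor (hA : PrimGen k A) : PrimGen k (A ⊗[k] A) := by
  have hl : ∀ x : A, x ⊗ₜ[k] (1 : A) ∈
      Algebra.adjoin k (prims k (A ⊗[k] A) : Set (A ⊗[k] A)) := by
    intro x
    have hx : x ∈ Algebra.adjoin k (prims k A : Set A) := by rw [hA]; trivial
    induction hx using Algebra.adjoin_induction with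
    | mem x hx =>
      refine Algebra.subset_adjoin ?_
      have h := mem_prims.1 hx
      rw [Bialgebra.comulAlgHom_apply] at h
      change Bialgebra.comulAlgHom k (A ⊗[k] A) _ = _
      rw [Bialgebra.comulAlgHom_apply, TensorProduct.comul_tmul, h, Bialgebra.comul_one,
        Algebra.TensorProduct.one_def]
      simp [TensorProduct.add_tmul]
    | algebraMap c =>
      exact Subalgebra.algebraMap_mem _ c
    | add x y _ _ hx hy => rw [TensorProduct.add_tmul]; exact add_mem hx hy
    | mul x y _ _ hx hy =>
      rw [← mul_one (1 : A), ← Algebra.TensorProduct.tmul_mul_tmul]; exact mul_mem hx hy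
  have hr : ∀ x : A, (1 : A) ⊗ₜ[k] x ∈
      Algebra.adjoin k (prims k (A ⊗[k] A) : Set (A ⊗[k] A)) := by
    intro x
    have hx : x ∈ Algebra.adjoin k (prims k A : Set A) := by rw [hA]; trivial
    induction hx using Algebra.adjoin_induction with
    | mem x hx =>
      refine Algebra.subset_adjoin ?_
      have h := mem_prims.1 hx
      rw [Bialgebra.comulAlgHom_apply] at h
      change Bialgebra.comulAlgHom k (A ⊗[k] A) _ = _
      rw [Bialgebra.comulAlgHom_apply, TensorProduct.comul_tmul, h, Bialgebra.comul_one,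
        Algebra.TensorProduct.one_def]
      simp [TensorProduct.tmul_add]
    | algebraMap c =>
      rw [Algebra.algebraMap_eq_smul_one, TensorProduct.tmul_smul, ← Algebra.TensorProduct.one_def,
        ← Algebra.algebraMap_eq_smul_one]
      exact Subalgebra.algebraMap_mem _ c
    | add x y _ _ hx hy => rw [TensorProduct.tmul_add]; exact add_mem hx hy
    | mul x y _ _ hx hy =>
      rw [← mul_one (1 : A), ← Algebra.TensorProduct.tmul_mul_tmul]; exact mul_mem hx hy
  rw [PrimGen, eq_top_iff]
  rintro t -
  induction t using TensorProduct.induction_on with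
  | zero => exact zero_mem _
  | tmul x y =>
    have e : x ⊗ₜ[k] y = (x ⊗ₜ 1) * (1 ⊗ₜ y) := by simp
    rw [e]; exact mul_mem (hl x) (hr y)
  | add x y hx hy => exact add_mem hx hy

end units

/-! ### Leading coefficients of twists -/

section leading
variable {k : Type u} [Field k] {A : Type w} [Ring A] [Bialgebra k A]

theorem coeff_mapₐ {B D : Type*} [Ring B] [Algebra k B] [Ring D] [Algebra k D] (φ : B →ₐ[k] D)
    (n : ℕ) (p : B⟦X⟧) : coeff n (mapₐ φ p) = φ (coeff n p) := by
  rw [mapₐ_apply, coeff_map]; rfl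

theorem mapₐ_X_pow_mul_C {B D : Type*} [Ring B] [Algebra k B] [Ring D] [Algebra k D]
    (φ : B →ₐ[k] D) (n : ℕ) (b : B) : mapₐ φ (X ^ n * C b) = X ^ n * C (φ b) := by
  rw [map_mul, map_pow, map_X_eq, mapₐ_C]

theorem cong_X_pow_mul {B : Type*} [Ring B] (n : ℕ) (p : B⟦X⟧) : Cong n (X ^ n * p) 0 := by
  rw [cong_zero_iff_dvd]; exact ⟨p, rfl⟩

theorem coeff_inv_of_cong {B : Type*} [Ring B] {n : ℕ} (hn : 1 ≤ n) {v : B⟦X⟧ˣ}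
    (hv : Cong n (v : B⟦X⟧) 1) : coeff n (↑v⁻¹ : B⟦X⟧) = -coeff n (v : B⟦X⟧) := by
  have h := Cong.coeff_mul_one hn hv hv.inv
  rw [Units.mul_inv, coeff_one, if_neg (by omega)] at h
  exact (neg_eq_of_add_eq_zero_right h.symm).symm

theorem Cong.conj {B : Type*} [Ring B] {n : ℕ} {p : B⟦X⟧} (v : B⟦X⟧ˣ) (hp : Cong n p 1) :
    Cong n ((v : B⟦X⟧) * p * (↑v⁻¹ : B⟦X⟧)) 1 := by
  simpa using ((Cong.refl (v : B⟦X⟧)).mul hp).mul (Cong.refl (↑v⁻¹ : B⟦X⟧))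

theorem coeff_conj {B : Type*} [Ring B] {n : ℕ} (hn : 1 ≤ n) {p : B⟦X⟧} {v : B⟦X⟧ˣ}
    (hv : Cong n (v : B⟦X⟧) 1) (hp : Cong n p 1) :
    coeff n ((v : B⟦X⟧) * p * (↑v⁻¹ : B⟦X⟧)) = coeff n p := by
  have h1 : Cong n ((v : B⟦X⟧) * p) 1 := by simpa using hv.mul hp
  rw [Cong.coeff_mul_one hn h1 hv.inv, Cong.coeff_mul_one hn hv hp, coeff_inv_of_cong hn hv]
  abel

theorem coeff_hexp {B : Type*} [Ring B] [Algebra k B] {n : ℕ} (hn : 1 ≤ n) (b : B) :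
    coeff n (hexp k (X ^ n * C b)) = b := by
  rw [hexp_cong_one_add hn (cong_X_pow_mul n (C b)) n (Nat.lt_succ_self n), map_add, coeff_one,
    if_neg (by omega), zero_add, coeff_X_pow_mul', if_pos le_rfl, Nat.sub_self, coeff_zero_C]

theorem commute_coeff {B : Type*} [Ring B] {Q : B⟦X⟧} {b : B} (h : Commute (C b) Q) (n : ℕ) :
    Commute b (coeff n Q) := by
  have := congrArg (coeff n) h.eq
  rwa [coeff_C_mul, coeff_mul_C] at this

theorem commute_X_pow_mul_C {B : Type*} [Ring B] {b : B} {Q : B⟦X⟧}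
    (h : ∀ i, Commute b (coeff i Q)) (n : ℕ) : Commute (X ^ n * C b) Q := by
  refine Commute.mul_left (commute_X_pow Q n).symm ?_
  ext i
  rw [coeff_C_mul, coeff_mul_C]
  exact h i

/-- The flip of the tensor factors, applied coefficientwise. -/
noncomputable abbrev flipH : (A ⊗[k] A)⟦X⟧ →ₐ[k⟦X⟧] (A ⊗[k] A)⟦X⟧ := mapₐ (flip k A)

theorem flipH_inl (p : A⟦X⟧) :
    flipH (inl (k := k) p : (A ⊗[k] A)⟦X⟧) = inr (k := k) p := by
  ext n
  simp [inl, inr, mapₐ_apply]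

theorem flipH_inr (p : A⟦X⟧) :
    flipH (inr (k := k) p : (A ⊗[k] A)⟦X⟧) = inl (k := k) p := by
  ext n
  simp [inl, inr, mapₐ_apply]

theorem flipH_sq (f : AlgAut k A) (p : (A ⊗[k] A)⟦X⟧) : flipH (sq f p) = sq f (flipH p) := by
  refine DFunLike.congr_fun (f := (flipH (k := k) (A := A)).comp (sq f))
    (g := (sq f).comp flipH) (tensor_hom_ext ?_ ?_) p <;>
  intro p <;> simp only [AlgHom.comp_apply, sq_inl, sq_inr, flipH_inl, flipH_inr]

theorem flipH_comul (hA : PrimGen k A) (p : A⟦X⟧) : flipH (comul k A p) = comul k A p := by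
  ext n
  rw [coeff_mapₐ, comul, coeff_mapₐ]
  exact comm_comul hA _

theorem coeff_comul (n : ℕ) (p : A⟦X⟧) :
    coeff n (comul k A p) = Bialgebra.comulAlgHom k A (coeff n p) := coeff_mapₐ _ _ _

theorem isAddCocycle_flip (hA : PrimGen k A) {F : A ⊗[k] A} (hF : IsAddCocycle k F) :
    IsAddCocycle k (flip k A F) := by
  have h12 : ∀ t, swap12 k A (swap12 k A t) = t := by
    intro t
    exact (TensorProduct.leftComm k A A A).symm_apply_apply t
  have h23 : ∀ t, swap23 k A (swap23 k A t) = t := by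
    intro t
    induction t using TensorProduct.induction_on with
    | zero => simp
    | tmul x y =>
      simp
    | add x y hx hy => simp only [map_add, hx, hy]
  have hff : ∀ t : A ⊗[k] A, flip k A (flip k A t) = t := fun t =>
    (TensorProduct.comm k A A).symm_apply_apply t
  have h := congrArg (fun t => swap12 k A (swap23 k A (swap12 k A t))) hF
  simp only [map_add] at h
  have e1 : comul23 k A F = swap12 k A (swap23 k A (comul12 k A (flip k A F))) := by
    rw [swap12_swap23_comul12, hff]
  rw [swap12_leg12, swap23_leg12, swap12_leg13, swap12_comul12 hA, swap12_swap23_comul12,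
    swap12_leg23, swap23_leg13, swap12_leg12, e1, h12, h23, swap12_comul12 hA] at h
  exact h.symm

/-- To leading order the product of series congruent to 1 is the sum, so the multiplicative cocycle
identity linearizes. -/
theorem TwAut.isAddCocycle_coeff (t : TwAut k A) {n : ℕ} (hn : 1 ≤ n)
    (h : Cong n (t.F : (A ⊗[k] A)⟦X⟧) 1) : IsAddCocycle k (coeff n (t.F : (A ⊗[k] A)⟦X⟧)) := by
  have hm : ∀ f : (A ⊗[k] A)⟦X⟧ →ₐ[k⟦X⟧] (A ⊗[k] (A ⊗[k] A))⟦X⟧,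
      Cong n (f t.F) 1 := fun f => by simpa using h.map f
  have e := congrArg (coeff n) t.cocycle
  rw [Cong.coeff_mul_one hn (hm _) (hm _), Cong.coeff_mul_one hn (hm _) (hm _)] at e
  simp only [tensorOne, oneTensor, comulL, comulR, coeff_mapₐ] at e
  exact e

theorem TwAut.epsL_coeff (t : TwAut k A) {n : ℕ} (hn : 1 ≤ n) :
    epsL k A (coeff n (t.F : (A ⊗[k] A)⟦X⟧)) = 0 := by
  have := congrArg (coeff n) t.norm_left
  rwa [counitL, coeff_mapₐ, coeff_one, if_neg (by omega)] at this

theorem TwAut.epsR_coeff (t : TwAut k A) {n : ℕ} (hn : 1 ≤ n) :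
    epsR k A (coeff n (t.F : (A ⊗[k] A)⟦X⟧)) = 0 := by
  have := congrArg (coeff n) t.norm_right
  rwa [counitR, coeff_mapₐ, coeff_one, if_neg (by omega)] at this

/-- Twists are congruent to `1` modulo `X`. -/
theorem TwAut.cong_one [CharZero k] (hA : PrimGen k A) (t : TwAut k A) :
    Cong 1 (t.F : (A ⊗[k] A)⟦X⟧) 1 := by
  have h : constantCoeff (t.F : (A ⊗[k] A)⟦X⟧) * constantCoeff (↑t.F⁻¹ : (A ⊗[k] A)⟦X⟧) = 1 := by
    rw [← map_mul, Units.mul_inv, map_one]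
  obtain ⟨c, hc⟩ := mem_filt_zero.1 (mem_filt_zero_of_mul_eq_one (primGen_tensor hA) h)
  have h2 := congrArg (coeff 0) t.norm_left
  -- The constant term is a scalar, being a unit of A ⊗ A; the normalization by the counit forces it
  -- to be 1.
  rw [counitL, coeff_mapₐ, coeff_zero_eq_constantCoeff_apply, ← hc, AlgHom.commutes,
    coeff_zero_one] at h2
  have h3 : c = 1 := by
    have := congrArg (Bialgebra.counitAlgHom k A) h2
    rw [AlgHom.commutes, map_one] at this
    exact this
  intro i hi
  obtain rfl : i = 0 := by omega
  rw [coeff_zero_eq_constantCoeff_apply, ← hc, h3, map_one, coeff_zero_one]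

/-- The skew part of the leading term of a twist is invariant. -/
theorem TwAut.commute_skew (hA : PrimGen k A) (t : TwAut k A) {n : ℕ} (hn : 1 ≤ n)
    (h : Cong n (t.F : (A ⊗[k] A)⟦X⟧) 1) (a : A) : Commute (Bialgebra.comulAlgHom k A a)
      (flip k A (coeff n (t.F : (A ⊗[k] A)⟦X⟧)) - coeff n (t.F : (A ⊗[k] A)⟦X⟧)) := by
  let F := t.F
  let G : ((A ⊗[k] A)⟦X⟧)ˣ := Units.map
    ((flipH : (A ⊗[k] A)⟦X⟧ →ₐ[k⟦X⟧] (A ⊗[k] A)⟦X⟧) : (A ⊗[k] A)⟦X⟧ →* (A ⊗[k] A)⟦X⟧) t.F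
  have hF : ∀ x, (F : (A ⊗[k] A)⟦X⟧) * comul k A (t.f x) = sq t.f (comul k A x) * F := t.conj
  have hG : ∀ x, (G : (A ⊗[k] A)⟦X⟧) * comul k A (t.f x) = sq t.f (comul k A x) * G := by
    intro x
    have := congrArg flipH (t.conj x)
    rw [map_mul, map_mul, flipH_sq, flipH_comul hA, flipH_comul hA] at this
    exact this
  -- `F` and its flip `G` both intertwine Δ ∘ f with (f ⊗ f) ∘ Δ, by cocommutativity. Hence F⁻¹G
  -- commutes with Δ(f(H)) = Δ(H), and its leading coefficient is the flip minus the original.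
  have hQ : ∀ y, Commute (comul k A y) (↑(F⁻¹ * G) : (A ⊗[k] A)⟦X⟧) := by
    intro y
    obtain ⟨x, rfl⟩ := t.f.surjective y
    have h1 : comul k A (t.f x) = ↑F⁻¹ * (sq t.f (comul k A x) * F) := by
      rw [← hF, Units.inv_mul_cancel_left]
    rw [Commute, SemiconjBy, Units.val_mul, mul_assoc, hG]
    conv_lhs => rw [h1]
    simp only [mul_assoc, Units.mul_inv_cancel_left]
  have hc := hQ (C a)
  rw [comul, mapₐ_C] at hc
  have hGn : Cong n (G : (A ⊗[k] A)⟦X⟧) 1 := by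
    have := h.map (flipH (k := k) (A := A))
    rwa [map_one] at this
  have hcoeff : coeff n (↑(F⁻¹ * G) : (A ⊗[k] A)⟦X⟧) =
      flip k A (coeff n (t.F : (A ⊗[k] A)⟦X⟧)) - coeff n (t.F : (A ⊗[k] A)⟦X⟧) := by
    rw [Units.val_mul, Cong.coeff_mul_one hn h.inv hGn, coeff_inv_of_cong hn h]
    change _ + coeff n (flipH _) = _
    rw [coeff_mapₐ]
    abel
  rw [← hcoeff]
  exact commute_coeff hc n

theorem leg12_eq (r : A ⊗[k] A) :
    leg12 k A r = Algebra.TensorProduct.assoc k k k A A A (r ⊗ₜ 1) := by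
  induction r using TensorProduct.induction_on with
  | zero => simp
  | tmul x y => simp
  | add x y hx hy => simp only [TensorProduct.add_tmul, map_add, hx, hy]

/-- The first two legs of (Δ ⊗ I)(G) lie in Δ(A), with which `r` commutes. This commutation lets the
exponentials in the cocycle identity be multiplied by adding exponents. -/
theorem commute_leg12 {r : A ⊗[k] A} (h : ∀ a, Commute (Bialgebra.comulAlgHom k A a) r)
    (G : A ⊗[k] A) : Commute (leg12 k A r) (comul12 k A G) := by
  rw [leg12_eq]
  induction G using TensorProduct.induction_on with
  | zero => rw [map_zero]; exact Commute.zero_right _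
  | tmul x y =>
    have : Commute (r ⊗ₜ[k] (1 : A)) (Bialgebra.comulAlgHom k A x ⊗ₜ[k] y) := by
      rw [Commute, SemiconjBy, Algebra.TensorProduct.tmul_mul_tmul,
        Algebra.TensorProduct.tmul_mul_tmul, one_mul, mul_one, (h x).eq]
    exact this.map (Algebra.TensorProduct.assoc k k k A A A)
  | add x y hx hy => rw [map_add]; exact hx.add_right hy

theorem commute_leg23 {r : A ⊗[k] A} (h : ∀ a, Commute (Bialgebra.comulAlgHom k A a) r)
    (G : A ⊗[k] A) : Commute (leg23 k A r) (comul23 k A G) := by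
  induction G using TensorProduct.induction_on with
  | zero => rw [map_zero]; exact Commute.zero_right _
  | tmul x y =>
    change (1 ⊗ₜ[k] r) * (x ⊗ₜ[k] Bialgebra.comulAlgHom k A y) =
      (x ⊗ₜ[k] Bialgebra.comulAlgHom k A y) * (1 ⊗ₜ[k] r)
    rw [Algebra.TensorProduct.tmul_mul_tmul, Algebra.TensorProduct.tmul_mul_tmul, one_mul,
      mul_one, (h y).eq]
  | add x y hx hy => rw [map_add]; exact hx.add_right hy

/-- The exponential of an invariant skew-symmetric cocycle is an invariant twist. -/
theorem exists_invariant_twist [CharZero k] (hA : PrimGen k A) {r : A ⊗[k] A}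
    (hr : IsAddCocycle k r) (hs : flip k A r = -r) (hl : epsL k A r = 0) (hr' : epsR k A r = 0)
    (h : ∀ a, Commute (Bialgebra.comulAlgHom k A a) r) {n : ℕ} (hn : 1 ≤ n) :
    ∃ s : TwAut k A, s.f = 1 ∧ (s.F : (A ⊗[k] A)⟦X⟧) = hexp k (X ^ n * C r) := by
  have hz : ∀ {B : Type w} [Ring B] (b : B), Cong 1 (X ^ n * C b) 0 := fun b =>
    (cong_X_pow_mul n (C b)).mono hn
  have hmap : ∀ {B : Type w} [Ring B] [Algebra k B] (φ : A ⊗[k] A →ₐ[k] B),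
      mapₐ φ (hexp k (X ^ n * C r)) = hexp k (X ^ n * C (φ r)) := fun φ => by
    rw [map_hexp _ (hz r), mapₐ_X_pow_mul_C]
  have hadd : ∀ {B : Type w} [Ring B] [Algebra k B] (a b : B), Commute a b →
      hexp k (X ^ n * C a) * hexp k (X ^ n * C b) = hexp k (X ^ n * C (a + b)) := by
    intro B _ _ a b hab
    have hc : Commute (X ^ n * C a : B⟦X⟧) (X ^ n * C b) := by
      refine commute_X_pow_mul_C (fun i => ?_) n
      rw [coeff_X_pow_mul']
      split_ifs
      · rw [coeff_C]
        split_ifs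
        · exact hab
        · exact Commute.zero_right a
      · exact Commute.zero_right a
    rw [← hexp_add (hz a) (hz b) hc, ← mul_add, ← map_add]
  obtain ⟨h12, h23⟩ := skew_cocycle hA hr hs
  refine ⟨⟨1, hexpUnit k (X ^ n * C r) (hz r), fun x => ?_, ?_, ?_, ?_⟩, rfl, rfl⟩
  · rw [sq_one]
    refine (commute_hexp (hz r) (commute_X_pow_mul_C (fun i => ?_) n)).eq
    rw [coeff_comul]
    exact (h _).symm
  · change mapₐ (leg12 k A) (hexp k (X ^ n * C r)) * mapₐ (comul12 k A) (hexp k (X ^ n * C r)) =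
      mapₐ (leg23 k A) (hexp k (X ^ n * C r)) * mapₐ (comul23 k A) (hexp k (X ^ n * C r))
    -- On each side the two exponents commute, so the multiplicative cocycle identity is the
    -- exponential of the additive one.
    have hr₂ : leg12 k A r + comul12 k A r = leg23 k A r + comul23 k A r := hr
    rw [hmap, hmap, hmap, hmap, hadd _ _ (commute_leg12 h r), hadd _ _ (commute_leg23 h r), hr₂]
  · change mapₐ (epsL k A) (hexp k (X ^ n * C r)) = 1
    rw [hmap, hl, map_zero, mul_zero, hexp_zero]
  · change mapₐ (epsR k A) (hexp k (X ^ n * C r)) = 1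
    rw [hmap, hr', map_zero, mul_zero, hexp_zero]

theorem TwAut.inner_F (w : unitsOne k A) :
    (TwAut.inner w).F = dbl (w : A⟦X⟧ˣ) * (comulUnit (w : A⟦X⟧ˣ))⁻¹ := rfl

theorem cong_dbl {n : ℕ} {v : A⟦X⟧ˣ} (h : Cong n (v : A⟦X⟧) 1) :
    Cong n (dbl (k := k) v : (A ⊗[k] A)⟦X⟧) 1 := by
  rw [dbl_val]
  simpa using (h.map (inl (k := k) (B := A))).mul (h.map (inr (k := k) (A := A)))

theorem cong_comulUnit {n : ℕ} {v : A⟦X⟧ˣ} (h : Cong n (v : A⟦X⟧) 1) :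
    Cong n (comulUnit (k := k) v : (A ⊗[k] A)⟦X⟧) 1 := by
  rw [comulUnit_val]
  simpa using h.map (comul k A)

theorem cong_inner {n : ℕ} {w : unitsOne k A} (h : Cong n ((w : A⟦X⟧ˣ) : A⟦X⟧) 1) :
    Cong n ((TwAut.inner w).F : (A ⊗[k] A)⟦X⟧) 1 := by
  rw [TwAut.inner_F, Units.val_mul]
  simpa using (cong_dbl h).mul (cong_comulUnit (k := k) h).inv

theorem coeff_inner {n : ℕ} (hn : 1 ≤ n) {w : unitsOne k A}
    (h : Cong n ((w : A⟦X⟧ˣ) : A⟦X⟧) 1) :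
    coeff n ((TwAut.inner w).F : (A ⊗[k] A)⟦X⟧) = cobound k (coeff n ((w : A⟦X⟧ˣ) : A⟦X⟧)) := by
  have hl : Cong n (inl (k := k) ((w : A⟦X⟧ˣ) : A⟦X⟧) : (A ⊗[k] A)⟦X⟧) 1 := by
    simpa using h.map (inl (k := k) (B := A))
  have hr : Cong n (inr (k := k) ((w : A⟦X⟧ˣ) : A⟦X⟧) : (A ⊗[k] A)⟦X⟧) 1 := by
    simpa using h.map (inr (k := k) (A := A))
  rw [TwAut.inner_F, Units.val_mul, Cong.coeff_mul_one hn (cong_dbl h) (cong_comulUnit h).inv,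
    coeff_inv_of_cong hn (cong_comulUnit h), dbl_val, Cong.coeff_mul_one hn hl hr, comulUnit_val,
    coeff_comul, inl, inr, coeff_mapₐ, coeff_mapₐ, cobound_apply, ← sub_eq_add_neg]
  rfl

theorem epsL_cobound (u : A) :
    epsL k A (cobound k u) = algebraMap k A (Bialgebra.counitAlgHom k A u) := by
  rw [cobound_apply, map_sub, map_add, epsL_comul]
  simp [Algebra.algebraMap_eq_smul_one]

theorem counit_eq_zero_of_cobound {u : A} (h : epsL k A (cobound k u) = 0) :
    Bialgebra.counitAlgHom k A u = 0 := by
  rw [epsL_cobound] at h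
  have := congrArg (Bialgebra.counitAlgHom k A) h
  rwa [AlgHom.commutes, map_zero] at this

variable (k) in
/-- The unit `exp(Xⁿ u)` for `u` of counit `0`. -/
theorem exists_unitsOne [CharZero k] {u : A} (hu : Bialgebra.counitAlgHom k A u = 0) {n : ℕ}
    (hn : 1 ≤ n) : ∃ w : unitsOne k A, Cong n ((w : A⟦X⟧ˣ) : A⟦X⟧) 1 ∧
      ((w : A⟦X⟧ˣ) : A⟦X⟧) = hexp k (X ^ n * C u) := by
  have hz := (cong_X_pow_mul n (C u)).mono hn
  refine ⟨⟨hexpUnit k (X ^ n * C u) hz, ?_⟩, hexp_cong_one hn (cong_X_pow_mul n (C u)), rfl⟩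
  rw [mem_unitsOne]
  change mapₐ (Bialgebra.counitAlgHom k A) (hexp k (X ^ n * C u)) = 1
  rw [map_hexp _ hz, mapₐ_X_pow_mul_C, hu, map_zero, mul_zero, hexp_zero]

end leading

/-! ### Successive approximation of automorphisms and group-like elements -/

section limits
variable {k : Type u} [Field k] {A : Type w} [Ring A] [Bialgebra k A]

theorem IsAddCocycle.add {F G : A ⊗[k] A} (hF : IsAddCocycle k F) (hG : IsAddCocycle k G) :
    IsAddCocycle k (F + G) := by
  rw [IsAddCocycle] at *
  rw [map_add, map_add, map_add, map_add, add_add_add_comm, hF, hG, add_add_add_comm]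

theorem IsAddCocycle.smul {F : A ⊗[k] A} (hF : IsAddCocycle k F) (c : k) :
    IsAddCocycle k (c • F) := by
  rw [IsAddCocycle] at *
  rw [map_smul, map_smul, map_smul, map_smul, ← smul_add, hF, smul_add]

theorem flip_flip (F : A ⊗[k] A) : flip k A (flip k A F) = F :=
  (TensorProduct.comm k A A).symm_apply_apply F

theorem epsL_flip (F : A ⊗[k] A) : epsL k A (flip k A F) = epsR k A F := by
  induction F using TensorProduct.induction_on with
  | zero => simp
  | tmul x y => simp
  | add x y hx hy => simp only [map_add, hx, hy]

theorem epsR_flip (F : A ⊗[k] A) : epsR k A (flip k A F) = epsL k A F := by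
  rw [← epsL_flip, flip_flip]

theorem bd_eq_inner (w : unitsOne k A) : (twCrossed k A).bd w = TwAut.inner w := rfl

theorem TwAut.mul_F_of_f_eq_one {s : TwAut k A} (hs : s.f = 1) (t : TwAut k A) :
    ((s * t).F : (A ⊗[k] A)⟦X⟧) = t.F * s.F := by
  rw [TwAut.mul_F, Units.val_mul]
  change sq s.f _ * _ = _
  rw [hs, sq_one]

theorem TwAut.inner_mul_F (w : unitsOne k A) (t : TwAut k A) :
    ((TwAut.inner w * t).F : (A ⊗[k] A)⟦X⟧) = (dbl (k := k) (w : A⟦X⟧ˣ) : (A ⊗[k] A)⟦X⟧) * t.F *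
      (↑(dbl (k := k) (w : A⟦X⟧ˣ))⁻¹ : (A ⊗[k] A)⟦X⟧) * (TwAut.inner w).F := by
  rw [TwAut.mul_F, Units.val_mul]
  change sq (conjAut k (w : A⟦X⟧ˣ)) _ * _ = _
  rw [sq_conjAut, conjAut_apply]

theorem TwAut.inner_mul_cong {n : ℕ} {w : unitsOne k A} {t : TwAut k A}
    (hw : Cong n ((w : A⟦X⟧ˣ) : A⟦X⟧) 1) (ht : Cong n (t.F : (A ⊗[k] A)⟦X⟧) 1) :
    Cong n ((TwAut.inner w * t).F : (A ⊗[k] A)⟦X⟧) 1 := by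
  rw [TwAut.inner_mul_F]
  simpa only [mul_one] using (ht.conj _).mul (cong_inner hw)

theorem TwAut.coeff_inner_mul {n : ℕ} (hn : 1 ≤ n) {w : unitsOne k A} {t : TwAut k A}
    (hw : Cong n ((w : A⟦X⟧ˣ) : A⟦X⟧) 1) (ht : Cong n (t.F : (A ⊗[k] A)⟦X⟧) 1) :
    coeff n ((TwAut.inner w * t).F : (A ⊗[k] A)⟦X⟧) =
      coeff n (t.F : (A ⊗[k] A)⟦X⟧) + cobound k (coeff n ((w : A⟦X⟧ˣ) : A⟦X⟧)) := by
  rw [TwAut.inner_mul_F, Cong.coeff_mul_one hn (ht.conj _) (cong_inner hw),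
    coeff_conj hn (cong_dbl hw) ht, coeff_inner hn hw]

/-- The order of a twist can be raised by an inner twisted automorphism and an invariant twist. -/
theorem TwAut.exists_raise [CharZero k] (hA : PrimGen k A) (t : TwAut k A) {n : ℕ} (hn : 1 ≤ n)
    (h : Cong n (t.F : (A ⊗[k] A)⟦X⟧) 1) :
    ∃ w : unitsOne k A, Cong n ((w : A⟦X⟧ˣ) : A⟦X⟧) 1 ∧ ∃ s : TwAut k A, s.f = 1 ∧
      Cong (n + 1) ((s * (TwAut.inner w * t)).F : (A ⊗[k] A)⟦X⟧) 1 := by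
  set F := coeff n (t.F : (A ⊗[k] A)⟦X⟧) with hFdef
  have hF : IsAddCocycle k F := t.isAddCocycle_coeff hn h
  have hF' := isAddCocycle_flip hA hF
  have hl : epsL k A F = 0 := t.epsL_coeff hn
  have hr : epsR k A F = 0 := t.epsR_coeff hn
  -- With `S` the symmetric part and `r` minus the skew part, the coefficient is S - r. The inner
  -- correction exp(-Xⁿu) subtracts S, and the invariant twist exp(Xⁿr) adds r.
  let S : A ⊗[k] A := (2⁻¹ : k) • (F + flip k A F)
  let r : A ⊗[k] A := (2⁻¹ : k) • (flip k A F + (-1 : k) • F)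
  have hSl : epsL k A S = 0 := by
    rw [map_smul, map_add, epsL_flip, hl, hr, add_zero, smul_zero]
  have hSr : epsR k A S = 0 := by
    rw [map_smul, map_add, epsR_flip, hl, hr, add_zero, smul_zero]
  have hS : flip k A S = S := by
    rw [map_smul, map_add, flip_flip, add_comm]
  obtain ⟨m, hm⟩ := exists_mem_augFilt hA hSl hSr
  obtain ⟨u, hu, -⟩ := exists_cobound_of_mem hA hm ((hF.add hF').smul _) hS
  have hu0 : Bialgebra.counitAlgHom k A (-u) = 0 := by
    rw [map_neg, counit_eq_zero_of_cobound (by rw [← hu, hSl]), neg_zero]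
  obtain ⟨w, hw, hw'⟩ := exists_unitsOne k hu0 hn
  obtain ⟨s, hs, hs'⟩ := exists_invariant_twist hA (r := r) ((hF'.add (hF.smul _)).smul _)
    (by rw [map_smul, map_add, map_smul, flip_flip]; module)
    (by rw [map_smul, map_add, map_smul, epsL_flip, hl, hr, smul_zero, add_zero, smul_zero])
    (by rw [map_smul, map_add, map_smul, epsR_flip, hl, hr, smul_zero, add_zero, smul_zero])
    (fun a => by
      have := (t.commute_skew hA hn h a).smul_right (2⁻¹ : k)
      rwa [sub_eq_add_neg, ← neg_one_smul k] at this) hn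
  refine ⟨w, hw, s, hs, ?_⟩
  have h1 := TwAut.inner_mul_cong hw h
  have h2 : Cong n (s.F : (A ⊗[k] A)⟦X⟧) 1 := by
    rw [hs']; exact hexp_cong_one hn (cong_X_pow_mul n _)
  rw [TwAut.mul_F_of_f_eq_one hs]
  refine Cong.one_succ (by simpa using h1.mul h2) hn ?_
  rw [Cong.coeff_mul_one hn h1 h2, TwAut.coeff_inner_mul hn hw h, hs', coeff_hexp hn, hw',
    coeff_hexp hn, map_neg, ← hu, ← hFdef]
  simp only [S, r]
  module

/-- Dependent choice for successive approximations: `Q` records the order reached and `R` the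
congruence of consecutive terms. -/
theorem exists_seq {α : Type*} {Q : ℕ → α → Prop} {R : ℕ → α → α → Prop} (h0 : ∃ a, Q 0 a)
    (hs : ∀ n a, Q n a → ∃ b, R n b a ∧ Q (n + 1) b) :
    ∃ s : ℕ → α, ∀ n, Q n (s n) ∧ R n (s (n + 1)) (s n) := by
  obtain ⟨a, ha⟩ := h0
  choose f hf hf' using hs
  let s : (n : ℕ) → {a // Q n a} := fun n =>
    Nat.rec ⟨a, ha⟩ (fun n x => ⟨f n x.1 x.2, hf' n x.1 x.2⟩) n
  exact ⟨fun n => (s n).1, fun n => ⟨(s n).2, hf n (s n).1 (s n).2⟩⟩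

theorem exists_limit_unitsOne (s : ℕ → unitsOne k A)
    (h : ∀ n, Cong (n + 1) ((s (n + 1) : A⟦X⟧ˣ) : A⟦X⟧) ((s n : A⟦X⟧ˣ) : A⟦X⟧)) :
    ∃ l : unitsOne k A, ∀ n, Cong n ((l : A⟦X⟧ˣ) : A⟦X⟧) ((s n : A⟦X⟧ˣ) : A⟦X⟧) := by
  obtain ⟨l, hl⟩ := exists_limit (fun n => ((s n : A⟦X⟧ˣ) : A⟦X⟧))
    fun n => (h n).mono (Nat.le_succ n)
  have hu : IsUnit l := by
    rw [isUnit_iff_constantCoeff, ← coeff_zero_eq_constantCoeff_apply, hl 1 0 (by omega),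
      coeff_zero_eq_constantCoeff_apply]
    exact (s 1 : A⟦X⟧ˣ).isUnit.map _
  obtain ⟨l, rfl⟩ := hu
  refine ⟨⟨l, ?_⟩, hl⟩
  rw [mem_unitsOne]
  refine eq_of_cong fun n => ((hl n).map (mapₐ (Bialgebra.counitAlgHom k A))).trans ?_
  exact Cong.of_eq (mem_unitsOne.1 (s n).2)

theorem Cong.inv_inv {n : ℕ} {B : Type*} [Ring B] {u v : B⟦X⟧ˣ} (h : Cong n (u : B⟦X⟧) v) :
    Cong n (↑u⁻¹ : B⟦X⟧) (↑v⁻¹ : B⟦X⟧) := by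
  have := ((Cong.refl (↑u⁻¹ : B⟦X⟧)).mul h.symm).mul (Cong.refl (↑v⁻¹ : B⟦X⟧))
  simpa using this

theorem cong_conjAut {n : ℕ} {B : Type w} [Ring B] [Algebra k B] {u v : B⟦X⟧ˣ}
    (h : Cong n (u : B⟦X⟧) v) (x : B⟦X⟧) : Cong n (conjAut k u x) (conjAut k v x) := by
  rw [conjAut_apply, conjAut_apply]
  exact (h.mul (Cong.refl x)).mul h.inv_inv

theorem cong_dbl_dbl {n : ℕ} {u v : A⟦X⟧ˣ} (h : Cong n (u : A⟦X⟧) v) :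
    Cong n (dbl (k := k) u : (A ⊗[k] A)⟦X⟧) (dbl (k := k) v : (A ⊗[k] A)⟦X⟧) := by
  rw [dbl_val, dbl_val]
  exact (h.map _).mul (h.map _)

theorem cong_inner_inner {n : ℕ} {u v : unitsOne k A}
    (h : Cong n ((u : A⟦X⟧ˣ) : A⟦X⟧) ((v : A⟦X⟧ˣ) : A⟦X⟧)) :
    Cong n ((TwAut.inner u).F : (A ⊗[k] A)⟦X⟧) ((TwAut.inner v).F : (A ⊗[k] A)⟦X⟧) := by
  rw [TwAut.inner_F, TwAut.inner_F, Units.val_mul, Units.val_mul]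
  refine (cong_dbl_dbl h).mul (Cong.inv_inv ?_)
  rw [comulUnit_val, comulUnit_val]
  exact h.map _

theorem TwAut.inner_mul_f (w : unitsOne k A) (t : TwAut k A) :
    (TwAut.inner w * t).f = conjAut k (w : A⟦X⟧ˣ) * t.f := rfl

/-- Up to an inner automorphism, the first component of a twisted automorphism is a bialgebra
automorphism. -/
theorem TwAut.exists_conj_mem_bialgAut [CharZero k] (hA : PrimGen k A) (t : TwAut k A) :
    ∃ P : unitsOne k A, conjAut k (P : A⟦X⟧ˣ) * t.f ∈ bialgAut k A := by
  -- Only the units `P` need to converge. The invariant twist `s` is re-chosen at each stage, since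
  -- it does not affect the first component.
  obtain ⟨P, hP⟩ := exists_seq
    (Q := fun n (P : unitsOne k A) => ∃ s : TwAut k A, s.f = 1 ∧
      Cong (n + 1) ((s * (TwAut.inner P * t)).F : (A ⊗[k] A)⟦X⟧) 1)
    (R := fun n P' P => Cong (n + 1) ((P' : A⟦X⟧ˣ) : A⟦X⟧) ((P : A⟦X⟧ˣ) : A⟦X⟧))
    ⟨1, 1, rfl, TwAut.cong_one hA _⟩ (by
      rintro n P ⟨s, hs, hc⟩
      obtain ⟨w, hw, s', hs', hc'⟩ := TwAut.exists_raise hA _ (Nat.le_add_left 1 n) hc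
      -- The old invariant twist is moved across the inner automorphism of `w`; conjugation keeps
      -- its first component trivial and makes the product telescope.
      refine ⟨w * P, ?_, s' * (TwAut.inner w * s * (TwAut.inner w)⁻¹), ?_, ?_⟩
      · simpa using hw.mul (Cong.refl ((P : A⟦X⟧ˣ) : A⟦X⟧))
      · rw [TwAut.mul_f, TwAut.mul_f, TwAut.mul_f, hs, hs', TwAut.inv_f, mul_one, one_mul,
          mul_inv_cancel]
      · have e : TwAut.inner (w * P) = TwAut.inner w * TwAut.inner P := map_mul (twCrossed k A).bd w P
        have e2 : s' * (TwAut.inner w * s * (TwAut.inner w)⁻¹) * (TwAut.inner (w * P) * t) =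
            s' * (TwAut.inner w * (s * (TwAut.inner P * t))) := by
          rw [e]; group
        rw [e2]
        exact hc')
  obtain ⟨l, hl⟩ := exists_limit_unitsOne P fun n => (hP n).2
  refine ⟨l, fun x => eq_of_cong fun n => ?_, (TwAut.inner l * t).counit_f⟩
  obtain ⟨⟨s, hs, hc⟩, -⟩ := hP n
  have hc := hc.mono (Nat.le_succ n)
  have hconj := (s * (TwAut.inner (P n) * t)).conj x
  rw [TwAut.mul_f, hs, one_mul, TwAut.inner_mul_f] at hconj
  -- With a twist congruent to 1, the intertwining relation says that the first component respects Δ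
  -- modulo `Xⁿ`.
  have h1 : Cong n (comul k A ((conjAut k (P n : A⟦X⟧ˣ) * t.f) x))
      (sq (conjAut k (P n : A⟦X⟧ˣ) * t.f) (comul k A x)) := by
    have e1 := hc.mul (Cong.refl (comul k A ((conjAut k (P n : A⟦X⟧ˣ) * t.f) x)))
    have e2 := (Cong.refl (sq (conjAut k (P n : A⟦X⟧ˣ) * t.f) (comul k A x))).mul hc
    rw [one_mul] at e1
    rw [mul_one] at e2
    exact e1.symm.trans ((Cong.of_eq hconj).trans e2)
  have h2 := (cong_conjAut (k := k) (hl n) (t.f x)).map (comul k A)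
  refine Cong.trans h2 (h1.trans ?_)
  rw [sq_mul, sq_mul, sq_conjAut, sq_conjAut]
  exact (cong_conjAut (cong_dbl_dbl (hl n)) _).symm

theorem flipH_dbl (v : A⟦X⟧ˣ) : flipH (dbl (k := k) v : (A ⊗[k] A)⟦X⟧) = dbl (k := k) v := by
  rw [dbl_val, map_mul, flipH_inl, flipH_inr, (commute_inl_inr (k := k) (v : A⟦X⟧) _).eq]

/-- u ⊗ u is symmetric, and so is Δ(u) by cocommutativity. Inner twists therefore have symmetric
leading coefficients, without a skew part. -/
theorem flipH_inner (hA : PrimGen k A) (w : unitsOne k A) :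
    flipH ((TwAut.inner w).F : (A ⊗[k] A)⟦X⟧) = (TwAut.inner w).F := by
  have h : (TwAut.inner w).F * comulUnit (k := k) (w : A⟦X⟧ˣ) = dbl (w : A⟦X⟧ˣ) := by
    rw [TwAut.inner_F, inv_mul_cancel_right]
  have h1 := congrArg Units.val h
  have h2 := congrArg (flipH (k := k) (A := A)) h1
  rw [Units.val_mul, map_mul, flipH_dbl, comulUnit_val, flipH_comul hA, ← h1, Units.val_mul,
    comulUnit_val, ← comulUnit_val] at h2
  exact (Units.mul_left_inj _).1 h2

theorem conjAut_mul_of_central {z u : A⟦X⟧ˣ} (hz : ∀ x : A⟦X⟧, Commute (z : A⟦X⟧) x) :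
    conjAut k (z * u) = conjAut k u := by
  rw [conjAut_mul]
  ext1 x
  rw [AlgEquiv.mul_apply, conjAut_apply, (hz _).eq, mul_assoc, Units.mul_inv, mul_one]

/-- An inner bialgebra automorphism is conjugation by a group-like element. -/
theorem exists_central_mul_mem_groupLike [CharZero k] (hA : PrimGen k A) (u : unitsOne k A)
    (hu : conjAut k (u : A⟦X⟧ˣ) ∈ bialgAut k A) :
    ∃ z : unitsOne k A, (∀ x : A⟦X⟧, Commute ((z : A⟦X⟧ˣ) : A⟦X⟧) x) ∧
      ((z * u : unitsOne k A) : A⟦X⟧ˣ) ∈ groupLike k A := by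
  obtain ⟨z, hz⟩ := exists_seq
    (Q := fun n (z : unitsOne k A) => (∀ x : A⟦X⟧, Commute ((z : A⟦X⟧ˣ) : A⟦X⟧) x) ∧
      Cong (n + 1) ((TwAut.inner (z * u)).F : (A ⊗[k] A)⟦X⟧) 1)
    (R := fun n P' P => Cong (n + 1) ((P' : A⟦X⟧ˣ) : A⟦X⟧) ((P : A⟦X⟧ˣ) : A⟦X⟧))
    ⟨1, fun x => Commute.one_left x, TwAut.cong_one hA _⟩ (by
      rintro n z ⟨hz, hc⟩
      have hn : 1 ≤ n + 1 := Nat.le_add_left 1 n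
      set t := TwAut.inner (z * u) with ht
      have htf : t.f = conjAut k (u : A⟦X⟧ˣ) := conjAut_mul_of_central hz
      -- As conj(u) respects Δ, the intertwining relation becomes commutation with Δ(H). The leading
      -- coefficient is thus an invariant symmetric cocycle, and the correcting `v` can be taken
      -- central.
      have hcomm : ∀ y, Commute (comul k A y) (t.F : (A ⊗[k] A)⟦X⟧) := by
        intro y
        obtain ⟨x, rfl⟩ := t.f.surjective y
        have := t.conj x
        rw [htf, ← hu.1 x, ← htf] at this
        exact this.symm
      set F := coeff (n + 1) (t.F : (A ⊗[k] A)⟦X⟧) with hFdef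
      have hF : IsAddCocycle k F := t.isAddCocycle_coeff hn hc
      have hs : flip k A F = F := by
        rw [hFdef, ← coeff_mapₐ, ht, flipH_inner hA]
      obtain ⟨m, hm⟩ := exists_mem_augFilt hA (t.epsL_coeff hn) (t.epsR_coeff hn)
      obtain ⟨v, hv, hv'⟩ := exists_cobound_of_mem hA hm hF hs
      have hvc : ∀ a : A, Commute a v := commute_of_prims hA (hv' fun p _ => by
        have := hcomm (C p)
        rw [comul, mapₐ_C] at this
        exact commute_coeff this _)
      have hv0 : Bialgebra.counitAlgHom k A (-v) = 0 := by
        rw [map_neg, counit_eq_zero_of_cobound (by rw [← hv]; exact t.epsL_coeff hn), neg_zero]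
      obtain ⟨w, hw, hw'⟩ := exists_unitsOne k hv0 hn
      have hwc : ∀ x : A⟦X⟧, Commute ((w : A⟦X⟧ˣ) : A⟦X⟧) x := by
        intro x
        rw [hw']
        exact commute_hexp ((cong_X_pow_mul _ _).mono hn)
          (commute_X_pow_mul_C (fun i => (hvc _).symm.neg_left) _)
      refine ⟨w * z, ?_, fun x => (hwc x).mul_left (hz x), ?_⟩
      · simpa using hw.mul (Cong.refl ((z : A⟦X⟧ˣ) : A⟦X⟧))
      · have e : TwAut.inner (w * z * u) = TwAut.inner w * t := by
          rw [mul_assoc]; exact map_mul (twCrossed k A).bd w (z * u)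
        rw [e]
        refine Cong.one_succ (TwAut.inner_mul_cong hw hc) hn ?_
        rw [TwAut.coeff_inner_mul hn hw hc, hw', coeff_hexp hn, map_neg, ← hv, ← hFdef,
          add_neg_cancel])
  obtain ⟨l, hl⟩ := exists_limit_unitsOne z fun n => (hz n).2
  refine ⟨l, fun x => eq_of_cong fun n => ?_, ?_⟩
  · refine ((hl n).mul (Cong.refl x)).trans (Cong.trans ?_ ((Cong.refl x).mul (hl n)).symm)
    exact Cong.of_eq ((hz n).1.1 x).eq
  · have h1 : (TwAut.inner (l * u)).F = 1 := by
      refine Units.ext (eq_of_cong fun n => ?_)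
      refine Cong.trans (cong_inner_inner (v := z n * u) ?_) ((hz n).1.2.mono (Nat.le_succ n))
      exact (hl n).mul (Cong.refl _)
    rw [TwAut.inner_F, mul_inv_eq_one] at h1
    exact mem_groupLike.2 h1.symm

end limits

/-! ### Retraction of central units onto central group-like elements -/

section retraction
variable {k : Type u} [Field k] {A : Type w} [Ring A] [Bialgebra k A]

/-- Coefficientwise application of a linear map. -/
noncomputable def coeffMap {B D : Type*} [Ring B] [Algebra k B] [Ring D] [Algebra k D] (φ : B →ₗ[k] D)
    (p : B⟦X⟧) : D⟦X⟧ := PowerSeries.mk fun n => φ (coeff n p)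

theorem coeff_coeffMap {B D : Type*} [Ring B] [Algebra k B] [Ring D] [Algebra k D]
    (φ : B →ₗ[k] D) (n : ℕ) (p : B⟦X⟧) : coeff n (coeffMap φ p) = φ (coeff n p) := coeff_mk _ _

theorem coeffMap_add {B D : Type*} [Ring B] [Algebra k B] [Ring D] [Algebra k D]
    (φ : B →ₗ[k] D) (p q : B⟦X⟧) : coeffMap φ (p + q) = coeffMap φ p + coeffMap φ q := by
  ext n
  simp only [coeff_coeffMap, map_add]

theorem cong_coeffMap {B D : Type*} [Ring B] [Algebra k B] [Ring D] [Algebra k D]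
    (φ : B →ₗ[k] D) {n : ℕ} {p : B⟦X⟧} (h : Cong n p 0) : Cong n (coeffMap φ p) 0 := by
  intro i hi
  rw [coeff_coeffMap, h i hi, map_zero, map_zero, map_zero]

theorem coeff_algHom {B D : Type*} [Ring B] [Algebra k B] [Ring D] [Algebra k D]
    (f : B⟦X⟧ →ₐ[k⟦X⟧] D⟦X⟧) (n : ℕ) (p : B⟦X⟧) : coeff n (f p) =
      ∑ x ∈ Finset.HasAntidiagonal.antidiagonal n, coeff x.1 (f (C (coeff x.2 p))) := by
  have : f = extend (restrictC f) := algHom_ext fun b => by rw [extend_C, restrictC_apply]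
  have e : f p = extendFun (restrictC f) p := DFunLike.congr_fun this p
  rw [e, extendFun, coeff_mk]
  rfl

theorem commute_of_coeff {B : Type*} [Ring B] {z : B⟦X⟧}
    (h : ∀ (n : ℕ) (b : B), Commute (coeff n z) b) (x : B⟦X⟧) : Commute z x := by
  ext n
  rw [coeff_mul, coeff_mul, ← Finset.Nat.sum_antidiagonal_swap]
  exact Finset.sum_congr rfl fun _ _ => h _ _

theorem coeffMap_mul'_inl_mul_inr (p q : A⟦X⟧) :
    coeffMap (LinearMap.mul' k A) (inl (k := k) p * inr (k := k) q) = p * q := by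
  ext n
  rw [coeff_coeffMap, coeff_mul, coeff_mul, map_sum]
  refine Finset.sum_congr rfl fun x _ => ?_
  rw [inl, inr, coeff_mapₐ, coeff_mapₐ]
  simp

/-- ψ is built from product and coproduct only, so a bialgebra automorphism commutes with its
coefficientwise extension. -/
theorem coeff_adams {g : AlgAut k A} (hg : g ∈ bialgAut k A) (n : ℕ) (a : A) :
    coeff n (g (C (adams k A a))) = adams k A (coeff n (g (C a))) := by
  have h : ∀ T : A ⊗[k] A, g (C (LinearMap.mul' k A T)) =
      coeffMap (LinearMap.mul' k A) (sq g (C T)) := by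
    intro T
    induction T using TensorProduct.induction_on with
    | zero => ext n; simp [coeff_coeffMap]
    | tmul x y =>
      have e : (C (x ⊗ₜ[k] y) : (A ⊗[k] A)⟦X⟧) = inl (k := k) (C x) * inr (k := k) (C y) := by
        simp [inl, inr, mapₐ_C, ← map_mul]
      rw [e, map_mul, sq_inl, sq_inr, coeffMap_mul'_inl_mul_inr]
      simp
    | add x y hx hy => simp only [map_add, coeffMap_add, hx, hy]
  have e := hg.1 (C a)
  rw [comul, mapₐ_C] at e
  change coeff n (g (C (LinearMap.mul' k A (Bialgebra.comulAlgHom k A a)))) = _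
  rw [h, ← e, coeff_coeffMap, coeff_mapₐ]
  rfl

variable (k) in
open Classical in
/-- The logarithm of a power series with constant term `1`. -/
noncomputable def hlog {B : Type*} [Ring B] [Algebra k B] (p : B⟦X⟧) : B⟦X⟧ :=
  if h : Cong 1 p 1 then (exists_hexp_eq (k := k) h).choose else 0

theorem hlog_cong {B : Type*} [Ring B] [Algebra k B] (p : B⟦X⟧) : Cong 1 (hlog k p) 0 := by
  rw [hlog]
  split_ifs with h
  · exact (exists_hexp_eq (k := k) h).choose_spec.1
  · exact Cong.refl 0

theorem hexp_hlog {B : Type*} [Ring B] [Algebra k B] {p : B⟦X⟧} (h : Cong 1 p 1) :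
    hexp k (hlog k p) = p := by
  rw [hlog, dif_pos h]
  exact (exists_hexp_eq (k := k) h).choose_spec.2

theorem hlog_hexp {B : Type*} [Ring B] [Algebra k B] {z : B⟦X⟧} (h : Cong 1 z 0) :
    hlog k (hexp k z) = z :=
  hexp_injective (k := k) (hlog_cong _) h (hexp_hlog (hexp_cong_one le_rfl h))

/-- The logarithm is a chosen preimage under the exponential; its naturality follows from naturality
and injectivity of the exponential. -/
theorem hlog_map {B D : Type*} [Ring B] [Algebra k B] [Ring D] [Algebra k D]
    (f : B⟦X⟧ →ₐ[k⟦X⟧] D⟦X⟧) {p : B⟦X⟧} (h : Cong 1 p 1) : hlog k (f p) = f (hlog k p) := by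
  conv_lhs => rw [← hexp_hlog (k := k) h]
  rw [map_hexp f (hlog_cong p), hlog_hexp]
  simpa using (hlog_cong p).map f

theorem hlog_central {B : Type w} [Ring B] [Algebra k B] {p : B⟦X⟧} (h : Cong 1 p 1)
    (hp : ∀ x, Commute p x) (x : B⟦X⟧) : Commute (hlog k p) x := by
  refine commute_of_coeff (fun n b => ?_) x
  -- Conjugation by the unit 1 + Xb fixes the central `p`, hence by naturality its logarithm.
  -- Commuting with 1 + Xb means commuting with `b`, after cancelling the central nonzerodivisor
  -- `X`.
  obtain ⟨v, hv⟩ := isUnit_of_cong_one (p := 1 + X * C b) (by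
    simpa using (Cong.refl 1).add (cong_X_pow_mul 1 (C b)))
  have h1 : conjAut k v p = p := by
    rw [conjAut_apply, ← (hp v).eq, Units.mul_inv_cancel_right]
  have h2 : conjAut k v (hlog k p) = hlog k p :=
    (hlog_map (conjAut k v : B⟦X⟧ →ₐ[k⟦X⟧] B⟦X⟧) h).symm.trans (congrArg (hlog k) h1)
  rw [conjAut_apply, Units.mul_inv_eq_iff_eq_mul, hv, add_mul, mul_add, one_mul, mul_one,
    add_right_inj, mul_assoc, ← mul_assoc _ X, (commute_X (hlog k p)).eq, mul_assoc] at h2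
  have h3 := congrArg (coeff (n + 1)) h2
  rw [coeff_succ_X_mul, coeff_succ_X_mul, coeff_C_mul, coeff_mul_C] at h3
  exact h3.symm

variable (k A) in
/-- The central units of counit `1`. -/
noncomputable def centralUnits : Subgroup (unitsOne k A) where
  carrier := {u | ∀ x, Commute ((u : A⟦X⟧ˣ) : A⟦X⟧) x}
  one_mem' x := Commute.one_left x
  mul_mem' hu hv x := (hu x).mul_left (hv x)
  inv_mem' hu x := (hu x).units_inv_left

/-- The projection onto the primitive elements. -/
noncomputable def primProj [CharZero k] (hA : PrimGen k A) : A →ₗ[k] A :=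
  Submodule.projection _ _ (isCompl_adamsSub hA)

variable [CharZero k] (hA : PrimGen k A)

theorem primProj_mem (x : A) : primProj hA x ∈ prims k A :=
  ker_adamsSub_le hA (Submodule.projection_apply_mem _ x)

theorem primProj_prim {p : A} (hp : p ∈ prims k A) : primProj hA p = p :=
  Submodule.projection_apply_left (isCompl_adamsSub hA) ⟨p, prims_le_ker hp⟩

/-- A linear map commuting with ψ preserves both the kernel and the range of ψ - 2, hence the
projection they define. -/
theorem primProj_comm {φ : A →ₗ[k] A} (h : ∀ x, φ (adams k A x) = adams k A (φ x)) (x : A) :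
    φ (primProj hA x) = primProj hA (φ x) := by
  have h' : ∀ x, φ (adamsSub k A x) = adamsSub k A (φ x) := fun x => by
    rw [adamsSub_apply, adamsSub_apply, map_sub, map_smul, h]
  obtain ⟨y, hy⟩ : x - primProj hA x ∈ LinearMap.range (adamsSub k A) :=
    Submodule.sub_projection_mem (isCompl_adamsSub hA) x
  have h1 : primProj hA (φ (adamsSub k A y)) = 0 := by
    rw [h' y]
    exact Submodule.projection_apply_right (isCompl_adamsSub hA) ⟨_, φ y, rfl⟩
  have h2 : φ (primProj hA x) ∈ prims k A := by
    refine ker_adamsSub_le hA ?_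
    rw [LinearMap.mem_ker, ← h', LinearMap.mem_ker.1 (prims_le_ker (primProj_mem hA x)), map_zero]
  rw [hy, map_sub, map_sub, sub_eq_zero] at h1
  rw [h1, primProj_prim hA h2]

/-- For primitive `p` the operator ad(p) commutes with ψ, hence with the projection; it kills `z`,
so it kills the projection of `z`. -/
theorem primProj_central {z : A} (hz : ∀ x, Commute z x) (x : A) : Commute (primProj hA z) x := by
  refine (commute_of_prims hA (fun p hp => ?_) x).symm
  have h := primProj_comm hA (φ := LinearMap.mulLeft k p - LinearMap.mulRight k p) (fun x => by
    simp only [adams, LinearMap.sub_apply, LinearMap.mulLeft_apply, LinearMap.mulRight_apply,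
      LinearMap.comp_apply, AlgHom.toLinearMap_apply]
    rw [map_sub, map_mul, map_mul, mul'_commutator hp]) z
  simp only [LinearMap.sub_apply, LinearMap.mulLeft_apply, LinearMap.mulRight_apply,
    (hz p).eq, sub_self, map_zero] at h
  exact sub_eq_zero.1 h

theorem coeffMap_primProj_comm {g : AlgAut k A} (hg : g ∈ bialgAut k A) (p : A⟦X⟧) :
    coeffMap (primProj hA) (g p) = g (coeffMap (primProj hA) p) := by
  -- The coefficients of `g` restricted to constants. They determine `g` by `coeff_algHom`, and each
  -- of them commutes with ψ.
  let φ : ℕ → A →ₗ[k] A := fun n =>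
    { toFun a := coeff n (restrictC (g : A⟦X⟧ →ₐ[k⟦X⟧] A⟦X⟧) a)
      map_add' x y := by simp only [map_add]
      map_smul' c x := by simp only [map_smul, RingHom.id_apply]; rfl }
  have hφ : ∀ n a, φ n a = coeff n (g (C a)) := fun n a => rfl
  ext n
  rw [coeff_coeffMap]
  have h1 := coeff_algHom (g : A⟦X⟧ →ₐ[k⟦X⟧] A⟦X⟧) n p
  have h2 := coeff_algHom (g : A⟦X⟧ →ₐ[k⟦X⟧] A⟦X⟧) n (coeffMap (primProj hA) p)
  refine (congrArg (primProj hA) h1).trans (Eq.trans ?_ h2.symm)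
  rw [map_sum]
  refine Finset.sum_congr rfl fun x _ => ?_
  rw [coeff_coeffMap]
  exact (primProj_comm hA (φ := φ x.1) (fun a => coeff_adams hg _ _) _).symm

include hA in
theorem cong_one_of_mem (u : unitsOne k A) : Cong 1 ((u : A⟦X⟧ˣ) : A⟦X⟧) 1 := by
  have h : constantCoeff ((u : A⟦X⟧ˣ) : A⟦X⟧) * constantCoeff (↑(u : A⟦X⟧ˣ)⁻¹ : A⟦X⟧) = 1 := by
    rw [← map_mul, Units.mul_inv, map_one]
  obtain ⟨c, hc⟩ := mem_filt_zero.1 (mem_filt_zero_of_mul_eq_one (k := k) hA h)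
  have h2 := congrArg (coeff 0) (mem_unitsOne.1 u.2)
  rw [counit, coeff_map, coeff_zero_eq_constantCoeff_apply, ← hc, coeff_zero_one] at h2
  have h3 : c = 1 := by
    refine Eq.trans ?_ h2
    exact ((Bialgebra.counitAlgHom k A).commutes c).symm
  intro i hi
  obtain rfl : i = 0 := by omega
  rw [coeff_zero_eq_constantCoeff_apply, ← hc, h3, map_one, coeff_zero_one]

/-- Since l ⊗ 1 and 1 ⊗ l commute, exp(l) ⊗ exp(l) is the exponential of their sum, and injectivity
of the exponential compares it with Δ(exp l) = exp(Δ l). -/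
theorem comul_hexp {l : A⟦X⟧} (hl : Cong 1 l 0) :
    comul k A (hexp k l) = inl (k := k) (hexp k l) * inr (k := k) (hexp k l) ↔
      ∀ n, coeff n l ∈ prims k A := by
  have h1 : Cong 1 (inl (k := k) l : (A ⊗[k] A)⟦X⟧) 0 := by simpa using hl.map (inl (k := k))
  have h2 : Cong 1 (inr (k := k) l : (A ⊗[k] A)⟦X⟧) 0 := by simpa using hl.map (inr (k := k))
  have h3 : Cong 1 (comul k A l) 0 := by simpa using hl.map (comul k A)
  rw [map_hexp _ hl, map_hexp _ hl, map_hexp _ hl, ← hexp_add h1 h2 (commute_inl_inr l l)]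
  have h4 : Cong 1 (inl (k := k) l + inr (k := k) l : (A ⊗[k] A)⟦X⟧) 0 := by simpa using h1.add h2
  have h5 : comul k A l = inl (k := k) l + inr (k := k) l ↔ ∀ n, coeff n l ∈ prims k A := by
    rw [PowerSeries.ext_iff]
    refine forall_congr' fun n => ?_
    rw [coeff_comul, map_add, inl, inr, coeff_mapₐ, coeff_mapₐ, mem_prims]
    rfl
  rw [← h5]
  exact ⟨fun h => hexp_injective h3 h4 h, fun h => by rw [h]⟩

/-- The retraction `exp ∘ e ∘ log` of the central units of counit `1` onto the central group-like
elements, where `e` is the projection onto the primitive elements. -/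
noncomputable def retract (u : A⟦X⟧ˣ) : A⟦X⟧ˣ :=
  hexpUnit k (coeffMap (primProj hA) (hlog k (u : A⟦X⟧))) (cong_coeffMap _ (hlog_cong _))

theorem retract_val (u : A⟦X⟧ˣ) :
    (retract hA u : A⟦X⟧) = hexp k (coeffMap (primProj hA) (hlog k (u : A⟦X⟧))) := rfl

theorem retract_mem (u : A⟦X⟧ˣ) : retract hA u ∈ groupLike k A := by
  refine (comul_hexp (cong_coeffMap _ (hlog_cong _))).2 fun n => ?_
  rw [coeff_coeffMap]
  exact primProj_mem hA _

theorem retract_central {u : unitsOne k A} (hu : u ∈ centralUnits k A) (x : A⟦X⟧) :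
    Commute (retract hA (u : A⟦X⟧ˣ) : A⟦X⟧) x := by
  refine commute_hexp (k := k) (cong_coeffMap _ (hlog_cong _)) (commute_of_coeff (fun n b => ?_) x)
  rw [coeff_coeffMap]
  refine primProj_central hA (fun a => ?_) b
  exact (commute_coeff (hlog_central (cong_one_of_mem hA u) hu (C a)).symm n).symm

/-- Centrality of `u` makes the logarithms commute and hence add; its projected logarithm is again
central, so the final exponentials multiply. -/
theorem retract_mul {u : unitsOne k A} (hu : u ∈ centralUnits k A) (v : unitsOne k A) :
    retract hA ((u * v : unitsOne k A) : A⟦X⟧ˣ) =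
      retract hA (u : A⟦X⟧ˣ) * retract hA (v : A⟦X⟧ˣ) := by
  have hu1 := cong_one_of_mem hA u
  have hv1 := cong_one_of_mem hA v
  have h : hlog k (((u * v : unitsOne k A) : A⟦X⟧ˣ) : A⟦X⟧) =
      hlog k ((u : A⟦X⟧ˣ) : A⟦X⟧) + hlog k ((v : A⟦X⟧ˣ) : A⟦X⟧) := by
    have e := hexp_add (k := k) (hlog_cong (k := k) ((u : A⟦X⟧ˣ) : A⟦X⟧))
      (hlog_cong (k := k) ((v : A⟦X⟧ˣ) : A⟦X⟧)) (hlog_central (k := k) hu1 hu _)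
    rw [hexp_hlog hu1, hexp_hlog hv1] at e
    rw [Subgroup.coe_mul, Units.val_mul, ← e, hlog_hexp]
    simpa using (hlog_cong (k := k) ((u : A⟦X⟧ˣ) : A⟦X⟧)).add (hlog_cong ((v : A⟦X⟧ˣ) : A⟦X⟧))
  refine Units.ext ?_
  rw [Units.val_mul, retract_val, retract_val, retract_val, h, coeffMap_add]
  refine hexp_add (cong_coeffMap _ (hlog_cong _)) (cong_coeffMap _ (hlog_cong _)) ?_
  refine commute_of_coeff (fun n b => ?_) _
  rw [coeff_coeffMap]
  refine primProj_central hA (fun a => ?_) b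
  exact (commute_coeff (hlog_central hu1 hu (C a)).symm n).symm

theorem retract_eq_self {u : unitsOne k A} (hu : (u : A⟦X⟧ˣ) ∈ groupLike k A) :
    retract hA (u : A⟦X⟧ˣ) = u := by
  have hu1 := cong_one_of_mem hA u
  have h : coeffMap (primProj hA) (hlog k ((u : A⟦X⟧ˣ) : A⟦X⟧)) =
      hlog k ((u : A⟦X⟧ˣ) : A⟦X⟧) := by
    ext n
    rw [coeff_coeffMap]
    refine primProj_prim hA ((comul_hexp (hlog_cong _)).1 ?_ n)
    rw [hexp_hlog hu1]
    exact hu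
  refine Units.ext ?_
  rw [retract_val, h, hexp_hlog hu1]

theorem retract_unitsAct {g : AlgAut k A} (hg : g ∈ bialgAut k A) (u : unitsOne k A) :
    retract hA (unitsAct k A g (u : A⟦X⟧ˣ)) = unitsAct k A g (retract hA (u : A⟦X⟧ˣ)) := by
  refine Units.ext ?_
  have e := hlog_map (k := k) (g : A⟦X⟧ →ₐ[k⟦X⟧] A⟦X⟧) (cong_one_of_mem hA u)
  have e2 := map_hexp (k := k) (g : A⟦X⟧ →ₐ[k⟦X⟧] A⟦X⟧)
    (cong_coeffMap (primProj hA) (hlog_cong (k := k) ((u : A⟦X⟧ˣ) : A⟦X⟧)))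
  rw [unitsAct_val, retract_val, retract_val, unitsAct_val]
  refine Eq.trans ?_ e2.symm
  refine congrArg (hexp k) (Eq.trans (congrArg _ e) ?_)
  exact coeffMap_primProj_comm hA hg _

end retraction

end HAdic

/-! ### Module morphisms and comparison of choices -/

namespace CrossedModule

variable {P C P' C' : Type u} [Group P] [Group C] [Group P'] [Group C']
  {M : CrossedModule P C} {N : CrossedModule P' C'}

/-- The morphism of modules over `π₀` given by an equivariant homomorphism on `π₁`. -/
def repHom (p : M.Pi0 →* N.Pi0) (a : N.Pi1 →* M.Pi1)
    (h : ∀ x c, a (N.pi0Act (p x) c) = M.pi0Act x (a c)) : Rep.res p N.rep ⟶ M.rep :=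
  Rep.ofHom (ρ := N.rep.ρ.comp p) (σ := M.rep.ρ)
    { toFun c := Additive.ofMul (a (Additive.toMul (α := N.Pi1) c))
      map_add' c d := congrArg Additive.ofMul (map_mul a (Additive.toMul (α := N.Pi1) c) (Additive.toMul (α := N.Pi1) d))
      map_smul' n c := congrArg Additive.ofMul (map_zpow a (Additive.toMul (α := N.Pi1) c) n.down)
      isIntertwining' x := LinearMap.ext fun c => congrArg Additive.ofMul (h x (Additive.toMul (α := N.Pi1) c)) }

theorem repHom_bijective (p : M.Pi0 →* N.Pi0) (a : N.Pi1 →* M.Pi1)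
    (h : ∀ x c, a (N.pi0Act (p x) c) = M.pi0Act x (a c)) (ha : Function.Bijective a) :
    Function.Bijective (repHom p a h).hom := ha

theorem eq_mul_coboundary {G : Type*} [CommGroup G] {a b c d w₁ w₂ : G}
    (h : d * w₁ * a = c * b * w₂) : c = d * (a * b⁻¹ * w₁ * w₂⁻¹) := by
  have e : d * (a * b⁻¹ * w₁ * w₂⁻¹) = d * w₁ * a * (w₂⁻¹ * b⁻¹) := by
    simp only [mul_assoc, mul_comm, mul_left_comm]
  rw [e, h]
  group

theorem eq_mul_coboundary_inv {G : Type*} [CommGroup G] {a b c d w₁ w₂ : G}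
    (h : d * w₁ * a = c * b * w₂) : d = c * (a⁻¹ * b⁻¹⁻¹ * w₁⁻¹ * w₂⁻¹⁻¹) := by
  refine eq_mul_coboundary ?_
  rw [mul_inv_eq_iff_eq_mul, mul_inv_eq_iff_eq_mul, eq_mul_coboundary h]
  simp only [mul_assoc, mul_comm, mul_left_comm]

/-- Comparison of the associativity constraints of two choices related by conjugation. -/
theorem comparison {U : Type*} [Group U] {G₁ G₂ G₁₂ : MulAut U}
    {a₁ a₂ a₃ a₄ b₁ b₂ b₃ b₄ v₁ v₂ v₃ v₁₂ v₂₃ v z₁ z₂ z₃ z₄ c d : U}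
    (h₁ : a₁ * v₁ * G₁ v₂₃ = v * b₁ * z₁) (h₂ : a₂ * v₂ * G₂ v₃ = v₂₃ * b₂ * z₂)
    (h₃ : a₃ * v₁ * G₁ v₂ = v₁₂ * b₃ * z₃) (h₄ : a₄ * v₁₂ * G₁₂ v₃ = v * b₄ * z₄)
    (hc : a₁ * (v₁ * G₁ a₂ * v₁⁻¹) = c * a₄ * a₃) (hd : b₁ * G₁ b₂ = d * b₄ * b₃)
    (hG : ∀ u, G₁₂ u * b₃ = b₃ * G₁ (G₂ u)) (cz₁ : ∀ u, z₁ * u = u * z₁)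
    (cz₃ : ∀ u, z₃ * u = u * z₃) (cz₄ : ∀ u, z₄ * u = u * z₄) (cc : ∀ u, c * u = u * c)
    (cd : ∀ u, d * u = u * d) : d * z₁ * G₁ z₂ = c * z₄ * z₃ := by
  -- One element is rewritten in two ways, following the bracketings x(yz) and (xy)z. The central
  -- elements `z`, `c`, `d` are moved to the right and the common prefix is cancelled.
  have e₁ : a₁ * (v₁ * G₁ a₂ * v₁⁻¹) * (v₁ * G₁ v₂ * G₁ (G₂ v₃)) =
      v * b₄ * b₃ * (d * z₁ * G₁ z₂) := by
    calc _ = a₁ * v₁ * G₁ (a₂ * v₂ * G₂ v₃) := by simp only [map_mul]; group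
      _ = (a₁ * v₁ * G₁ v₂₃) * G₁ b₂ * G₁ z₂ := by rw [h₂]; simp only [map_mul, mul_assoc]
      _ = v * b₁ * (z₁ * G₁ b₂) * G₁ z₂ := by rw [h₁]; simp only [mul_assoc]
      _ = v * (b₁ * G₁ b₂) * z₁ * G₁ z₂ := by rw [cz₁]; simp only [mul_assoc]
      _ = v * (d * (b₄ * b₃)) * z₁ * G₁ z₂ := by rw [hd]; simp only [mul_assoc]
      _ = _ := by rw [cd]; simp only [mul_assoc]
  have e₂ : a₁ * (v₁ * G₁ a₂ * v₁⁻¹) * (v₁ * G₁ v₂ * G₁ (G₂ v₃)) =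
      v * b₄ * b₃ * (c * z₄ * z₃) := by
    calc _ = c * a₄ * (a₃ * v₁ * G₁ v₂) * G₁ (G₂ v₃) := by rw [hc]; simp only [mul_assoc]
      _ = c * a₄ * v₁₂ * b₃ * (z₃ * G₁ (G₂ v₃)) := by rw [h₃]; simp only [mul_assoc]
      _ = c * a₄ * v₁₂ * (b₃ * G₁ (G₂ v₃)) * z₃ := by rw [cz₃]; simp only [mul_assoc]
      _ = c * (a₄ * v₁₂ * G₁₂ v₃) * b₃ * z₃ := by rw [← hG]; simp only [mul_assoc]
      _ = c * (v * b₄ * (z₄ * b₃) * z₃) := by rw [h₄]; simp only [mul_assoc]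
      _ = v * b₄ * b₃ * z₄ * z₃ * c := by rw [cz₄, cc]; simp only [mul_assoc]
      _ = _ := by rw [mul_assoc c, cc]; simp only [mul_assoc]
  exact mul_left_cancel (e₁.symm.trans e₂)

end CrossedModule

namespace HAdic

open PowerSeries
open scoped TensorProduct

/-! ### The projection onto outer bialgebra automorphisms -/

section projection
variable {k : Type u} [Field k] {A : Type w} [Ring A] [Bialgebra k A]

theorem conjAut_eq_one_iff {u : A⟦X⟧ˣ} :
    conjAut k u = 1 ↔ ∀ x, Commute (u : A⟦X⟧) x := by
  refine ⟨fun h x => ?_, fun h => ?_⟩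
  · have := DFunLike.congr_fun h x
    rw [conjAut_apply, Units.mul_inv_eq_iff_eq_mul] at this
    exact this
  · ext1 x
    rw [conjAut_apply, Units.mul_inv_eq_iff_eq_mul]
    exact h x

/-- The first component of ∂(u) is trivial when `u` is central, and the second when `u` is
group-like. This is also the kernel for bialgebra automorphisms, whence the isomorphism on π₁. -/
theorem mem_ker_bd {u : unitsOne k A} : u ∈ (twCrossed k A).bd.ker ↔
    u ∈ centralUnits k A ∧ (u : A⟦X⟧ˣ) ∈ groupLike k A := by
  rw [MonoidHom.mem_ker, bd_eq_inner, mem_groupLike]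
  have h : (TwAut.inner u).F = 1 ↔ comulUnit (k := k) (u : A⟦X⟧ˣ) = dbl (u : A⟦X⟧ˣ) := by
    rw [TwAut.inner_F, mul_inv_eq_one, eq_comm]
  rw [← h]
  exact ⟨fun h => ⟨conjAut_eq_one_iff.1 (congrArg TwAut.f h), congrArg TwAut.F h⟩,
    fun h => TwAut.ext (conjAut_eq_one_iff.2 h.1) h.2⟩

theorem incl_pi1_bijective : Function.Bijective (incl k A).pi1 := by
  refine ⟨fun c d h => ?_, fun c => ?_⟩
  · have h1 : (((incl k A).pi1 c : unitsOne k A) : A⟦X⟧ˣ) = ((incl k A).pi1 d : unitsOne k A) := by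
      rw [h]
    exact Subtype.ext (Subtype.ext h1)
  · obtain ⟨h1, h2⟩ := mem_ker_bd.1 c.2
    exact ⟨⟨⟨_, h2⟩, Subtype.ext (conjAut_eq_one_iff.2 h1)⟩, rfl⟩

variable (k A) in
/-- The isomorphism between the groups `π₁` of the two crossed modules. -/
noncomputable def pi1Equiv : (bialgCrossed k A).Pi1 ≃* (twCrossed k A).Pi1 :=
  MulEquiv.ofBijective (incl k A).pi1 incl_pi1_bijective

theorem pi1Equiv_apply (c : (bialgCrossed k A).Pi1) : pi1Equiv k A c = (incl k A).pi1 c := rfl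

variable (k A) in
/-- The action of the bialgebra automorphisms on the units of counit `1`. -/
noncomputable def bialgAct : bialgAut k A →* MulAut (unitsOne k A) :=
  (twCrossed k A).act.comp TwAut.ofBialg

theorem bialgAct_val (g : bialgAut k A) (u : unitsOne k A) :
    (bialgAct k A g u : A⟦X⟧ˣ) = unitsAct k A g u := rfl

theorem bialgAct_mem_centralUnits (g : bialgAut k A) {u : unitsOne k A}
    (hu : u ∈ centralUnits k A) : bialgAct k A g u ∈ centralUnits k A := by
  refine conjAut_eq_one_iff (k := k).1 ?_
  rw [bialgAct_val, conjAut_unitsAct, conjAut_eq_one_iff.2 hu, mul_one, mul_inv_cancel]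

/-- Pairs (v, g) compose as in a semidirect product; this makes the projection multiplicative. -/
theorem conjAut_bialgAct (v w : unitsOne k A) (g h : bialgAut k A) :
    conjAut k (v : A⟦X⟧ˣ) * g * (conjAut k (w : A⟦X⟧ˣ) * h) =
      conjAut k ((v * bialgAct k A g w : unitsOne k A) : A⟦X⟧ˣ) * (g * h : bialgAut k A) := by
  rw [Subgroup.coe_mul, conjAut_mul, bialgAct_val, conjAut_unitsAct, Subgroup.coe_mul]
  group

theorem act_of_f_eq {t : TwAut k A} {v : unitsOne k A} {g : bialgAut k A}
    (h : t.f = conjAut k (v : A⟦X⟧ˣ) * g) (u : unitsOne k A) :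
    (twCrossed k A).act t u = v * bialgAct k A g u * v⁻¹ := by
  refine Subtype.ext (Units.ext ?_)
  exact DFunLike.congr_fun h ((u : A⟦X⟧ˣ) : A⟦X⟧)

theorem conjAut_one : conjAut k (1 : A⟦X⟧ˣ) = 1 :=
  conjAut_eq_one_iff.2 fun x => Commute.one_left x

variable (k A) in
/-- The characterization of the projection onto `π₀` of the bialgebra automorphisms. -/
def IsRetraction (p : (twCrossed k A).Pi0 →* (bialgCrossed k A).Pi0) : Prop :=
  (∀ x, p ((incl k A).pi0 x) = x) ∧
    ∀ y, p y = 1 ↔ ∃ t : TwAut k A, t.f = 1 ∧ (t : (twCrossed k A).Pi0) = y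

theorem mk_inner (u : unitsOne k A) : (TwAut.inner u : (twCrossed k A).Pi0) = 1 :=
  (QuotientGroup.eq_one_iff _).2 ⟨u, rfl⟩

theorem exists_invariant {t : TwAut k A} {v : unitsOne k A} {g : bialgAut k A}
    (h : t.f = conjAut k (v : A⟦X⟧ˣ) * g) : ∃ s : TwAut k A, s.f = 1 ∧
      (t : (twCrossed k A).Pi0) = s * (incl k A).pi0 (g : (bialgCrossed k A).Pi0) := by
  refine ⟨(TwAut.inner v)⁻¹ * t * (TwAut.ofBialg g)⁻¹, ?_, ?_⟩
  · rw [TwAut.mul_f, TwAut.mul_f, h, TwAut.inv_f, TwAut.inv_f]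
    change (conjAut k (v : A⟦X⟧ˣ))⁻¹ * (conjAut k (v : A⟦X⟧ˣ) * g) * (g : AlgAut k A)⁻¹ = 1
    rw [inv_mul_cancel_left, mul_inv_cancel]
  · change _ = _ * (TwAut.ofBialg g : (twCrossed k A).Pi0)
    rw [QuotientGroup.mk_mul, QuotientGroup.mk_mul, QuotientGroup.mk_inv, QuotientGroup.mk_inv,
      mk_inner, inv_one, one_mul, inv_mul_cancel_right]

/-- Modulo an inner twisted automorphism `t` is an invariant twist times (g, 1). The two conditions
on `p` therefore leave no choice for its value. -/
theorem IsRetraction.apply_eq {p : (twCrossed k A).Pi0 →* (bialgCrossed k A).Pi0}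
    (hp : IsRetraction k A p) {t : TwAut k A} {v : unitsOne k A} {g : bialgAut k A}
    (h : t.f = conjAut k (v : A⟦X⟧ˣ) * g) : p t = g := by
  obtain ⟨s, hs, e⟩ := exists_invariant h
  rw [e, map_mul, (hp.2 s).2 ⟨s, hs, rfl⟩, one_mul, hp.1]

variable [CharZero k] (hA : PrimGen k A)

include hA in
/-- Every twisted automorphism is the composition of an inner automorphism and an automorphism
of bialgebras, up to its twist. -/
theorem TwAut.exists_f_eq (t : TwAut k A) : ∃ (v : unitsOne k A) (g : bialgAut k A),
    t.f = conjAut k (v : A⟦X⟧ˣ) * g := by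
  obtain ⟨P, hP⟩ := t.exists_conj_mem_bialgAut hA
  refine ⟨P⁻¹, ⟨_, hP⟩, ?_⟩
  rw [← mul_assoc, ← conjAut_mul, ← Subgroup.coe_mul, inv_mul_cancel]
  ext1 x
  simp [conjAut_apply]

-- Well-definedness of the projection: two decompositions differ by an inner automorphism that
-- respects the bialgebra structure, and this is conjugation by a group-like element.
include hA in
theorem mk_eq_of_conjAut_eq {v w : unitsOne k A} {g h : bialgAut k A}
    (e : conjAut k (v : A⟦X⟧ˣ) * g = conjAut k (w : A⟦X⟧ˣ) * h) :
    (g : (bialgCrossed k A).Pi0) = h := by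
  have e1 : conjAut k ((w⁻¹ * v : unitsOne k A) : A⟦X⟧ˣ) = (h * g⁻¹ : bialgAut k A) := by
    have e2 : conjAut k (w : A⟦X⟧ˣ) * conjAut k ((w⁻¹ * v : unitsOne k A) : A⟦X⟧ˣ) =
        conjAut k (v : A⟦X⟧ˣ) := by
      rw [← conjAut_mul, ← Subgroup.coe_mul, mul_inv_cancel_left]
    rw [Subgroup.coe_mul (bialgAut k A), Subgroup.coe_inv (bialgAut k A),
      _root_.eq_mul_inv_iff_mul_eq, ← mul_right_inj (conjAut k (w : A⟦X⟧ˣ)), ← mul_assoc, e2, e]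
  obtain ⟨z, hz, hu⟩ := exists_central_mul_mem_groupLike hA (w⁻¹ * v) (e1 ▸ (h * g⁻¹).2)
  refine Eq.symm (QuotientGroup.eq_iff_div_mem.2 ⟨⟨_, hu⟩, Subtype.ext ?_⟩)
  rw [div_eq_mul_inv]
  exact (conjAut_mul_of_central hz).trans e1

/-- The class of the bialgebra automorphism underlying a twisted automorphism. -/
noncomputable def TwAut.proj : TwAut k A →* (bialgCrossed k A).Pi0 :=
  MonoidHom.mk' (fun t => ((t.exists_f_eq hA).choose_spec.choose : (bialgCrossed k A).Pi0))
    fun t s => by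
      have h1 := (t.exists_f_eq hA).choose_spec.choose_spec
      have h2 := (s.exists_f_eq hA).choose_spec.choose_spec
      have h3 := ((t * s).exists_f_eq hA).choose_spec.choose_spec
      refine mk_eq_of_conjAut_eq hA (h3.symm.trans ((congrArg₂ (· * ·) h1 h2).trans
        (conjAut_bialgAct _ _ _ _)))

theorem TwAut.proj_eq {t : TwAut k A} {v : unitsOne k A} {g : bialgAut k A}
    (h : t.f = conjAut k (v : A⟦X⟧ˣ) * g) : TwAut.proj hA t = g :=
  mk_eq_of_conjAut_eq hA ((t.exists_f_eq hA).choose_spec.choose_spec.symm.trans h)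

/-- The projection of `π₀` of the twisted automorphisms onto `π₀` of the bialgebra
automorphisms. -/
noncomputable def outProj : (twCrossed k A).Pi0 →* (bialgCrossed k A).Pi0 :=
  QuotientGroup.lift _ (TwAut.proj hA) (by
    rintro _ ⟨u, rfl⟩
    exact TwAut.proj_eq hA (g := 1) (mul_one _).symm)

theorem isRetraction_outProj : IsRetraction k A (outProj hA) := by
  refine ⟨fun x => ?_, fun y => ⟨fun h => ?_, ?_⟩⟩
  · obtain ⟨g, rfl⟩ := QuotientGroup.mk_surjective x
    refine TwAut.proj_eq hA (t := TwAut.ofBialg g) (v := 1) ?_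
    rw [Subgroup.coe_one, conjAut_one, one_mul]
    rfl
  · obtain ⟨t, rfl⟩ := QuotientGroup.mk_surjective y
    obtain ⟨v, g, hg⟩ := t.exists_f_eq hA
    have h1 : (g : (bialgCrossed k A).Pi0) = 1 := (TwAut.proj_eq hA hg).symm.trans h
    obtain ⟨s, hs, e⟩ := exists_invariant hg
    exact ⟨s, hs, by rw [e, h1, map_one, mul_one]⟩
  · rintro ⟨t, ht, rfl⟩
    refine TwAut.proj_eq hA (t := t) (v := 1) (g := 1) ?_
    rw [ht, Subgroup.coe_one, conjAut_one, one_mul]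
    rfl

include hA in
theorem existsUnique_isRetraction : ∃! p, IsRetraction k A p := by
  refine ⟨outProj hA, isRetraction_outProj hA, fun p hp => MonoidHom.ext fun y => ?_⟩
  obtain ⟨t, rfl⟩ := QuotientGroup.mk_surjective y
  obtain ⟨v, g, hg⟩ := t.exists_f_eq hA
  rw [hp.apply_eq hg, (isRetraction_outProj hA).apply_eq hg]

-- The representative `g` of the class can be prescribed: two representatives differ by conjugation
-- by a group-like element, which is absorbed into `v`. It allows both sections to be chosen
-- beforehand.
include hA in
theorem IsRetraction.exists_f_eq {p : (twCrossed k A).Pi0 →* (bialgCrossed k A).Pi0}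
    (hp : IsRetraction k A p) (t : TwAut k A) {g : bialgAut k A}
    (hg : (g : (bialgCrossed k A).Pi0) = p t) :
    ∃ v : unitsOne k A, t.f = conjAut k (v : A⟦X⟧ˣ) * g := by
  obtain ⟨v, g', h⟩ := t.exists_f_eq hA
  rw [hp.apply_eq h, eq_comm] at hg
  obtain ⟨u, hu⟩ := QuotientGroup.eq_iff_div_mem.1 hg
  have hu' : conjAut k (u : A⟦X⟧ˣ) * g = (g' : AlgAut k A) := by
    rw [eq_div_iff_mul_eq'] at hu
    exact congrArg Subtype.val hu
  refine ⟨v * ⟨u, groupLike_le u.2⟩, ?_⟩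
  rw [h, Subgroup.coe_mul, conjAut_mul, mul_assoc, hu']

-- Conjugation by `v` is trivial on central elements, so only the bialgebra part of `t` acts on π₁.
include hA in
theorem IsRetraction.pi1_pi0Act {p : (twCrossed k A).Pi0 →* (bialgCrossed k A).Pi0}
    (hp : IsRetraction k A p) (x : (twCrossed k A).Pi0) (c : (bialgCrossed k A).Pi1) :
    (incl k A).pi1 ((bialgCrossed k A).pi0Act (p x) c) =
      (twCrossed k A).pi0Act x ((incl k A).pi1 c) := by
  obtain ⟨t, rfl⟩ := QuotientGroup.mk_surjective x
  obtain ⟨v, g, hg⟩ := t.exists_f_eq hA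
  rw [hp.apply_eq hg]
  refine Subtype.ext ?_
  change bialgAct k A g ((incl k A).pi1 c) = (twCrossed k A).act t ((incl k A).pi1 c)
  have hc := (mem_ker_bd.1 ((incl k A).pi1 c).2).1
  rw [act_of_f_eq hg, _root_.eq_mul_inv_iff_mul_eq]
  exact Subtype.ext (Units.ext (bialgAct_mem_centralUnits g hc _))

end projection

/-! ### Comparison of the associators -/

section associators
variable {k : Type u} [Field k] {A : Type w} [Ring A] [Bialgebra k A] [CharZero k]
  (hA : PrimGen k A) {p : (twCrossed k A).Pi0 →* (bialgCrossed k A).Pi0}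
  (hp : IsRetraction k A p)
include hA hp

/-- The cocycles of choices for the two crossed modules differ by the coboundary of a cochain
with values in the central units. -/
theorem IsRetraction.exists_central_cochain (D : (twCrossed k A).Choice)
    (E : (bialgCrossed k A).Choice) :
    ∃ ζ : (twCrossed k A).Pi0 → (twCrossed k A).Pi0 → unitsOne k A,
      (∀ x y, ζ x y ∈ centralUnits k A) ∧ ∀ x y z,
      ((incl k A).pi1 (E.cochain (p x) (p y) (p z)) : unitsOne k A) * ζ x (y * z) *
        bialgAct k A (E.sec (p x)) (ζ y z) =
      (D.cochain x y z : unitsOne k A) * ζ (x * y) z * ζ x y := by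
  choose v hv using fun x => hp.exists_f_eq hA (D.sec x) (g := E.sec (p x))
    (by rw [E.mk_sec, D.mk_sec])
  let G := fun x => bialgAct k A (E.sec (p x))
  let b : (twCrossed k A).Pi0 → (twCrossed k A).Pi0 → unitsOne k A :=
    fun x y => (incl k A).mor (E.a (p x) (p y))
  -- The discrepancy between the elements `a` of the two choices, after transport along the units
  -- `v`.
  let ζ := fun x y => (v (x * y) * b x y)⁻¹ * (D.a x y * v x * G x (v y))
  have hζ : ∀ x y, D.a x y * v x * G x (v y) = v (x * y) * b x y * ζ x y := fun x y =>
    (mul_inv_cancel_left _ _).symm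
  have hsec : ∀ x y, E.sec (p (x * y)) =
      (bialgCrossed k A).bd (E.a (p x) (p y)) * E.sec (p x) * E.sec (p y) := fun x y => by
    rw [map_mul, E.sec_mul]
  have hbd : ∀ u : groupLike k A, (((bialgCrossed k A).bd u : bialgAut k A) : AlgAut k A) =
      conjAut k ((incl k A).mor u : A⟦X⟧ˣ) := fun _ => rfl
  have hcen : ∀ x y, ζ x y ∈ centralUnits k A := by
    intro x y
    refine conjAut_eq_one_iff (k := k).1 ?_
    -- Both units relate the same automorphism, the first component of the section at xy, to the
    -- product of the two bialgebra automorphisms. They induce the same conjugation, so their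
    -- quotient is central.
    have h1 : conjAut k ((D.a x y * v x * G x (v y) : unitsOne k A) : A⟦X⟧ˣ) =
        conjAut k ((v (x * y) * b x y : unitsOne k A) : A⟦X⟧ˣ) := by
      have h2 := congrArg TwAut.f (D.sec_mul x y)
      rw [TwAut.mul_f, TwAut.mul_f, bd_eq_inner, hv, hv, hv, mul_assoc, conjAut_bialgAct,
        hsec] at h2
      change _ = conjAut k ((D.a x y : unitsOne k A) : A⟦X⟧ˣ) * _ at h2
      rw [Subgroup.coe_mul (bialgAut k A), Subgroup.coe_mul (bialgAut k A), mul_assoc,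
        Subgroup.coe_mul (bialgAut k A), hbd] at h2
      simp only [← mul_assoc] at h2
      rw [mul_left_inj, mul_left_inj] at h2
      rw [mul_assoc, Subgroup.coe_mul, conjAut_mul, ← h2, Subgroup.coe_mul, conjAut_mul]
    rw [hζ, Subgroup.coe_mul, conjAut_mul, mul_eq_left] at h1
    exact h1
  have comm : ∀ {u : unitsOne k A}, u ∈ centralUnits k A → ∀ w, u * w = w * u :=
    fun hu w => Subtype.ext (Units.ext (hu _))
  refine ⟨ζ, hcen, fun x y z => ?_⟩
  have h1 := hζ x (y * z)
  have h4 := hζ (x * y) z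
  rw [mul_assoc x y z] at h4
  refine CrossedModule.comparison h1 (hζ y z) (hζ x y) h4 ?_ ?_ (fun u => ?_)
    (comm (hcen _ _)) (comm (hcen _ _)) (comm (hcen _ _))
    (comm (mem_ker_bd.1 (D.cochain x y z).2).1)
    (comm (mem_ker_bd.1 ((incl k A).pi1 (E.cochain (p x) (p y) (p z))).2).1)
  · rw [← act_of_f_eq (hv x)]
    exact D.cochain_spec x y z
  · have := congrArg (incl k A).mor (E.cochain_spec (p x) (p y) (p z))
    rw [map_mul, map_mul, map_mul, ← map_mul p, ← map_mul p] at this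
    exact this
  · change bialgAct k A (E.sec (p (x * y))) u * _ = _
    rw [hsec, map_mul, map_mul, MulAut.mul_apply, MulAut.mul_apply]
    refine Subtype.ext (Units.ext ?_)
    change ((b x y : A⟦X⟧ˣ) : A⟦X⟧) * _ * (↑(b x y : A⟦X⟧ˣ)⁻¹ : A⟦X⟧) * (b x y : A⟦X⟧ˣ) = _
    rw [Units.inv_mul_cancel_right]
    rfl

/-- The cocycles of choices for the two crossed modules differ by a coboundary. -/
theorem IsRetraction.exists_cochain (D : (twCrossed k A).Choice) (E : (bialgCrossed k A).Choice) :
    ∃ ω : (twCrossed k A).Pi0 → (twCrossed k A).Pi0 → (twCrossed k A).Pi1, ∀ x y z,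
      (incl k A).pi1 (E.cochain (p x) (p y) (p z)) * ω x (y * z) *
        (twCrossed k A).pi0Act x (ω y z) = D.cochain x y z * ω (x * y) z * ω x y := by
  obtain ⟨ζ, hζ, h⟩ := hp.exists_central_cochain hA D E
  have hmem : ∀ {u : unitsOne k A}, u ∈ centralUnits k A →
      (⟨retract hA (u : A⟦X⟧ˣ), groupLike_le (retract_mem hA u)⟩ : unitsOne k A) ∈
        (twCrossed k A).bd.ker := fun {u} hu =>
    mem_ker_bd.2 ⟨retract_central hA hu, retract_mem hA (u : A⟦X⟧ˣ)⟩
  -- Retracting turns the cochain of central units into one with values in π₁. The two cocycles are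
  -- already group-like and are fixed, so the relation between them survives.
  let ω := fun x y => (⟨_, hmem (hζ x y)⟩ : (twCrossed k A).Pi1)
  refine ⟨ω, fun x y z => ?_⟩
  have hc := mem_ker_bd.1 (D.cochain x y z).2
  have hd := mem_ker_bd.1 ((incl k A).pi1 (E.cochain (p x) (p y) (p z))).2
  -- The retraction is equivariant for bialgebra automorphisms, and x acts on π₁ through the
  -- bialgebra automorphism chosen for p(x).
  have hact : (((twCrossed k A).pi0Act x (ω y z) : unitsOne k A) : A⟦X⟧ˣ) =
      retract hA (bialgAct k A (E.sec (p x)) (ζ y z) : A⟦X⟧ˣ) := by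
    obtain ⟨c, hc⟩ := (incl_pi1_bijective (k := k) (A := A)).2 (ω y z)
    rw [bialgAct_val, retract_unitsAct hA (E.sec (p x)).2, ← hc,
      ← hp.pi1_pi0Act hA]
    change (((bialgCrossed k A).pi0Act (p x) c : groupLike k A) : A⟦X⟧ˣ) = _
    rw [E.pi0Act_val]
    exact congrArg (fun c : (twCrossed k A).Pi1 =>
      unitsAct k A (E.sec (p x)) ((c : unitsOne k A) : A⟦X⟧ˣ)) hc
  have h' := congrArg (fun u : unitsOne k A => retract hA (u : A⟦X⟧ˣ)) (h x y z)
  simp only [retract_mul hA (mul_mem hd.1 (hζ _ _)), retract_mul hA hd.1,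
    retract_mul hA (mul_mem hc.1 (hζ _ _)), retract_mul hA hc.1, retract_eq_self hA hc.2,
    retract_eq_self hA hd.2] at h'
  refine Subtype.ext (Subtype.ext (Eq.trans ?_ h'))
  rw [← hact]
  rfl

theorem IsRetraction.symm_pi0Act (x : (bialgCrossed k A).Pi0) (c : (twCrossed k A).Pi1) :
    (pi1Equiv k A).symm ((twCrossed k A).pi0Act ((incl k A).pi0 x) c) =
      (bialgCrossed k A).pi0Act x ((pi1Equiv k A).symm c) := by
  have h := hp.pi1_pi0Act hA ((incl k A).pi0 x) ((pi1Equiv k A).symm c)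
  rw [hp.1 x, ← pi1Equiv_apply, ← pi1Equiv_apply, MulEquiv.apply_symm_apply] at h
  rw [← h, MulEquiv.symm_apply_apply]

theorem IsRetraction.associator_eq (D : (twCrossed k A).Choice) (E : (bialgCrossed k A).Choice) :
    CrossedModule.associator D = groupCohomology.map p
      (CrossedModule.repHom p (incl k A).pi1 (hp.pi1_pi0Act hA)) 3
      (CrossedModule.associator E) := by
  obtain ⟨ω, hω⟩ := hp.exists_cochain hA D E
  exact CrossedModule.associator_eq_map D E p _ _ (fun c => rfl) ω fun x y z =>
    CrossedModule.eq_mul_coboundary (hω x y z)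

theorem IsRetraction.associator_eq_map_incl (D : (twCrossed k A).Choice) (E : (bialgCrossed k A).Choice) :
    CrossedModule.associator E = groupCohomology.map (incl k A).pi0
      (CrossedModule.repHom (incl k A).pi0 (pi1Equiv k A).symm.toMonoidHom
        (hp.symm_pi0Act hA)) 3 (CrossedModule.associator D) := by
  obtain ⟨ω, hω⟩ := hp.exists_cochain hA D E
  refine CrossedModule.associator_eq_map E D _ _ (pi1Equiv k A).symm (fun c => rfl)
    -- The cochain is the pullback of `ω`, inverted because the roles of the two cocycles are
    -- exchanged.
    (fun x y => ((pi1Equiv k A).symm (ω ((incl k A).pi0 x) ((incl k A).pi0 y)))⁻¹)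
    fun x y z => ?_
  have h := congrArg (pi1Equiv k A).symm
    (hω ((incl k A).pi0 x) ((incl k A).pi0 y) ((incl k A).pi0 z))
  rw [hp.1, hp.1, hp.1, ← pi1Equiv_apply] at h
  simp only [map_mul, MulEquiv.symm_apply_apply, hp.symm_pi0Act hA] at h
  rw [map_inv, map_mul, map_mul]
  exact CrossedModule.eq_mul_coboundary_inv h

end associators

/-! ### Enveloping algebras -/

section enveloping
variable (k : Type u) [Field k] (g : Type v) [LieRing g] [LieAlgebra k g]

attribute [local instance 100] LieRing.ofAssociativeRing

theorem ι_mem_prims (x : g) :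
    UniversalEnvelopingAlgebra.ι k x ∈ prims k (UniversalEnvelopingAlgebra k g) :=
  mem_prims.2 (UniversalEnvelopingAlgebra.lift_ι_apply k (primitive k g) x)

/-- Enveloping algebras are generated by their primitive elements. -/
theorem primGen_enveloping : PrimGen k (UniversalEnvelopingAlgebra k g) := by
  let S := Algebra.adjoin k (prims k (UniversalEnvelopingAlgebra k g) :
    Set (UniversalEnvelopingAlgebra k g))
  have hS : ∀ x : g, UniversalEnvelopingAlgebra.ι k x ∈ S := fun x =>
    Algebra.subset_adjoin (ι_mem_prims k g x)
  -- By the universal property, the identity factors through the subalgebra generated by the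
  -- primitive elements.
  let l : g →ₗ⁅k⁆ S :=
    { toFun x := ⟨UniversalEnvelopingAlgebra.ι k x, hS x⟩
      map_add' x y := Subtype.ext (map_add _ x y)
      map_smul' c x := Subtype.ext (map_smul _ c x)
      map_lie' {x y} := Subtype.ext (LieHom.map_lie _ x y) }
  have h : S.val.comp (UniversalEnvelopingAlgebra.lift k l) = AlgHom.id k _ :=
    enveloping_hom_ext k g fun x =>
      congrArg S.val (UniversalEnvelopingAlgebra.lift_ι_apply k l x)
  refine eq_top_iff.2 fun x _ => ?_
  have := DFunLike.congr_fun h x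
  rw [← AlgHom.id_apply (R := k) x, ← this]
  exact (UniversalEnvelopingAlgebra.lift k l x).2

end enveloping

end HAdic

/-! ### The theorem for U(g)⟦h⟧ -/

theorem mainTheorem4 (k : Type u) [Field k] [IsAlgClosed k] [CharZero k]
    (g : Type v) [LieRing g] [LieAlgebra k g] :
    (∃! p : (HAdic.twU k g).Pi0 →* (HAdic.bialgU k g).Pi0, HAdic.IsProjection p) ∧
    (∀ p : (HAdic.twU k g).Pi0 →* (HAdic.bialgU k g).Pi0, HAdic.IsProjection p →
      ∃ α : Rep.res p (HAdic.bialgU k g).rep ⟶ (HAdic.twU k g).rep,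
        (∀ c : (HAdic.bialgU k g).Pi1,
          α.hom (Additive.ofMul c) = Additive.ofMul ((HAdic.inclU k g).pi1 c)) ∧
        Function.Bijective α.hom ∧
        ∀ (D : (HAdic.twU k g).Choice) (E : (HAdic.bialgU k g).Choice),
          CrossedModule.associator D =
            groupCohomology.map p α 3 (CrossedModule.associator E)) ∧
    (∃ β : Rep.res (HAdic.inclU k g).pi0 (HAdic.twU k g).rep ⟶ (HAdic.bialgU k g).rep,
      (∀ c : (HAdic.bialgU k g).Pi1,
        β.hom (Additive.ofMul ((HAdic.inclU k g).pi1 c)) = Additive.ofMul c) ∧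
      Function.Bijective β.hom ∧
      ∀ (D : (HAdic.twU k g).Choice) (E : (HAdic.bialgU k g).Choice),
        CrossedModule.associator E =
          groupCohomology.map (HAdic.inclU k g).pi0 β 3 (CrossedModule.associator D)) := by
  have hA := HAdic.primGen_enveloping k g
  refine ⟨HAdic.existsUnique_isRetraction hA, fun p hp => ?_, ?_⟩
  · have hp' : HAdic.IsRetraction k (UniversalEnvelopingAlgebra k g) p := hp
    exact ⟨_, fun c => rfl, CrossedModule.repHom_bijective _ _ _ HAdic.incl_pi1_bijective,
      hp'.associator_eq hA⟩
  -- The third claim does not mention p, but its proof pulls back along i the identity of cocycles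
  -- attached to a projection, so one is supplied here.
  · have hp := HAdic.isRetraction_outProj hA
    exact ⟨_, fun c => congrArg Additive.ofMul
        ((HAdic.pi1Equiv k (UniversalEnvelopingAlgebra k g)).symm_apply_apply c),
      CrossedModule.repHom_bijective _ _ _ (HAdic.pi1Equiv k _).symm.bijective,
      hp.associator_eq_map_incl hA⟩
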